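/- Let $A\in\mathbb R^{m\times m}$, $B\in\mathbb R^{m\times d}$, $C\in\mathbb R^{l\times m}$, $D\in\mathbb R^{m\times n}$, $E\in\mathbb R^{l\times d}$ and $\gamma>0$, with $E^\top C=0$, $R:=E^\top E>0$ and $DD^\top>0$. Norms of matrices are operator norms. For $K\in\mathbb R^{d\times m}$ let $\mathcal T(K)(z)=(C^\top C+K^\top RK)^{1/2}(zI-A+BK)^{-1}D$, $\|\mathcal T(K)\|_\infty=\sup_{\theta\in[0,2\pi)}\sigma_{\max}\big(\mathcal T(K)(e^{i\theta})\big)$, and $$\mathcal K=\{K:\ \rho(A-BK)<1,\ \|\mathcal T(K)\|_\infty<\gamma\}.$$ For $K\in\mathcal K$ let $P_K\ge 0$ be the unique stabilizing solution of $$(A-BK)^\top\tilde P_K(A-BK)+C^\top C+K^\top RK-P_K=0,\qquad \tilde P_K=P_K+P_KD(\gamma^2I-D^\top P_KD)^{-1}D^\top P_K,$$ that is, the one with $I-\gamma^{-2}D^\top P_KD>0$ and $\rho\big((I-\gamma^{-2}P_KDD^\top)^{-\top}(A-BK)\big)<1$. Put $$\mathcal J(K)=-\gamma^2\log\det(I-\gamma^{-2}P_KDD^\top),\qquad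 E_K=(R+B^\top\tilde P_KB)K-B^\top\tilde P_KA.$$ Assume that $\mathcal J$ has a global minimizer over $\mathcal K$ in $\mathcal K$, and let $K^*\in\mathcal K$ be one. Then $K^*=(R+B^\top\tilde P_{K^*}B)^{-1}B^\top\tilde P_{K^*}A$. Consider the updates $$\text{(natural PG)}\quad K_{k+1}=K_k-2\eta E_{K_k},\qquad \text{(Gauss–Newton)}\quad K_{k+1}=K_k-2\eta(R+B^\top\tilde P_{K_k}B)^{-1}E_{K_k}.$$ (i) Local linear rate. For natural PG with any $\eta>0$, and for Gauss–Newton with any $\eta\in(0,1/2]$, there are $c\in(0,1)$ and $r>0$ such that for every $K_0\in\mathcal K$ (for natural PG: every $K_0\in\mathcal K$ with $2\eta\|R+B^\top\tilde P_{K_0}B\|\le 1$), all iterates $K_k$ lie in $\mathcal K$, $K_k\to K^*$, $\mathcal J(K_k)\to\mathcal J(K^*)$, and for every $k$ with $\|K_k-K^*\|<r$, $$\mathcal J(K_{k+1})-\mathcal J(K^*)\le c\,\big(\mathcal J(K_k)-\mathcal J(K^*)\big).$$ (ii) Local Q-quadratic rate. For Gauss–Newton with $\eta=1/2$ there are $c>0$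 and $r>0$ such that for every $K_0\in\mathcal K$, $K_k\to K^*$, and for every $k$ with $\|K_k-K^*\|<r$, $$\|K_{k+1}-K^*\|\le c\,\|K_k-K^*\|^2,\qquad \mathcal J(K_{k+1})-\mathcal J(K^*)\le c\,\big(\mathcal J(K_k)-\mathcal J(K^*)\big)^2 .$$ -/

import Mathlib

open Filter Topology Matrix
open scoped MatrixOrder Matrix.Norms.L2Operator

/-- The data of the discrete-time system
`x_{t+1} = A x_t + B u_t + D w_t`, `z_t = C x_t + E u_t`,
with state in `ℝ^m`, control in `ℝ^d`, disturbance in `ℝ^n`, output in `ℝ^l`,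
together with the robustness level `γ`. Norms of matrices are `ℓ²` operator norms throughout. -/
structure MixedDesign (m d n l : ℕ) where
  A : Matrix (Fin m) (Fin m) ℝ
  B : Matrix (Fin m) (Fin d) ℝ
  C : Matrix (Fin l) (Fin m) ℝ
  D : Matrix (Fin m) (Fin n) ℝ
  E : Matrix (Fin l) (Fin d) ℝ
  γ : ℝ

/-- A real square matrix whose complex eigenvalues all have modulus `< 1`, i.e. `ρ(M) < 1`. -/
def IsSchurStable {m : ℕ} (M : Matrix (Fin m) (Fin m) ℝ) : Prop :=
  spectralRadius ℂ (M.map Complex.ofReal) < 1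

/-- Transfer function `z ↦ H (z I - F)⁻¹ G` of the discrete-time system with state matrix `F`,
input matrix `G`, output matrix `H` and no feedthrough. -/
noncomputable def transferFunction {m n p : ℕ} (F : Matrix (Fin m) (Fin m) ℝ)
    (G : Matrix (Fin m) (Fin n) ℝ) (H : Matrix (Fin p) (Fin m) ℝ) (z : ℂ) :
    Matrix (Fin p) (Fin n) ℂ :=
  H.map Complex.ofReal * (z • (1 : Matrix (Fin m) (Fin m) ℂ) - F.map Complex.ofReal)⁻¹ *
    G.map Complex.ofReal

/-- The `H_∞`-norm `sup_{θ ∈ [0, 2π)} σ_max (T(e^{iθ}))`, with values in `[0, ∞]`. -/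
noncomputable def hInfNorm {p n : ℕ} (T : ℂ → Matrix (Fin p) (Fin n) ℂ) : ENNReal :=
  ⨆ θ ∈ Set.Ico (0 : ℝ) (2 * Real.pi), ENNReal.ofReal ‖T (Complex.exp (θ * Complex.I))‖

namespace MixedDesign

variable {m d n l : ℕ} (S : MixedDesign m d n l)

/-- The control weight `R = Eᵀ E`. -/
def R : Matrix (Fin d) (Fin d) ℝ := S.Eᵀ * S.E

/-- The closed-loop transfer function of `u_t = - K x_t`, with state matrix `A - B K`,
input matrix `D` and output matrix `(Cᵀ C + Kᵀ R K)^{1/2}`. -/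
noncomputable def closedLoop (K : Matrix (Fin d) (Fin m) ℝ) :
    ℂ → Matrix (Fin m) (Fin n) ℂ :=
  transferFunction (S.A - S.B * K) S.D (CFC.sqrt (S.Cᵀ * S.C + Kᵀ * S.R * K))

/-- The feasible set: stabilizing gains whose closed loop has `H_∞`-norm `< γ`. -/
def feasible : Set (Matrix (Fin d) (Fin m) ℝ) :=
  {K | IsSchurStable (S.A - S.B * K) ∧ hInfNorm (S.closedLoop K) < ENNReal.ofReal S.γ}

/-- `P̃ = P + P D (γ² I - Dᵀ P D)⁻¹ Dᵀ P`. -/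
noncomputable def tilde (P : Matrix (Fin m) (Fin m) ℝ) : Matrix (Fin m) (Fin m) ℝ :=
  P + P * S.D * (S.γ ^ 2 • (1 : Matrix (Fin n) (Fin n) ℝ) - S.Dᵀ * P * S.D)⁻¹ * S.Dᵀ * P

/-- `P` is a stabilizing solution of the Riccati equation
`(A - B K)ᵀ P̃ (A - B K) + Cᵀ C + Kᵀ R K - P = 0`: `P ≥ 0`, `I - γ⁻² Dᵀ P D > 0`, and
`(I - γ⁻² P D Dᵀ)^{-T} (A - B K)` is stable. -/
structure IsStabilizingSolution (K : Matrix (Fin d) (Fin m) ℝ)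
    (P : Matrix (Fin m) (Fin m) ℝ) : Prop where
  posSemidef : P.PosSemidef
  riccati : (S.A - S.B * K)ᵀ * S.tilde P * (S.A - S.B * K) + S.Cᵀ * S.C + Kᵀ * S.R * K - P = 0
  posDef : (1 - (S.γ ^ 2)⁻¹ • (S.Dᵀ * P * S.D)).PosDef
  stable : IsSchurStable
    (((1 - (S.γ ^ 2)⁻¹ • (P * S.D * S.Dᵀ))⁻¹)ᵀ * (S.A - S.B * K))

open Classical in
/-- `P_K`: the (unique) stabilizing solution of the Riccati equation at `K`. It exists for every
feasible `K`; the value for gains without such a solution is irrelevant. -/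
noncomputable def riccatiSol (K : Matrix (Fin d) (Fin m) ℝ) : Matrix (Fin m) (Fin m) ℝ :=
  if h : ∃ P, S.IsStabilizingSolution K P then h.choose else 0

/-- `P̃_K`. -/
noncomputable def tildeP (K : Matrix (Fin d) (Fin m) ℝ) : Matrix (Fin m) (Fin m) ℝ :=
  S.tilde (S.riccatiSol K)

/-- The objective `J(K) = - γ² log det (I - γ⁻² P_K D Dᵀ)`. -/
noncomputable def cost (K : Matrix (Fin d) (Fin m) ℝ) : ℝ :=
  -S.γ ^ 2 * Real.log (1 - (S.γ ^ 2)⁻¹ • (S.riccatiSol K * S.D * S.Dᵀ)).det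

/-- `R + Bᵀ P̃_K B`. -/
noncomputable def gainWeight (K : Matrix (Fin d) (Fin m) ℝ) : Matrix (Fin d) (Fin d) ℝ :=
  S.R + S.Bᵀ * S.tildeP K * S.B

/-- `E_K = (R + Bᵀ P̃_K B) K - Bᵀ P̃_K A`. -/
noncomputable def gradE (K : Matrix (Fin d) (Fin m) ℝ) : Matrix (Fin d) (Fin m) ℝ :=
  S.gainWeight K * K - S.Bᵀ * S.tildeP K * S.A

/-- The natural policy gradient update `K ↦ K - 2 η E_K`. -/
noncomputable def naturalPG (η : ℝ) (K : Matrix (Fin d) (Fin m) ℝ) :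
    Matrix (Fin d) (Fin m) ℝ :=
  K - (2 * η) • S.gradE K

/-- The Gauss-Newton update `K ↦ K - 2 η (R + Bᵀ P̃_K B)⁻¹ E_K`. -/
noncomputable def gaussNewton (η : ℝ) (K : Matrix (Fin d) (Fin m) ℝ) :
    Matrix (Fin d) (Fin m) ℝ :=
  K - (2 * η) • ((S.gainWeight K)⁻¹ * S.gradE K)

/-- Local linear convergence of an update rule `step` on a set `init` of initial gains: with a
contraction factor `c < 1` and a radius `r > 0` that do not depend on the initial gain, the iterates
stay feasible, converge to `Kstar`, their costs converge to the cost of `Kstar`, and the cost gap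
contracts by the factor `c` at every iterate within distance `r` of `Kstar`. -/
def ConvergesLocallyLinearly (step : Matrix (Fin d) (Fin m) ℝ → Matrix (Fin d) (Fin m) ℝ)
    (init : Set (Matrix (Fin d) (Fin m) ℝ)) (Kstar : Matrix (Fin d) (Fin m) ℝ) : Prop :=
  ∃ c r : ℝ, 0 < c ∧ c < 1 ∧ 0 < r ∧ ∀ K₀ ∈ init,
    (∀ k, step^[k] K₀ ∈ S.feasible) ∧
    Tendsto (fun k => step^[k] K₀) atTop (𝓝 Kstar) ∧
    Tendsto (fun k => S.cost (step^[k] K₀)) atTop (𝓝 (S.cost Kstar)) ∧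
    ∀ k, ‖step^[k] K₀ - Kstar‖ < r →
      S.cost (step^[k + 1] K₀) - S.cost Kstar ≤ c * (S.cost (step^[k] K₀) - S.cost Kstar)

/-- Local Q-quadratic convergence, both of the gains and of their costs, with a constant and a
radius that do not depend on the initial gain. -/
def ConvergesLocallyQuadratically (step : Matrix (Fin d) (Fin m) ℝ → Matrix (Fin d) (Fin m) ℝ)
    (init : Set (Matrix (Fin d) (Fin m) ℝ)) (Kstar : Matrix (Fin d) (Fin m) ℝ) : Prop :=
  ∃ c r : ℝ, 0 < c ∧ 0 < r ∧ ∀ K₀ ∈ init,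
    Tendsto (fun k => step^[k] K₀) atTop (𝓝 Kstar) ∧
    ∀ k, ‖step^[k] K₀ - Kstar‖ < r →
      ‖step^[k + 1] K₀ - Kstar‖ ≤ c * ‖step^[k] K₀ - Kstar‖ ^ 2 ∧
      S.cost (step^[k + 1] K₀) - S.cost Kstar ≤ c * (S.cost (step^[k] K₀) - S.cost Kstar) ^ 2

end MixedDesign

/-! The Riccati operator of a gain is the Bellman operator of a game against the disturbance.
Completing the square in the disturbance (`complete_square`) gives exact formulas for its increments
in `P` (`ric_sub_ric`), and for fixed `P` it is exactly quadratic in the gain, with `E_K` as linear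
coefficient (`gainRic_sub`). Hence after one policy step from `K`, the matrix `P_K` is a
supersolution of the Riccati equation of the new gain, with slack at least a multiple of `N_K = E_Kᵀ
(R + Bᵀ P̃_K B)⁻¹ E_K`. A stabilizing solution lies below every supersolution, and a supersolution
whose slack detects marginal modes certifies feasibility. So the iterates stay feasible and `P`
drops by at least a multiple of `N_K` (`GainStabilizing.improve`). That feasible gains have a
stabilizing solution at all is the bounded real lemma (`exists_stabilizing`), proved by continuation
in the size of the output weight.

Global convergence (`tendsto_of_decrease`): the decreasing `P_k` converge, hence `N_K → 0` and `E_K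
→ 0`, and the gains converge because `(R + Bᵀ P̃ B) K = E_K + Bᵀ P̃ A`. The limit is stationary. It
is identified with `K*` by two facts, both read off from `saddleForm`, which compares one gain with
the worst-case trajectory of a stationary gain: a stationary stabilizing gain has the least Riccati
solution (`GainStabilizing.sub_posSemidef`), and the limit is again stabilizing (`stable_of_limit`).

Rates: by concavity of `log det` and `D Dᵀ > 0` the cost gap is comparable near `K*` with `tr (P_K -
P*)`. This trace is at most a multiple of `tr N_K` (gradient dominance), which gives the linear
rate, and at most a multiple of `‖K - K*‖²`. The full Gauss–Newton step sees `K` only through `P_K`,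
in a Lipschitz way, so its error is quadratic. -/

set_option linter.unusedSectionVars false

/-! ### Loewner order, traces and `log det` of real semidefinite matrices. -/

section Semidefinite

variable {p q : Type*} [Fintype p] [Fintype q] [DecidableEq p] [DecidableEq q]

theorem Matrix.PosSemidef.transpose_mul_mul {X : Matrix p p ℝ} (hX : X.PosSemidef)
    (Z : Matrix p q ℝ) : (Zᵀ * X * Z).PosSemidef := by
  simpa using hX.conjTranspose_mul_mul_same Z

theorem Matrix.PosSemidef.mul_mul_transpose {X : Matrix p p ℝ} (hX : X.PosSemidef)
    (Z : Matrix q p ℝ) : (Z * X * Zᵀ).PosSemidef := by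
  simpa using hX.mul_mul_conjTranspose_same Z

theorem Matrix.posSemidef_transpose_mul_self (Z : Matrix p q ℝ) : (Zᵀ * Z).PosSemidef := by
  simpa using Matrix.posSemidef_conjTranspose_mul_self Z

theorem Matrix.PosSemidef.transpose_eq {X : Matrix p p ℝ} (hX : X.PosSemidef) : Xᵀ = X := by
  simpa [Matrix.IsHermitian] using hX.1

theorem Matrix.PosDef.transpose_eq {X : Matrix p p ℝ} (hX : X.PosDef) : Xᵀ = X := by
  simpa [Matrix.IsHermitian] using hX.1

theorem Matrix.posSemidef_iff_exists_transpose_mul_self {X : Matrix p p ℝ} :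
    X.PosSemidef ↔ ∃ Z : Matrix p p ℝ, X = Zᵀ * Z := by
  constructor
  · intro h
    obtain ⟨Z, hZ⟩ := CStarAlgebra.nonneg_iff_eq_star_mul_self.mp
      (Matrix.nonneg_iff_posSemidef.mpr h)
    exact ⟨Z, by simpa [Matrix.star_eq_conjTranspose] using hZ⟩
  · rintro ⟨Z, rfl⟩
    exact Matrix.posSemidef_transpose_mul_self Z

theorem Matrix.PosSemidef.trace_mul_nonneg {X Y : Matrix p p ℝ} (hX : X.PosSemidef)
    (hY : Y.PosSemidef) : 0 ≤ (X * Y).trace := by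
  obtain ⟨Z, rfl⟩ := Matrix.posSemidef_iff_exists_transpose_mul_self.mp hY
  rw [← Matrix.mul_assoc, Matrix.trace_mul_comm, ← Matrix.mul_assoc]
  exact (hX.mul_mul_transpose Z).trace_nonneg

theorem Matrix.trace_transpose_mul_self_eq_zero {Z : Matrix p q ℝ} (h : (Zᵀ * Z).trace = 0) :
    Z = 0 := by
  have := (Matrix.trace_conjTranspose_mul_self_eq_zero_iff (A := Z)).mp (by simpa using h)
  exact this

/-- Used whenever an energy identity forces a sum of nonnegative traces to vanish: each term then
yields a linear equation for the mode `V`. -/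
theorem Matrix.PosSemidef.mul_eq_zero_of_trace {X : Matrix p p ℝ} (hX : X.PosSemidef)
    {V : Matrix p q ℝ} (h : (Vᵀ * X * V).trace = 0) : X * V = 0 := by
  obtain ⟨Z, rfl⟩ := Matrix.posSemidef_iff_exists_transpose_mul_self.mp hX
  have : Z * V = 0 := Matrix.trace_transpose_mul_self_eq_zero (by
    rw [← h, Matrix.transpose_mul]; simp only [Matrix.mul_assoc])
  rw [Matrix.mul_assoc, this, Matrix.mul_zero]

theorem Matrix.PosDef.eq_zero_of_mul_eq_zero {X : Matrix p p ℝ} (hX : X.PosDef)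
    {V : Matrix p q ℝ} (h : X * V = 0) : V = 0 := by
  have hu : IsUnit X.det := hX.det_pos.ne'.isUnit
  calc V = X⁻¹ * (X * V) := by rw [Matrix.nonsing_inv_mul_cancel_left _ _ hu]
    _ = 0 := by rw [h, Matrix.mul_zero]

theorem Matrix.PosDef.eq_zero_of_trace {X : Matrix p p ℝ} (hX : X.PosDef)
    {V : Matrix p q ℝ} (h : (Vᵀ * X * V).trace = 0) : V = 0 :=
  hX.eq_zero_of_mul_eq_zero (hX.posSemidef.mul_eq_zero_of_trace h)

theorem Matrix.IsHermitian.posSemidef_of_forall {X : Matrix p p ℝ} (hX : Xᵀ = X)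
    (h : ∀ x : p → ℝ, 0 ≤ x ⬝ᵥ X *ᵥ x) : X.PosSemidef :=
  Matrix.posSemidef_iff_dotProduct_mulVec.mpr
    ⟨by simpa [Matrix.IsHermitian] using hX, by simpa using h⟩

theorem Matrix.PosSemidef.dotProduct_nonneg {X : Matrix p p ℝ} (hX : X.PosSemidef) (x : p → ℝ) :
    0 ≤ x ⬝ᵥ X *ᵥ x := by
  simpa using (Matrix.posSemidef_iff_dotProduct_mulVec.mp hX).2 x

theorem Matrix.abs_dotProduct_mulVec_le (X : Matrix p p ℝ) (x : p → ℝ) :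
    |x ⬝ᵥ X *ᵥ x| ≤ ‖X‖ * (x ⬝ᵥ x) := by
  have h1 := Matrix.l2_opNorm_mulVec X (WithLp.toLp 2 x)
  have h2 := abs_real_inner_le_norm (WithLp.toLp 2 (X *ᵥ x)) (WithLp.toLp 2 x)
  have h3 : ‖WithLp.toLp 2 x‖ ^ 2 = x ⬝ᵥ x := by
    rw [EuclideanSpace.norm_sq_eq]
    simp [dotProduct, sq]
  have h4 : inner ℝ (WithLp.toLp 2 (X *ᵥ x)) (WithLp.toLp 2 x) = x ⬝ᵥ X *ᵥ x := by
    simp [EuclideanSpace.inner_eq_star_dotProduct]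
  rw [h4] at h2
  calc _ ≤ _ := h2
    _ ≤ ‖X‖ * ‖WithLp.toLp 2 x‖ * ‖WithLp.toLp 2 x‖ := by
        gcongr; exact h1
    _ = _ := by rw [← h3]; ring

theorem Matrix.posSemidef_norm_smul_one_sub {X : Matrix p p ℝ} (hX : Xᵀ = X) :
    (‖X‖ • (1 : Matrix p p ℝ) - X).PosSemidef := by
  refine Matrix.IsHermitian.posSemidef_of_forall (by simp [hX]) fun x => ?_
  have := (abs_le.mp (X.abs_dotProduct_mulVec_le x)).2
  simp only [Matrix.sub_mulVec, Matrix.smul_mulVec, Matrix.one_mulVec, dotProduct_sub,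
    dotProduct_smul, smul_eq_mul]
  linarith

theorem Matrix.PosSemidef.smul_one_of_norm_le {X : Matrix p p ℝ} (hX : Xᵀ = X) {c : ℝ}
    (hc : ‖X‖ ≤ c) : (c • (1 : Matrix p p ℝ) - X).PosSemidef := by
  have := (Matrix.posSemidef_norm_smul_one_sub hX).add
    ((Matrix.PosSemidef.one (n := p) (R := ℝ)).smul (sub_nonneg.mpr hc))
  convert this using 1
  module

/-- The Frobenius norm of a square root dominates its operator norm. This lets the trace serve as
the scalar size of every Loewner gap. -/
theorem Matrix.PosSemidef.norm_le_trace {X : Matrix p p ℝ} (hX : X.PosSemidef) :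
    ‖X‖ ≤ X.trace := by
  obtain ⟨Z, rfl⟩ := Matrix.posSemidef_iff_exists_transpose_mul_self.mp hX
  have h1 : ‖Zᵀ * Z‖ = ‖Z‖ * ‖Z‖ := by
    simpa using Matrix.l2_opNorm_conjTranspose_mul_self Z
  have ht : (Zᵀ * Z).trace = ∑ i, ∑ j, Z i j ^ 2 := by
    simp only [Matrix.trace, Matrix.diag_apply, Matrix.mul_apply, Matrix.transpose_apply]
    rw [Finset.sum_comm]
    simp [sq]
  have h0 : 0 ≤ (Zᵀ * Z).trace := hX.trace_nonneg
  have h2 : ‖Z‖ ≤ Real.sqrt (Zᵀ * Z).trace := by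
    rw [Matrix.l2_opNorm_def]
    refine ContinuousLinearMap.opNorm_le_bound _ (Real.sqrt_nonneg _) fun x => ?_
    rw [← Real.sqrt_sq (norm_nonneg x), ← Real.sqrt_mul h0]
    refine Real.le_sqrt_of_sq_le ?_
    rw [EuclideanSpace.norm_sq_eq, EuclideanSpace.norm_sq_eq, ht, Finset.sum_mul]
    refine Finset.sum_le_sum fun i _ => ?_
    have := Finset.sum_mul_sq_le_sq_mul_sq Finset.univ (fun j => Z i j) (fun j => x j)
    simpa [Matrix.toLpLin_apply, Matrix.mulVec, dotProduct] using this
  rw [h1, ← sq]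
  calc ‖Z‖ ^ 2 ≤ Real.sqrt (Zᵀ * Z).trace ^ 2 := by gcongr
    _ = _ := Real.sq_sqrt h0

theorem Matrix.PosSemidef.eq_of_sub_sub {X Y : Matrix p p ℝ} (h1 : (X - Y).PosSemidef)
    (h2 : (Y - X).PosSemidef) : X = Y :=
  le_antisymm (Matrix.le_iff.mpr h2) (Matrix.le_iff.mpr h1)

theorem Matrix.PosSemidef.trace_mul_le {X Y : Matrix p p ℝ} (hX : X.PosSemidef) {c : ℝ}
    (hY : (c • (1 : Matrix p p ℝ) - Y).PosSemidef) : (X * Y).trace ≤ c * X.trace := by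
  have := hX.trace_mul_nonneg hY
  rw [Matrix.mul_sub, Matrix.trace_sub, Matrix.mul_smul, Matrix.mul_one, Matrix.trace_smul,
    smul_eq_mul] at this
  linarith

theorem Matrix.PosSemidef.le_trace_mul {X Y : Matrix p p ℝ} (hX : X.PosSemidef) {c : ℝ}
    (hY : (Y - c • (1 : Matrix p p ℝ)).PosSemidef) : c * X.trace ≤ (X * Y).trace := by
  have := hX.trace_mul_nonneg hY
  rw [Matrix.mul_sub, Matrix.trace_sub, Matrix.mul_smul, Matrix.mul_one, Matrix.trace_smul,
    smul_eq_mul] at this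
  linarith

theorem Matrix.posDef_of_sub_smul_one {X : Matrix p p ℝ} {ε : ℝ} (hε : 0 < ε)
    (h : (X - ε • (1 : Matrix p p ℝ)).PosSemidef) : X.PosDef := by
  have := Matrix.PosDef.posSemidef_add h ((Matrix.PosDef.one (n := p) (R := ℝ)).smul hε)
  simpa using this

theorem Matrix.PosDef.exists_sub_smul_one {X : Matrix p p ℝ} (hX : X.PosDef) :
    ∃ ε : ℝ, 0 < ε ∧ (X - ε • (1 : Matrix p p ℝ)).PosSemidef := by
  obtain ⟨Z, hZ⟩ := Matrix.posSemidef_iff_exists_transpose_mul_self.mp hX.posSemidef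
  have hu : IsUnit X.det := hX.det_pos.ne'.isUnit
  have hZu : IsUnit Z.det := by
    rw [hZ, Matrix.det_mul] at hu
    exact isUnit_of_mul_isUnit_right hu
  set N := (Z⁻¹)ᵀ * Z⁻¹ with hN
  have hNs : Nᵀ = N := by simp [hN]
  have hc : 0 < ‖N‖ + 1 := by positivity
  refine ⟨(‖N‖ + 1)⁻¹, inv_pos.mpr hc, ?_⟩
  have h1 := ((Matrix.PosSemidef.smul_one_of_norm_le hNs
    (le_add_of_nonneg_right zero_le_one)).smul (inv_nonneg.mpr hc.le)).transpose_mul_mul Z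
  have h3 : Zᵀ * N * Z = 1 := by
    rw [hN, ← Matrix.mul_assoc, ← Matrix.transpose_mul, Matrix.nonsing_inv_mul _ hZu]
    simp [Matrix.nonsing_inv_mul _ hZu]
  convert h1 using 1
  rw [smul_sub, smul_smul, inv_mul_cancel₀ hc.ne', one_smul, Matrix.mul_sub, Matrix.sub_mul,
    Matrix.mul_smul, Matrix.smul_mul, h3, Matrix.mul_one, ← hZ]

theorem Matrix.isClosed_posSemidef : IsClosed {X : Matrix p p ℝ | X.PosSemidef} := by
  have : {X : Matrix p p ℝ | X.PosSemidef} =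
      {X | Xᵀ = X} ∩ ⋂ x : p → ℝ, {X | 0 ≤ x ⬝ᵥ X *ᵥ x} := by
    ext X
    simp only [Set.mem_ofPred_eq, Set.mem_inter_iff, Set.mem_iInter]
    exact ⟨fun h => ⟨h.transpose_eq, h.dotProduct_nonneg⟩,
      fun h => Matrix.IsHermitian.posSemidef_of_forall h.1 h.2⟩
  rw [this]
  refine (isClosed_eq (by fun_prop) continuous_id).inter (isClosed_iInter fun x => ?_)
  exact isClosed_le continuous_const (by fun_prop)

theorem Matrix.PosSemidef.of_tendsto {ι : Type*} {l : Filter ι} [l.NeBot]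
    {X : ι → Matrix p p ℝ} {Y : Matrix p p ℝ} (h : Tendsto X l (𝓝 Y))
    (hX : ∀ i, (X i).PosSemidef) : Y.PosSemidef :=
  Matrix.isClosed_posSemidef.mem_of_tendsto h (Eventually.of_forall hX)

theorem Matrix.continuous_trace : Continuous (Matrix.trace : Matrix p p ℝ → ℝ) :=
  Continuous.matrix_trace continuous_id

/-- A decreasing sequence of matrices in the Loewner order that is bounded below converges. -/
theorem Matrix.exists_tendsto_of_decreasing {P : ℕ → Matrix p p ℝ} {B : Matrix p p ℝ}
    (h : ∀ k, (P k - P (k + 1)).PosSemidef) (hB : ∀ k, (P k - B).PosSemidef) :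
    ∃ X, Tendsto P atTop (𝓝 X) ∧ ∀ k, (P k - X).PosSemidef := by
  have hmono : ∀ k j, (P k - P (k + j)).PosSemidef := by
    intro k j
    induction j with
    | zero => simpa using Matrix.PosSemidef.zero
    | succ j ih => simpa [add_assoc] using ih.add (h (k + j))
  have htr : Antitone fun k => (P k).trace := by
    refine antitone_nat_of_succ_le fun k => ?_
    have := (h k).trace_nonneg
    rw [Matrix.trace_sub] at this
    linarith
  have hbd : BddBelow (Set.range fun k => (P k).trace) := by
    refine ⟨B.trace, ?_⟩
    rintro _ ⟨k, rfl⟩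
    have := (hB k).trace_nonneg
    rw [Matrix.trace_sub] at this
    simp only
    linarith
  have hc := (tendsto_atTop_ciInf htr hbd).cauchySeq
  -- Increments are semidefinite, so their norms are bounded by differences of the convergent
  -- traces.
  have hP : CauchySeq P := by
    rw [Metric.cauchySeq_iff'] at hc ⊢
    intro ε hε
    obtain ⟨N, hN⟩ := hc ε hε
    refine ⟨N, fun k hk => ?_⟩
    obtain ⟨j, rfl⟩ := Nat.exists_eq_add_of_le hk
    have h1 := (hmono N j).norm_le_trace
    have h2 := hN (N + j) hk
    rw [Matrix.trace_sub] at h1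
    rw [dist_comm, dist_eq_norm]
    rw [dist_comm, Real.dist_eq] at h2
    exact (h1.trans (le_abs_self _)).trans_lt h2
  obtain ⟨X, hX⟩ := cauchySeq_tendsto_of_complete hP
  refine ⟨X, hX, fun k => ?_⟩
  refine Matrix.PosSemidef.of_tendsto (l := atTop) (X := fun j => P k - P (k + j)) ?_ (hmono k)
  exact tendsto_const_nhds.sub (hX.comp (tendsto_add_atTop_nat k |>.congr fun j => by omega))

theorem Matrix.PosDef.log_det_le {X : Matrix p p ℝ} (hX : X.PosDef) :
    Real.log X.det ≤ X.trace - Fintype.card p := by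
  have h1 : X.det = ∏ i, hX.1.eigenvalues i := by simpa using hX.1.det_eq_prod_eigenvalues
  have h2 : X.trace = ∑ i, hX.1.eigenvalues i := by simpa using hX.1.trace_eq_sum_eigenvalues
  rw [h1, h2, Real.log_prod fun i _ => (hX.eigenvalues_pos i).ne']
  calc _ ≤ ∑ i, (hX.1.eigenvalues i - 1) :=
        Finset.sum_le_sum fun i _ => Real.log_le_sub_one_of_pos (hX.eigenvalues_pos i)
    _ = _ := by simp

/-- Concavity of `log det`. -/
theorem Matrix.PosDef.log_det_sub_le {X Y : Matrix p p ℝ} (hX : X.PosDef) (hY : Y.PosDef) :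
    Real.log X.det - Real.log Y.det ≤ ((X - Y) * Y⁻¹).trace := by
  obtain ⟨Z, hZ⟩ := Matrix.posSemidef_iff_exists_transpose_mul_self.mp hY.posSemidef
  have hu : IsUnit Y.det := hY.det_pos.ne'.isUnit
  have hZu : IsUnit Z.det := by
    rw [hZ, Matrix.det_mul] at hu
    exact isUnit_of_mul_isUnit_right hu
  have hZt : IsUnit Zᵀ.det := by rwa [Matrix.det_transpose]
  -- Congruence by a square root of `Y` reduces the claim to `Y = 1`, where it is `log λ ≤ λ - 1` on
  -- eigenvalues.
  set W := (Z⁻¹)ᵀ * X * Z⁻¹ with hW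
  have hd : W.det = X.det / Y.det := by
    rw [hW, Matrix.det_mul, Matrix.det_mul, Matrix.det_transpose, Matrix.det_nonsing_inv,
      Ring.inverse_eq_inv', hZ, Matrix.det_mul, Matrix.det_transpose]
    have := hZu.ne_zero
    field_simp
  have hYi : Y⁻¹ = Z⁻¹ * (Z⁻¹)ᵀ := by
    rw [hZ, Matrix.mul_inv_rev, Matrix.transpose_nonsing_inv]
  have ht : W.trace = (X * Y⁻¹).trace := by
    rw [hW, Matrix.mul_assoc, Matrix.trace_mul_comm, hYi, Matrix.mul_assoc]
  have hWp : W.PosDef := by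
    rw [(hX.posSemidef.transpose_mul_mul Z⁻¹).posDef_iff_det_ne_zero, ← hW, hd]
    exact (div_pos hX.det_pos hY.det_pos).ne'
  have := hWp.log_det_le
  rw [hd, Real.log_div hX.det_pos.ne' hY.det_pos.ne', ht] at this
  rw [Matrix.sub_mul, Matrix.mul_nonsing_inv _ hu, Matrix.trace_sub, Matrix.trace_one]
  exact this

/-- From the identity `X⁻¹ - 1 = (1 - X) + (1 - X) X⁻¹ (1 - X)`. -/
theorem Matrix.PosDef.inv_sub_one {X : Matrix p p ℝ} (hX : X.PosDef)
    (h : (1 - X).PosSemidef) : (X⁻¹ - 1).PosSemidef := by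
  have hu : IsUnit X.det := hX.det_pos.ne'.isUnit
  have h1 := h.add (hX.inv.posSemidef.transpose_mul_mul (1 - X))
  convert h1 using 1
  rw [h.transpose_eq]
  simp only [Matrix.sub_mul, Matrix.mul_sub, Matrix.one_mul, Matrix.mul_one,
    Matrix.mul_nonsing_inv _ hu, Matrix.nonsing_inv_mul _ hu]
  abel

end Semidefinite

/-! ### Complex vectors as two real columns, so that real energy identities apply to complex modes.
-/

section ComplexAsReal

/-- The real `2 × 2` matrix that represents multiplication by `α + β i`, acting from the right on
matrices with two columns (real and imaginary part). -/
def rotMatrix (α β : ℝ) : Matrix (Fin 2) (Fin 2) ℝ := !![α, β; -β, α]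

theorem rotMatrix_mul_transpose (α β : ℝ) :
    rotMatrix α β * (rotMatrix α β)ᵀ = (α ^ 2 + β ^ 2) • (1 : Matrix (Fin 2) (Fin 2) ℝ) := by
  ext i j
  fin_cases i <;> fin_cases j <;> simp [rotMatrix, Matrix.mul_apply, Fin.sum_univ_two] <;> ring

theorem eq_zero_of_mul_rotMatrix {p : Type*} {α β : ℝ} (h : 0 < α ^ 2 + β ^ 2)
    {V : Matrix p (Fin 2) ℝ} (hV : V * rotMatrix α β = 0) : V = 0 := by
  have : V * rotMatrix α β * (rotMatrix α β)ᵀ = 0 := by rw [hV, Matrix.zero_mul]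
  rw [Matrix.mul_assoc, rotMatrix_mul_transpose, Matrix.mul_smul, Matrix.mul_one] at this
  exact (smul_eq_zero.mp this).resolve_left h.ne'

theorem trace_rotMatrix {p : Type*} [Fintype p] (α β : ℝ) (V : Matrix p (Fin 2) ℝ)
    (X : Matrix p p ℝ) :
    ((V * rotMatrix α β)ᵀ * X * (V * rotMatrix α β)).trace
      = (α ^ 2 + β ^ 2) * (Vᵀ * X * V).trace := by
  have h1 : (V * rotMatrix α β)ᵀ * X * (V * rotMatrix α β)
      = (rotMatrix α β)ᵀ * ((Vᵀ * X * V) * rotMatrix α β) := by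
    simp only [Matrix.transpose_mul, Matrix.mul_assoc]
  rw [h1, Matrix.trace_mul_comm, Matrix.mul_assoc, rotMatrix_mul_transpose, Matrix.mul_smul,
    Matrix.mul_one, Matrix.trace_smul, smul_eq_mul]

/-- The complex vector with real and imaginary part the two columns of `V`. -/
def complexVec {p : Type*} (V : Matrix p (Fin 2) ℝ) : p → ℂ :=
  fun i => (V i 0 : ℂ) + (V i 1 : ℂ) * Complex.I

/-- The two-column real matrix of real and imaginary parts. -/
def realPair {p : Type*} (v : p → ℂ) : Matrix p (Fin 2) ℝ :=
  Matrix.of fun i => ![(v i).re, (v i).im]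

variable {p q : Type*} [Fintype p] [Fintype q]

theorem complexVec_realPair (v : p → ℂ) : complexVec (realPair v) = v := by
  funext i
  simp [complexVec, realPair, Complex.re_add_im]

theorem complexVec_injective : Function.Injective (complexVec (p := p)) := by
  intro V W h
  ext i j
  have := congrFun h i
  simp only [complexVec, Complex.ext_iff] at this
  fin_cases j
  · simpa using this.1
  · simpa using this.2

theorem complexVec_add (V W : Matrix p (Fin 2) ℝ) :
    complexVec (V + W) = complexVec V + complexVec W := by
  funext i
  simp [complexVec]; ring

theorem complexVec_zero : complexVec (0 : Matrix p (Fin 2) ℝ) = 0 := by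
  funext i
  simp [complexVec]

theorem complexVec_mul (A : Matrix q p ℝ) (V : Matrix p (Fin 2) ℝ) :
    complexVec (A * V) = A.map Complex.ofReal *ᵥ complexVec V := by
  funext i
  simp [complexVec, Matrix.mulVec, dotProduct, Matrix.mul_apply, mul_add, Finset.sum_add_distrib,
    Finset.sum_mul, mul_assoc]

theorem complexVec_mul_rotMatrix (V : Matrix p (Fin 2) ℝ) (α β : ℝ) :
    complexVec (V * rotMatrix α β) = ((α : ℂ) + β * Complex.I) • complexVec V := by
  funext i
  simp only [complexVec, rotMatrix, Matrix.mul_apply, Fin.sum_univ_two, Pi.smul_apply, smul_eq_mul]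
  simp
  ring_nf
  simp
  ring

theorem norm_complexVec_sq (V : Matrix p (Fin 2) ℝ) :
    ‖WithLp.toLp 2 (complexVec V)‖ ^ 2 = (Vᵀ * V).trace := by
  rw [EuclideanSpace.norm_sq_eq]
  simp only [Matrix.trace, Matrix.diag_apply, Matrix.mul_apply, Matrix.transpose_apply]
  rw [Finset.sum_comm]
  refine Finset.sum_congr rfl fun i _ => ?_
  rw [Fin.sum_univ_two, ← Complex.normSq_eq_norm_sq, Complex.normSq_apply]
  simp [complexVec]

end ComplexAsReal

/-! ### Schur stability: power decay, Lyapunov matrices, limits of stable matrices. -/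

section Stability

variable {m n : ℕ}

/-- Real vectors keep their norm inside `ℂ^n`; this transfers Gelfand's formula, which is applied
over `ℂ`, back to real powers. -/
theorem norm_le_norm_map_ofReal (A : Matrix (Fin m) (Fin n) ℝ) :
    ‖A‖ ≤ ‖A.map Complex.ofReal‖ := by
  rw [Matrix.l2_opNorm_def A]
  refine ContinuousLinearMap.opNorm_le_bound _ (norm_nonneg _) fun x => ?_
  have h := Matrix.l2_opNorm_mulVec (A.map Complex.ofReal)
    (WithLp.toLp 2 fun i => (x i : ℂ))
  have h1 : ‖WithLp.toLp 2 fun i => (x i : ℂ)‖ = ‖x‖ := by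
    simp [EuclideanSpace.norm_eq]
  have h2 : ‖WithLp.toLp 2 (A.map Complex.ofReal *ᵥ fun i => (x i : ℂ))‖
      = ‖WithLp.toLp 2 (A *ᵥ x.ofLp)‖ := by
    have : (A.map Complex.ofReal *ᵥ fun i => (x i : ℂ)) = fun i => ((A *ᵥ x.ofLp) i : ℂ) := by
      funext i
      simp [Matrix.mulVec, dotProduct]
    rw [this]
    simp [EuclideanSpace.norm_eq]
  rw [h1] at h
  simpa [Matrix.toLpLin_apply, h2] using h

theorem map_ofReal_pow (A : Matrix (Fin m) (Fin m) ℝ) (k : ℕ) :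
    (A ^ k).map Complex.ofReal = (A.map Complex.ofReal) ^ k :=
  map_pow (Complex.ofRealHom.mapMatrix) A k

theorem mem_spectrum_iff_exists_mulVec {A : Matrix (Fin m) (Fin m) ℂ} {z : ℂ} :
    z ∈ spectrum ℂ A ↔ ∃ v ≠ 0, A *ᵥ v = z • v := by
  rw [spectrum.mem_iff, Matrix.isUnit_iff_isUnit_det, isUnit_iff_ne_zero, not_not,
    ← Matrix.exists_mulVec_eq_zero_iff]
  refine exists_congr fun v => and_congr_right fun _ => ?_
  rw [Matrix.sub_mulVec, sub_eq_zero, Algebra.algebraMap_eq_smul_one, Matrix.smul_mulVec,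
    Matrix.one_mulVec, eq_comm]

/-- Schur stability in terms of real invariant planes. -/
theorem isSchurStable_iff {A : Matrix (Fin m) (Fin m) ℝ} :
    IsSchurStable A ↔ ∀ (V : Matrix (Fin m) (Fin 2) ℝ) (α β : ℝ), 1 ≤ α ^ 2 + β ^ 2 →
      A * V = V * rotMatrix α β → V = 0 := by
  have hnorm : ∀ α β : ℝ, ‖(α : ℂ) + β * Complex.I‖ ^ 2 = α ^ 2 + β ^ 2 := fun α β => by
    rw [← Complex.normSq_eq_norm_sq, Complex.normSq_add_mul_I]
  constructor
  · intro h V α β hαβ hV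
    by_contra hne
    have hmem : ((α : ℂ) + β * Complex.I) ∈ spectrum ℂ (A.map Complex.ofReal) := by
      refine mem_spectrum_iff_exists_mulVec.mpr ⟨complexVec V, fun h0 => hne ?_, ?_⟩
      · exact complexVec_injective (by rw [h0, complexVec_zero])
      · rw [← complexVec_mul, hV, complexVec_mul_rotMatrix]
    have h1 : (‖(α : ℂ) + β * Complex.I‖₊ : ENNReal) ≤ spectralRadius ℂ (A.map Complex.ofReal) :=
      le_iSup₂ (f := fun k (_ : k ∈ spectrum ℂ (A.map Complex.ofReal)) => (‖k‖₊ : ENNReal)) _ hmem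
    have h2 : (‖(α : ℂ) + β * Complex.I‖₊ : ENNReal) < 1 := h1.trans_lt h
    have h3 : ‖(α : ℂ) + β * Complex.I‖ < 1 := by exact_mod_cast h2
    have := hnorm α β
    nlinarith [norm_nonneg ((α : ℂ) + β * Complex.I)]
  · intro h
    unfold IsSchurStable
    rcases (spectrum ℂ (A.map Complex.ofReal)).eq_empty_or_nonempty with he | hne
    · simp [spectralRadius, he]
    · refine spectrum.spectralRadius_lt_of_forall_lt_of_nonempty hne (r := 1) fun z hz => ?_
      obtain ⟨v, hv0, hv⟩ := mem_spectrum_iff_exists_mulVec.mp hz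
      by_contra hlt
      have hz1 : 1 ≤ ‖z‖ := by exact_mod_cast not_lt.mp hlt
      refine hv0 ?_
      rw [← complexVec_realPair v, h (realPair v) z.re z.im ?_ ?_, complexVec_zero]
      · rw [← hnorm, Complex.re_add_im]
        nlinarith
      · apply complexVec_injective
        rw [complexVec_mul, complexVec_mul_rotMatrix, complexVec_realPair, Complex.re_add_im, hv]

/-- Gelfand's formula gives `‖A ^ k‖ ≤ r ^ k` from some `N` on; the constant absorbs the finitely
many earlier powers. -/
theorem IsSchurStable.exists_norm_pow_le {A : Matrix (Fin m) (Fin m) ℝ} (h : IsSchurStable A) :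
    ∃ C ρ : ℝ, 0 ≤ C ∧ 0 < ρ ∧ ρ < 1 ∧ ∀ k, ‖A ^ k‖ ≤ C * ρ ^ k := by
  obtain ⟨r, hr1, hr2⟩ := ENNReal.lt_iff_exists_nnreal_btwn.mp h
  have hr2' : (r : ℝ) < 1 := by exact_mod_cast hr2
  have hr0 : 0 < (r : ℝ) := by
    have : (0 : ENNReal) < r := bot_le.trans_lt hr1
    exact_mod_cast this
  have hg := spectrum.pow_nnnorm_pow_one_div_tendsto_nhds_spectralRadius (A.map Complex.ofReal)
  have hev := (hg.eventually (gt_mem_nhds hr1)).and (eventually_gt_atTop 0)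
  obtain ⟨N, hN⟩ := eventually_atTop.mp hev
  have hb : ∀ k ≥ N, ‖A ^ k‖ ≤ (r : ℝ) ^ k := by
    intro k hk
    obtain ⟨h1, h2⟩ := hN k hk
    have h3 : ((‖(A.map Complex.ofReal) ^ k‖₊ : ENNReal)) ≤ (r : ENNReal) ^ k := by
      have := ENNReal.rpow_le_rpow h1.le (Nat.cast_nonneg k)
      rwa [← ENNReal.rpow_mul, one_div, inv_mul_cancel₀ (by exact_mod_cast h2.ne'),
        ENNReal.rpow_one, ENNReal.rpow_natCast] at this
    have h4 : ‖(A.map Complex.ofReal) ^ k‖ ≤ (r : ℝ) ^ k := by exact_mod_cast h3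
    rw [← map_ofReal_pow] at h4
    exact (norm_le_norm_map_ofReal _).trans h4
  refine ⟨1 + ∑ k ∈ Finset.range N, ‖A ^ k‖ / (r : ℝ) ^ k, r, by positivity, hr0, hr2',
    fun k => ?_⟩
  have hrk : 0 < (r : ℝ) ^ k := pow_pos hr0 k
  rcases lt_or_ge k N with hk | hk
  · have : ‖A ^ k‖ / (r : ℝ) ^ k ≤ ∑ k ∈ Finset.range N, ‖A ^ k‖ / (r : ℝ) ^ k :=
      Finset.single_le_sum (f := fun k => ‖A ^ k‖ / (r : ℝ) ^ k) (fun i _ => by positivity)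
        (Finset.mem_range.mpr hk)
    rw [← div_le_iff₀ hrk]
    linarith
  · have : 0 ≤ ∑ k ∈ Finset.range N, ‖A ^ k‖ / (r : ℝ) ^ k :=
      Finset.sum_nonneg fun i _ => by positivity
    nlinarith [hb k hk]

theorem IsSchurStable.tendsto_pow {A : Matrix (Fin m) (Fin m) ℝ} (h : IsSchurStable A) :
    Tendsto (fun k => A ^ k) atTop (𝓝 0) := by
  obtain ⟨C, ρ, -, h0, h1, hb⟩ := h.exists_norm_pow_le
  refine squeeze_zero_norm hb ?_
  simpa using (tendsto_pow_atTop_nhds_zero_of_lt_one h0.le h1).const_mul C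

/-- A truncated Gramian suffices: the sum telescopes to `1 - (A ^ N)ᵀ A ^ N ≥ 1/2`, and doubling it
gives slack `1`. -/
theorem exists_lyapunov_of_norm_pow {A : Matrix (Fin m) (Fin m) ℝ} {N : ℕ} (hN : 1 ≤ N)
    (h : ‖A ^ N‖ ^ 2 ≤ 1 / 2) :
    ∃ X : Matrix (Fin m) (Fin m) ℝ, X.PosDef ∧ (X - Aᵀ * X * A - 1).PosSemidef := by
  set X : Matrix (Fin m) (Fin m) ℝ := ∑ k ∈ Finset.range N, (A ^ k)ᵀ * A ^ k with hX
  have hd : X - Aᵀ * X * A = 1 - (A ^ N)ᵀ * A ^ N := by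
    have h1 : Aᵀ * X * A = ∑ k ∈ Finset.range N, (A ^ (k + 1))ᵀ * A ^ (k + 1) := by
      rw [hX, Finset.mul_sum, Finset.sum_mul]
      refine Finset.sum_congr rfl fun k _ => ?_
      rw [pow_succ, Matrix.transpose_mul]
      simp only [Matrix.mul_assoc]
    rw [h1, hX, ← Finset.sum_sub_distrib, Finset.sum_range_sub']
    simp
  have hb : ((1 / 2 : ℝ) • (1 : Matrix (Fin m) (Fin m) ℝ) - (A ^ N)ᵀ * A ^ N).PosSemidef := by
    refine Matrix.PosSemidef.smul_one_of_norm_le (by simp) ?_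
    have := Matrix.l2_opNorm_conjTranspose_mul_self (A ^ N)
    rw [Matrix.conjTranspose_eq_transpose_of_trivial] at this
    rw [this, ← sq]
    exact h
  have hXp : X.PosDef := by
    obtain ⟨N, rfl⟩ := Nat.exists_eq_add_of_le' hN
    rw [hX, Finset.sum_range_succ']
    refine Matrix.PosDef.posSemidef_add (Matrix.posSemidef_sum _ fun i _ =>
      Matrix.posSemidef_transpose_mul_self _) ?_
    simpa using Matrix.PosDef.one
  refine ⟨(2 : ℝ) • X, hXp.smul two_pos, ?_⟩
  convert hb.smul (zero_le_two (α := ℝ)) using 1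
  rw [Matrix.mul_smul, Matrix.smul_mul, ← smul_sub, hd]
  module

theorem IsSchurStable.exists_norm_pow_sq_le {A : Matrix (Fin m) (Fin m) ℝ}
    (h : IsSchurStable A) : ∃ N, 1 ≤ N ∧ ‖A ^ N‖ ^ 2 ≤ 1 / 2 := by
  have h1 : Tendsto (fun k => ‖A ^ k‖ ^ 2) atTop (𝓝 0) := by
    simpa using (h.tendsto_pow.norm).pow 2
  obtain ⟨N, hN⟩ := ((h1.eventually (gt_mem_nhds (by norm_num : (0 : ℝ) < 1 / 2))).and
    (eventually_ge_atTop 1)).exists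
  exact ⟨N, hN.2, hN.1.le⟩

/-- Lyapunov's theorem. -/
theorem IsSchurStable.exists_lyapunov {A : Matrix (Fin m) (Fin m) ℝ} (h : IsSchurStable A) :
    ∃ X : Matrix (Fin m) (Fin m) ℝ, X.PosDef ∧ (X - Aᵀ * X * A - 1).PosSemidef := by
  obtain ⟨N, hN, hle⟩ := h.exists_norm_pow_sq_le
  exact exists_lyapunov_of_norm_pow hN hle

theorem IsSchurStable.exists_lyapunov_transpose {A : Matrix (Fin m) (Fin m) ℝ}
    (h : IsSchurStable A) :
    ∃ X : Matrix (Fin m) (Fin m) ℝ, X.PosDef ∧ (X - A * X * Aᵀ - 1).PosSemidef := by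
  obtain ⟨N, hN, hle⟩ := h.exists_norm_pow_sq_le
  have : ‖Aᵀ ^ N‖ ^ 2 ≤ 1 / 2 := by
    rw [← Matrix.transpose_pow, ← Matrix.conjTranspose_eq_transpose_of_trivial,
      Matrix.l2_opNorm_conjTranspose]
    exact hle
  simpa using exists_lyapunov_of_norm_pow hN this

/-- Discrete Lyapunov comparison: `Δ ≥ Aᵀ Δ A` with `A` stable forces `Δ ≥ 0`. -/
theorem IsSchurStable.posSemidef_of_sub {A Δ : Matrix (Fin m) (Fin m) ℝ} (h : IsSchurStable A)
    (hΔ : (Δ - Aᵀ * Δ * A).PosSemidef) : Δ.PosSemidef := by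
  have hk : ∀ k, (Δ - (A ^ k)ᵀ * Δ * A ^ k).PosSemidef := by
    intro k
    induction k with
    | zero => simpa using Matrix.PosSemidef.zero
    | succ k ih =>
      convert ih.add (hΔ.transpose_mul_mul (A ^ k)) using 1
      rw [pow_succ', Matrix.transpose_mul]
      simp only [Matrix.mul_sub, Matrix.sub_mul, Matrix.mul_assoc]
      abel
  have hl : Tendsto (fun k => Δ - (A ^ k)ᵀ * Δ * A ^ k) atTop (𝓝 (Δ - 0ᵀ * Δ * 0)) := by
    have h1 := h.tendsto_pow
    have h2 : Continuous fun Z : Matrix (Fin m) (Fin m) ℝ => Δ - Zᵀ * Δ * Z := by fun_prop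
    exact (h2.tendsto 0).comp h1
  simpa using Matrix.PosSemidef.of_tendsto hl hk

/-- Every root of the characteristic polynomial lies in the unit disc, so each linear factor is at
least `‖z‖ - 1`. Unlike invertibility, this bound is uniform in `A` and survives limits. -/
theorem IsSchurStable.le_norm_det {A : Matrix (Fin m) (Fin m) ℝ} (h : IsSchurStable A) {z : ℂ}
    (hz : 1 ≤ ‖z‖) :
    (‖z‖ - 1) ^ m ≤ ‖(z • (1 : Matrix (Fin m) (Fin m) ℂ) - A.map Complex.ofReal).det‖ := by
  set B := A.map Complex.ofReal
  have h1 : (z • (1 : Matrix (Fin m) (Fin m) ℂ) - B).det = B.charpoly.eval z := by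
    rw [Matrix.eval_charpoly, ← Algebra.algebraMap_eq_smul_one]
    rfl
  have hs : B.charpoly.Splits := IsAlgClosed.splits _
  rw [h1, hs.eval_eq_prod_roots_of_monic B.charpoly_monic]
  have hcard : B.charpoly.roots.card = m := by
    rw [← hs.natDegree_eq_card_roots, Matrix.charpoly_natDegree_eq_dim, Fintype.card_fin]
  have hroot : ∀ x ∈ B.charpoly.roots, ‖z‖ - 1 ≤ ‖z - x‖ := by
    intro x hx
    have hx1 : x ∈ spectrum ℂ B := by
      rw [Matrix.mem_spectrum_iff_isRoot_charpoly]
      exact (Polynomial.mem_roots'.mp hx).2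
    have h2 : (‖x‖₊ : ENNReal) ≤ spectralRadius ℂ B :=
      le_iSup₂ (f := fun k (_ : k ∈ spectrum ℂ B) => (‖k‖₊ : ENNReal)) _ hx1
    have h3 : (‖x‖₊ : ENNReal) < 1 := h2.trans_lt h
    have h4 : ‖x‖ < 1 := by exact_mod_cast h3
    linarith [norm_sub_norm_le z x]
  have key : ∀ s : Multiset ℂ, (∀ x ∈ s, ‖z‖ - 1 ≤ ‖z - x‖) →
      (‖z‖ - 1) ^ s.card ≤ ‖(s.map fun x => z - x).prod‖ := by
    intro s
    induction s using Multiset.induction_on with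
    | empty => simp
    | cons a s ih =>
      intro hs
      rw [Multiset.card_cons, Multiset.map_cons, Multiset.prod_cons, norm_mul, pow_succ']
      refine mul_le_mul (hs a (Multiset.mem_cons_self a s))
        (ih fun x hx => hs x (Multiset.mem_cons_of_mem hx)) (pow_nonneg (by linarith) _)
        (norm_nonneg _)
  simpa [hcard] using key _ hroot

/-- A limit of stable matrices has no eigenvalue outside the closed unit disc. -/
theorem eq_zero_of_tendsto_isSchurStable {A : ℕ → Matrix (Fin m) (Fin m) ℝ}
    {B : Matrix (Fin m) (Fin m) ℝ} (hA : ∀ k, IsSchurStable (A k))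
    (hB : Tendsto A atTop (𝓝 B)) {V : Matrix (Fin m) (Fin 2) ℝ} {α β : ℝ}
    (hαβ : 1 < α ^ 2 + β ^ 2) (hV : B * V = V * rotMatrix α β) : V = 0 := by
  set z : ℂ := (α : ℂ) + β * Complex.I with hz
  have hzn : ‖z‖ ^ 2 = α ^ 2 + β ^ 2 := by
    rw [← Complex.normSq_eq_norm_sq, Complex.normSq_add_mul_I]
  have hz1 : 1 < ‖z‖ := by nlinarith [norm_nonneg z]
  have hc : Continuous fun M : Matrix (Fin m) (Fin m) ℝ =>
      ‖(z • (1 : Matrix (Fin m) (Fin m) ℂ) - M.map Complex.ofReal).det‖ := by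
    have : Continuous fun M : Matrix (Fin m) (Fin m) ℝ => M.map Complex.ofReal :=
      continuous_id.matrix_map Complex.continuous_ofReal
    fun_prop
  have hlim := (hc.tendsto B).comp hB
  have hle : (‖z‖ - 1) ^ m ≤
      ‖(z • (1 : Matrix (Fin m) (Fin m) ℂ) - B.map Complex.ofReal).det‖ :=
    ge_of_tendsto' hlim fun k => (hA k).le_norm_det hz1.le
  have hpos : 0 < (‖z‖ - 1) ^ m := pow_pos (by linarith) m
  have hdet : (z • (1 : Matrix (Fin m) (Fin m) ℂ) - B.map Complex.ofReal).det ≠ 0 :=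
    norm_pos_iff.mp (hpos.trans_le hle)
  by_contra hne
  refine hdet (Matrix.exists_mulVec_eq_zero_iff.mp ⟨complexVec V, fun h0 => hne ?_, ?_⟩)
  · exact complexVec_injective (by rw [h0, complexVec_zero])
  · rw [Matrix.sub_mulVec, ← complexVec_mul, hV, complexVec_mul_rotMatrix, Matrix.smul_mulVec,
      Matrix.one_mulVec, sub_self]

/-- The equation `Y Λ = F Y + U` is solvable for `F` stable and `Λ` outside the open unit disc. -/
theorem IsSchurStable.exists_steadyState {F : Matrix (Fin m) (Fin m) ℝ} (h : IsSchurStable F)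
    {α β : ℝ} (hαβ : 1 ≤ α ^ 2 + β ^ 2) (U : Matrix (Fin m) (Fin 2) ℝ) :
    ∃ Y : Matrix (Fin m) (Fin 2) ℝ, Y * rotMatrix α β = F * Y + U := by
  let T : Matrix (Fin m) (Fin 2) ℝ →ₗ[ℝ] Matrix (Fin m) (Fin 2) ℝ :=
    { toFun := fun Y => Y * rotMatrix α β - F * Y
      map_add' := fun Y Z => by rw [Matrix.add_mul, Matrix.mul_add]; abel
      map_smul' := fun c Y => by
        rw [Matrix.smul_mul, Matrix.mul_smul, ← smul_sub, RingHom.id_apply] }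
  have hinj : Function.Injective T := by
    rw [← LinearMap.ker_eq_bot, LinearMap.ker_eq_bot']
    intro Y hY
    exact isSchurStable_iff.mp h Y α β hαβ (sub_eq_zero.mp hY).symm
  obtain ⟨Y, hY⟩ := (LinearMap.injective_iff_surjective.mp hinj) U
  refine ⟨Y, ?_⟩
  have : Y * rotMatrix α β - F * Y = U := hY
  rw [← this]
  abel

end Stability

/-! ### Continuity of inversion and of strict semidefinite bounds. -/

section Inverse

variable {p : Type*} [Fintype p] [DecidableEq p]

theorem Matrix.continuousAt_nonsing_inv {𝕜 : Type*} [RCLike 𝕜] {X : Matrix p p 𝕜} (hX : IsUnit X.det) :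
    ContinuousAt (fun Y : Matrix p p 𝕜 => Y⁻¹) X := by
  have hu : IsUnit X := (Matrix.isUnit_iff_isUnit_det X).mpr hX
  rw [show (fun Y : Matrix p p 𝕜 => Y⁻¹) = Ring.inverse from
    funext Matrix.nonsing_inv_eq_ringInverse]
  exact NormedRing.inverse_continuousAt hu.unit

theorem Matrix.differentiableAt_nonsing_inv {𝕜 : Type*} [RCLike 𝕜] {X : Matrix p p 𝕜} (hX : IsUnit X.det) :
    DifferentiableAt 𝕜 (fun Y : Matrix p p 𝕜 => Y⁻¹) X := by
  have hu : IsUnit X := (Matrix.isUnit_iff_isUnit_det X).mpr hX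
  rw [show (fun Y : Matrix p p 𝕜 => Y⁻¹) = Ring.inverse from
    funext Matrix.nonsing_inv_eq_ringInverse]
  exact (hasFDerivAt_ringInverse (𝕜 := 𝕜) hu.unit).differentiableAt

/-- Symmetry is a hypothesis at each nearby point because semidefiniteness includes it, and it is
not an open condition. -/
theorem Matrix.eventually_posSemidef_sub_smul_one {E : Type*} [TopologicalSpace E]
    {f : E → Matrix p p ℝ} {a : E} {c c' : ℝ} (hf : ContinuousAt f a) (hc : c' < c)
    (h : (f a - c • (1 : Matrix p p ℝ)).PosSemidef) :
    ∀ᶠ x in 𝓝 a, (f x)ᵀ = f x → (f x - c' • (1 : Matrix p p ℝ)).PosSemidef := by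
  have hev : ∀ᶠ x in 𝓝 a, ‖f a - f x‖ < c - c' := by
    have : ContinuousAt (fun x => ‖f a - f x‖) a := (continuousAt_const.sub hf).norm
    exact this.eventually (gt_mem_nhds (show ‖f a - f a‖ < c - c' by simpa using hc))
  filter_upwards [hev] with x hx hs
  have hfa : (f a)ᵀ = f a := by
    have := h.transpose_eq
    simpa using this
  have h1 := Matrix.PosSemidef.smul_one_of_norm_le (X := f a - f x)
    (by rw [Matrix.transpose_sub, hfa, hs]) hx.le
  convert h.add h1 using 1
  module

end Inverse

/-! ### The Riccati operator, its increments, and supersolutions. -/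

namespace MixedDesign

variable {m d n l : ℕ} (S : MixedDesign m d n l)

/-- `γ² I - Dᵀ P D`. -/
noncomputable def dist (P : Matrix (Fin m) (Fin m) ℝ) : Matrix (Fin n) (Fin n) ℝ :=
  S.γ ^ 2 • (1 : Matrix (Fin n) (Fin n) ℝ) - S.Dᵀ * P * S.D

/-- The worst-case disturbance gain `(γ² I - Dᵀ P D)⁻¹ Dᵀ P`. -/
noncomputable def gain (P : Matrix (Fin m) (Fin m) ℝ) : Matrix (Fin n) (Fin m) ℝ :=
  (S.dist P)⁻¹ * (S.Dᵀ * P)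

/-- The worst-case amplification `I + D (γ² I - Dᵀ P D)⁻¹ Dᵀ P = (I - γ⁻² D Dᵀ P)⁻¹`. -/
noncomputable def amp (P : Matrix (Fin m) (Fin m) ℝ) : Matrix (Fin m) (Fin m) ℝ :=
  1 + S.D * S.gain P

/-- The Riccati operator `Fᵀ P̃ F + Q - P`. -/
noncomputable def ric (F Q P : Matrix (Fin m) (Fin m) ℝ) : Matrix (Fin m) (Fin m) ℝ :=
  Fᵀ * S.tilde P * F + Q - P

/-- Stabilizing solutions of `Fᵀ P̃ F + Q - P = 0`. -/
structure Stabilizing (F Q P : Matrix (Fin m) (Fin m) ℝ) : Prop where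
  posSemidef : P.PosSemidef
  ric_eq : S.ric F Q P = 0
  posDef : (S.dist P).PosDef
  stable : IsSchurStable (S.amp P * F)

variable {S} {F Q P P₁ P₂ : Matrix (Fin m) (Fin m) ℝ}

theorem tilde_eq (P : Matrix (Fin m) (Fin m) ℝ) : S.tilde P = P + P * (S.D * S.gain P) := by
  simp only [tilde, gain, dist, Matrix.mul_assoc]

theorem tilde_eq_mul_amp (P : Matrix (Fin m) (Fin m) ℝ) : S.tilde P = P * S.amp P := by
  rw [tilde_eq, amp, Matrix.mul_add, Matrix.mul_one]

theorem dist_transpose (hs : Pᵀ = P) : (S.dist P)ᵀ = S.dist P := by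
  simp [dist, hs, Matrix.mul_assoc]

theorem dist_mul_gain (hM : (S.dist P).PosDef) : S.dist P * S.gain P = S.Dᵀ * P := by
  rw [gain, Matrix.mul_nonsing_inv_cancel_left _ _ hM.det_pos.ne'.isUnit]

theorem gain_transpose_mul_dist (hs : Pᵀ = P) (hM : (S.dist P).PosDef) :
    (S.gain P)ᵀ * S.dist P = P * S.D := by
  have := congrArg Matrix.transpose (S.dist_mul_gain hM)
  rwa [Matrix.transpose_mul, Matrix.transpose_mul, dist_transpose hs, hs,
    Matrix.transpose_transpose] at this

theorem D_mul_gain (hM : (S.dist P).PosDef) :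
    S.Dᵀ * (P * (S.D * S.gain P)) = S.γ ^ 2 • S.gain P - S.Dᵀ * P := by
  have := S.dist_mul_gain hM
  rw [dist, Matrix.sub_mul, Matrix.smul_mul, Matrix.one_mul] at this
  rw [← this]
  simp only [Matrix.mul_assoc]
  abel

theorem gain_transpose_mul (hs : Pᵀ = P) (hM : (S.dist P).PosDef) :
    (S.gain P)ᵀ * (S.Dᵀ * P) = P * (S.D * S.gain P) := by
  rw [← dist_mul_gain hM, ← Matrix.mul_assoc, gain_transpose_mul_dist hs hM, Matrix.mul_assoc]

theorem D_mul_amp (hM : (S.dist P).PosDef) :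
    S.Dᵀ * (P * S.amp P) = S.γ ^ 2 • S.gain P := by
  rw [amp, Matrix.mul_add, Matrix.mul_one, Matrix.mul_add, D_mul_gain hM]
  abel

theorem tilde_transpose (hs : Pᵀ = P) (hM : (S.dist P).PosDef) : (S.tilde P)ᵀ = S.tilde P := by
  rw [tilde_eq, Matrix.transpose_add, hs, ← gain_transpose_mul hs hM]
  congr 1
  rw [Matrix.transpose_mul, Matrix.transpose_mul, hs, Matrix.transpose_transpose,
    Matrix.transpose_transpose, Matrix.mul_assoc, gain_transpose_mul hs hM]

/-- Completing the square in the disturbance. -/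
theorem complete_square {r : Type*} (hs : Pᵀ = P) (hM : (S.dist P).PosDef)
    (x : Matrix (Fin m) r ℝ) (w : Matrix (Fin n) r ℝ) :
    (x + S.D * w)ᵀ * P * (x + S.D * w) - S.γ ^ 2 • (wᵀ * w) =
      xᵀ * S.tilde P * x - (w - S.gain P * x)ᵀ * S.dist P * (w - S.gain P * x) := by
  have h1 : S.dist P * (S.gain P * x) = S.Dᵀ * (P * x) := by
    rw [← Matrix.mul_assoc, dist_mul_gain hM, Matrix.mul_assoc]
  have h2 : ∀ Z : Matrix (Fin n) r ℝ, (S.gain P)ᵀ * (S.dist P * Z) = P * (S.D * Z) := fun Z => by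
    rw [← Matrix.mul_assoc, gain_transpose_mul_dist hs hM, Matrix.mul_assoc]
  have h3 : S.dist P * w = S.γ ^ 2 • w - S.Dᵀ * (P * (S.D * w)) := by
    rw [dist, Matrix.sub_mul, Matrix.smul_mul, Matrix.one_mul]
    simp only [Matrix.mul_assoc]
  rw [tilde_eq]
  simp only [Matrix.transpose_add, Matrix.transpose_sub, Matrix.transpose_mul, Matrix.add_mul,
    Matrix.mul_add, Matrix.sub_mul, Matrix.mul_sub, Matrix.mul_assoc, h1, h2]
  have h4 : (S.gain P)ᵀ * (S.Dᵀ * (P * x)) = P * (S.D * (S.gain P * x)) := by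
    have := congrArg (· * x) (gain_transpose_mul hs hM)
    simpa only [Matrix.mul_assoc] using this
  rw [h3, h4]
  simp only [Matrix.mul_sub, Matrix.mul_smul]
  abel

theorem amp_mul {r : Type*} (P : Matrix (Fin m) (Fin m) ℝ) (x : Matrix (Fin m) r ℝ) :
    S.amp P * x = x + S.D * (S.gain P * x) := by
  rw [amp, Matrix.add_mul, Matrix.one_mul, Matrix.mul_assoc]

/-- Complete the square for both matrices at the same disturbance, the worst case for `P₁`: one
square vanishes and the other remains as the error term. -/
theorem tilde_sub_tilde (hs₁ : P₁ᵀ = P₁) (hM₁ : (S.dist P₁).PosDef) (hs₂ : P₂ᵀ = P₂)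
    (hM₂ : (S.dist P₂).PosDef) :
    S.tilde P₂ - S.tilde P₁ = (S.amp P₁)ᵀ * (P₂ - P₁) * S.amp P₁ +
      (S.gain P₁ - S.gain P₂)ᵀ * S.dist P₂ * (S.gain P₁ - S.gain P₂) := by
  have e1 := complete_square hs₁ hM₁ (1 : Matrix (Fin m) (Fin m) ℝ) (S.gain P₁)
  have e2 := complete_square hs₂ hM₂ (1 : Matrix (Fin m) (Fin m) ℝ) (S.gain P₁)
  simp only [Matrix.mul_one, Matrix.transpose_one, Matrix.one_mul, sub_self, Matrix.mul_zero,
    sub_zero] at e1 e2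
  rw [← e1, sub_eq_iff_eq_add.mp e2.symm, amp, Matrix.mul_sub _ P₂ P₁, Matrix.sub_mul (_ * P₂)]
  abel

theorem tilde_sub_tilde' (hs₁ : P₁ᵀ = P₁) (hM₁ : (S.dist P₁).PosDef) (hs₂ : P₂ᵀ = P₂)
    (hM₂ : (S.dist P₂).PosDef) :
    S.tilde P₂ - S.tilde P₁ = (S.amp P₂)ᵀ * (P₂ - P₁) * S.amp P₂ -
      (S.gain P₂ - S.gain P₁)ᵀ * S.dist P₁ * (S.gain P₂ - S.gain P₁) := by
  have := tilde_sub_tilde hs₂ hM₂ hs₁ hM₁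
  rw [← neg_sub, this, ← neg_sub P₂ P₁, Matrix.mul_neg, Matrix.neg_mul]
  abel

theorem tilde_mono (hs₁ : P₁ᵀ = P₁) (hM₁ : (S.dist P₁).PosDef) (hs₂ : P₂ᵀ = P₂)
    (hM₂ : (S.dist P₂).PosDef) (h : (P₂ - P₁).PosSemidef) :
    (S.tilde P₂ - S.tilde P₁).PosSemidef := by
  rw [tilde_sub_tilde hs₁ hM₁ hs₂ hM₂]
  exact (h.transpose_mul_mul _).add (hM₂.posSemidef.transpose_mul_mul _)

theorem tilde_sub_self (hs : Pᵀ = P) (hM : (S.dist P).PosDef) :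
    S.tilde P = P + (S.gain P)ᵀ * S.dist P * S.gain P := by
  rw [tilde_eq, Matrix.mul_assoc, dist_mul_gain hM, gain_transpose_mul hs hM]

theorem tilde_posSemidef (hP : P.PosSemidef) (hM : (S.dist P).PosDef) :
    (S.tilde P).PosSemidef := by
  rw [tilde_sub_self hP.transpose_eq hM]
  exact hP.add (hM.posSemidef.transpose_mul_mul _)

/-- An increment is a Lyapunov operator of the worst-case loop at `P₁` plus a nonnegative square, so
Lyapunov comparison applies to a nonlinear equation. -/
theorem ric_sub_ric (hs₁ : P₁ᵀ = P₁) (hM₁ : (S.dist P₁).PosDef) (hs₂ : P₂ᵀ = P₂)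
    (hM₂ : (S.dist P₂).PosDef) :
    S.ric F Q P₂ - S.ric F Q P₁ = (S.amp P₁ * F)ᵀ * (P₂ - P₁) * (S.amp P₁ * F) - (P₂ - P₁) +
      ((S.gain P₁ - S.gain P₂) * F)ᵀ * S.dist P₂ * ((S.gain P₁ - S.gain P₂) * F) := by
  have h : S.ric F Q P₂ - S.ric F Q P₁ = Fᵀ * (S.tilde P₂ - S.tilde P₁) * F - (P₂ - P₁) := by
    rw [ric, ric, Matrix.mul_sub, Matrix.sub_mul]
    abel
  rw [h, tilde_sub_tilde hs₁ hM₁ hs₂ hM₂, Matrix.mul_add, Matrix.add_mul, Matrix.transpose_mul,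
    Matrix.transpose_mul]
  simp only [Matrix.mul_assoc]
  abel

theorem dist_sub (P₁ P₂ : Matrix (Fin m) (Fin m) ℝ) :
    S.dist P₁ - S.dist P₂ = S.Dᵀ * (P₂ - P₁) * S.D := by
  simp only [dist, Matrix.mul_sub, Matrix.sub_mul]
  abel

theorem dist_posDef_of_le (h : (P₂ - P₁).PosSemidef) (hM : (S.dist P₂).PosDef) :
    (S.dist P₁).PosDef := by
  have h1 := hM.add_posSemidef (h.transpose_mul_mul S.D)
  rwa [← dist_sub, add_sub_cancel] at h1

/-- The stabilizing solution lies below every supersolution. -/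
theorem Stabilizing.le_of_ric_nonpos (h : S.Stabilizing F Q P) (hs : P₂ᵀ = P₂)
    (hM : (S.dist P₂).PosDef) (hr : (-S.ric F Q P₂).PosSemidef) : (P₂ - P).PosSemidef := by
  -- The gap satisfies a Lyapunov inequality for the stable worst-case loop of `P`.
  refine h.stable.posSemidef_of_sub ?_
  have e := ric_sub_ric (F := F) (Q := Q) h.posSemidef.transpose_eq h.posDef hs hM
  rw [h.ric_eq, sub_zero] at e
  convert hr.add (hM.posSemidef.transpose_mul_mul ((S.gain P - S.gain P₂) * F)) using 1
  rw [e]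
  abel

theorem amp_mul_ric_form {r : Type*} (hs : Pᵀ = P) (hM : (S.dist P).PosDef)
    (x : Matrix (Fin m) r ℝ) (w : Matrix (Fin n) r ℝ) :
    (F * x + S.D * w)ᵀ * P * (F * x + S.D * w) - S.γ ^ 2 • (wᵀ * w) =
      xᵀ * S.ric F Q P * x - xᵀ * Q * x + xᵀ * P * x -
        (w - S.gain P * (F * x))ᵀ * S.dist P * (w - S.gain P * (F * x)) := by
  rw [complete_square hs hM, ric]
  simp only [Matrix.mul_sub, Matrix.sub_mul, Matrix.mul_add, Matrix.add_mul, Matrix.transpose_mul,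
    Matrix.mul_assoc]
  abel

/-- A supersolution whose slack detects the marginal modes of the worst-case closed loop yields a
stable closed loop. -/
theorem isSchurStable_of_supersolution (hP : P.PosSemidef) (hM : (S.dist P).PosDef)
    (hQ : Q.PosSemidef) (hr : (-S.ric F Q P).PosSemidef)
    (hker : ∀ (V : Matrix (Fin m) (Fin 2) ℝ) (α β : ℝ), 1 ≤ α ^ 2 + β ^ 2 →
      S.amp P * F * V = V * rotMatrix α β → S.ric F Q P * V = 0 → V = 0) :
    IsSchurStable F := by
  rw [isSchurStable_iff]
  intro V α β hαβ hV
  -- Energy balance along a mode of `F` with zero disturbance. All terms have the same sign, so the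
  -- slack vanishes on `V` and zero is the worst-case disturbance; hence `V` is also a mode of `amp
  -- P * F`.
  have e := congrArg Matrix.trace
    (amp_mul_ric_form (F := F) (Q := Q) hP.transpose_eq hM V (0 : Matrix (Fin n) (Fin 2) ℝ))
  simp only [Matrix.mul_zero, add_zero, smul_zero, sub_zero, zero_sub] at e
  rw [hV, trace_rotMatrix, Matrix.trace_sub, Matrix.trace_add, Matrix.trace_sub] at e
  have t1 := (hP.transpose_mul_mul V).trace_nonneg
  have t2 := (hr.transpose_mul_mul V).trace_nonneg
  have t3 := (hQ.transpose_mul_mul V).trace_nonneg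
  have t4 := (hM.posSemidef.transpose_mul_mul (-(S.gain P * (V * rotMatrix α β)))).trace_nonneg
  have t2' : (Vᵀ * (-S.ric F Q P) * V).trace = -(Vᵀ * S.ric F Q P * V).trace := by simp
  have t5 : 0 ≤ (α ^ 2 + β ^ 2 - 1) * (Vᵀ * P * V).trace := mul_nonneg (by linarith) t1
  have z1 : -(S.gain P * (V * rotMatrix α β)) = 0 := hM.eq_zero_of_trace (by linarith)
  have z2 : -S.ric F Q P * V = 0 := hr.mul_eq_zero_of_trace (by linarith)
  refine hker V α β hαβ ?_ (by simpa using z2)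
  rw [Matrix.mul_assoc, amp_mul, hV, neg_eq_zero.mp z1, Matrix.mul_zero, add_zero]

/-- Under the same hypotheses the frequency response is strictly below the level `γ`. -/
theorem frequency_of_supersolution (hP : P.PosSemidef) (hM : (S.dist P).PosDef)
    (hr : (-S.ric F Q P).PosSemidef)
    (hker : ∀ (V : Matrix (Fin m) (Fin 2) ℝ) (α β : ℝ), 1 ≤ α ^ 2 + β ^ 2 →
      S.amp P * F * V = V * rotMatrix α β → S.ric F Q P * V = 0 → V = 0)
    {α β : ℝ} (hαβ : α ^ 2 + β ^ 2 = 1) {x : Matrix (Fin m) (Fin 2) ℝ}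
    {w : Matrix (Fin n) (Fin 2) ℝ} (hx : x * rotMatrix α β = F * x + S.D * w)
    (hw : S.γ ^ 2 * (wᵀ * w).trace ≤ (xᵀ * Q * x).trace) : w = 0 := by
  -- On the unit circle the storage terms cancel. The reverse gain inequality then forces `w` to be
  -- the worst-case disturbance and the slack to vanish on `x`.
  have e := congrArg Matrix.trace
    (amp_mul_ric_form (F := F) (Q := Q) hP.transpose_eq hM x w)
  rw [← hx, Matrix.trace_sub, trace_rotMatrix, Matrix.trace_sub, Matrix.trace_add,
    Matrix.trace_sub, hαβ, one_mul, Matrix.trace_smul, smul_eq_mul] at e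
  have t2 := (hr.transpose_mul_mul x).trace_nonneg
  have t4 := (hM.posSemidef.transpose_mul_mul (w - S.gain P * (F * x))).trace_nonneg
  have t2' : (xᵀ * (-S.ric F Q P) * x).trace = -(xᵀ * S.ric F Q P * x).trace := by simp
  have z1 : w - S.gain P * (F * x) = 0 := hM.eq_zero_of_trace (by linarith)
  have z2 : -S.ric F Q P * x = 0 := hr.mul_eq_zero_of_trace (by linarith)
  have hx0 : x = 0 := by
    refine hker x α β hαβ.ge ?_ (by simpa using z2)
    rw [Matrix.mul_assoc, amp_mul, ← sub_eq_zero.mp z1, hx]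
  rw [sub_eq_zero.mp z1, hx0, Matrix.mul_zero, Matrix.mul_zero]

theorem continuous_dist : Continuous S.dist := by
  unfold dist
  fun_prop

theorem continuousAt_gain (hM : (S.dist P).PosDef) : ContinuousAt S.gain P := by
  have h1 : ContinuousAt (fun P => (S.dist P)⁻¹) P :=
    ContinuousAt.comp (f := S.dist) (g := fun Y => Y⁻¹)
      (Matrix.continuousAt_nonsing_inv hM.det_pos.ne'.isUnit) S.continuous_dist.continuousAt
  have h2 : ContinuousAt (fun P => S.Dᵀ * P) P := Continuous.continuousAt (by fun_prop)
  have h3 : Continuous fun x : Matrix (Fin n) (Fin n) ℝ × Matrix (Fin n) (Fin m) ℝ =>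
    x.1 * x.2 := by fun_prop
  exact ContinuousAt.comp (g := fun x : Matrix (Fin n) (Fin n) ℝ × Matrix (Fin n) (Fin m) ℝ =>
    x.1 * x.2) h3.continuousAt (h1.prodMk h2)

theorem continuousAt_amp (hM : (S.dist P).PosDef) : ContinuousAt S.amp P := by
  have h3 : Continuous fun x : Matrix (Fin n) (Fin m) ℝ => 1 + S.D * x := by fun_prop
  exact ContinuousAt.comp (f := S.gain) (g := fun x => 1 + S.D * x) h3.continuousAt
    (continuousAt_gain hM)

theorem continuousAt_tilde (hM : (S.dist P).PosDef) : ContinuousAt S.tilde P := by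
  have h : S.tilde = fun P => P * S.amp P := funext S.tilde_eq_mul_amp
  rw [h]
  exact continuousAt_id.mul (continuousAt_amp hM)

theorem dist_zero : S.dist 0 = S.γ ^ 2 • (1 : Matrix (Fin n) (Fin n) ℝ) := by simp [dist]

theorem tilde_zero : S.tilde 0 = 0 := by simp [tilde]

/-- A strict supersolution of the Riccati equation gives a stabilizing solution. -/
theorem exists_stabilizing_of_strict (hQ : Q.PosSemidef) (hP : P.PosSemidef)
    (hM : (S.dist P).PosDef) (hr : (-S.ric F Q P).PosDef) : ∃ X, S.Stabilizing F Q X := by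
  -- Value iteration from `0` increases and stays below the supersolution.
  let step : Matrix (Fin m) (Fin m) ℝ → Matrix (Fin m) (Fin m) ℝ :=
    fun X => Fᵀ * S.tilde X * F + Q
  let X : ℕ → Matrix (Fin m) (Fin m) ℝ := fun k => step^[k] 0
  have hX : ∀ k, X (k + 1) = Fᵀ * S.tilde (X k) * F + Q := fun k =>
    Function.iterate_succ_apply' step k 0
  have hmono : ∀ Y Z : Matrix (Fin m) (Fin m) ℝ, Y.PosSemidef → (Z - Y).PosSemidef →
      (P - Z).PosSemidef → (step Z - step Y).PosSemidef := by
    intro Y Z hY hYZ hZ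
    have hZp : Z.PosSemidef := by simpa using hYZ.add hY
    have hMZ := S.dist_posDef_of_le hZ hM
    have hMY := S.dist_posDef_of_le hYZ hMZ
    convert (tilde_mono hY.transpose_eq hMY hZp.transpose_eq hMZ hYZ).transpose_mul_mul F using 1
    simp only [step, Matrix.mul_sub, Matrix.sub_mul]
    abel
  have hle : ∀ k, (X k).PosSemidef ∧ (X (k + 1) - X k).PosSemidef ∧ (P - X k).PosSemidef := by
    intro k
    induction k with
    | zero =>
      refine ⟨Matrix.PosSemidef.zero, ?_, by simpa [X] using hP⟩
      simpa [X, step, tilde_zero] using hQ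
    | succ k ih =>
      obtain ⟨h0, h1, h2⟩ := ih
      have h0' : (X (k + 1)).PosSemidef := by simpa using h1.add h0
      have h2' : (P - X (k + 1)).PosSemidef := by
        convert (hmono (X k) P h0 h2 (by simpa using Matrix.PosSemidef.zero)).add hr.posSemidef
          using 1
        rw [hX, ric]
        simp only [step]
        abel
      refine ⟨h0', ?_, h2'⟩
      have := hmono (X k) (X (k + 1)) h0 h1 h2'
      rw [hX (k + 1)]
      nth_rewrite 2 [hX k]
      exact this
  obtain ⟨Y, hY, hYle⟩ := Matrix.exists_tendsto_of_decreasing (P := fun k => -X k) (B := -P)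
    (fun k => by simpa [sub_eq_add_neg, add_comm] using (hle k).2.1)
    (fun k => by simpa [sub_eq_add_neg, add_comm] using (hle k).2.2)
  have hlim : Tendsto X atTop (𝓝 (-Y)) := by simpa using hY.neg
  generalize -Y = Z at hlim
  have hZ : Z.PosSemidef := Matrix.PosSemidef.of_tendsto hlim fun k => (hle k).1
  have hPZ : (P - Z).PosSemidef :=
    Matrix.PosSemidef.of_tendsto (tendsto_const_nhds.sub hlim) fun k => (hle k).2.2
  have hMZ := S.dist_posDef_of_le hPZ hM
  have hfix : Z = Fᵀ * S.tilde Z * F + Q := by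
    have h1 := (tendsto_add_atTop_iff_nat 1).mpr hlim
    have hc : Continuous fun T : Matrix (Fin m) (Fin m) ℝ => Fᵀ * T * F + Q := by fun_prop
    have h2 : Tendsto (fun k => Fᵀ * S.tilde (X k) * F + Q) atTop
        (𝓝 (Fᵀ * S.tilde Z * F + Q)) :=
      (hc.tendsto _).comp ((continuousAt_tilde hMZ).tendsto.comp hlim)
    exact tendsto_nhds_unique h1 (h2.congr fun k => (hX k).symm)
  have hric : S.ric F Q Z = 0 := by
    rw [ric, ← hfix, sub_self]
  refine ⟨Z, hZ, hric, hMZ, ?_⟩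
  rw [isSchurStable_iff]
  intro V α β hαβ hV
  -- Along a mode of modulus at least one, `P - Z ≥ 0` makes the residual of `P` nonnegative,
  -- against its strict negativity.
  have e := ric_sub_ric (F := F) (Q := Q) hZ.transpose_eq hMZ hP.transpose_eq hM
  rw [hric, sub_zero] at e
  have e2 : (Vᵀ * S.ric F Q P * V).trace = (α ^ 2 + β ^ 2) * (Vᵀ * (P - Z) * V).trace -
      (Vᵀ * (P - Z) * V).trace +
      (Vᵀ * (((S.gain Z - S.gain P) * F)ᵀ * S.dist P * ((S.gain Z - S.gain P) * F)) * V).trace := by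
    rw [e, Matrix.mul_add, Matrix.add_mul, Matrix.trace_add, Matrix.mul_sub, Matrix.sub_mul,
      Matrix.trace_sub, ← trace_rotMatrix, ← hV]
    simp only [Matrix.transpose_mul, Matrix.mul_assoc]
  have t1 := (hPZ.transpose_mul_mul V).trace_nonneg
  have t2 := ((hM.posSemidef.transpose_mul_mul
    ((S.gain Z - S.gain P) * F)).transpose_mul_mul V).trace_nonneg
  have t3 : 0 ≤ (α ^ 2 + β ^ 2 - 1) * (Vᵀ * (P - Z) * V).trace := mul_nonneg (by linarith) t1
  have t4 := (hr.posSemidef.transpose_mul_mul V).trace_nonneg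
  have t5 : (Vᵀ * (-S.ric F Q P) * V).trace = -(Vᵀ * S.ric F Q P * V).trace := by simp
  exact hr.eq_zero_of_trace (by linarith)

end MixedDesign

/-! ### Resolvents of stable matrices outside the open disc. -/

section Spectrum

variable {m : ℕ}

theorem IsSchurStable.norm_lt_one {A : Matrix (Fin m) (Fin m) ℝ} (h : IsSchurStable A) {z : ℂ}
    (hz : z ∈ spectrum ℂ (A.map Complex.ofReal)) : ‖z‖ < 1 := by
  have h1 : (‖z‖₊ : ENNReal) ≤ spectralRadius ℂ (A.map Complex.ofReal) :=
    le_iSup₂ (f := fun k (_ : k ∈ spectrum ℂ (A.map Complex.ofReal)) => (‖k‖₊ : ENNReal)) _ hz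
  exact_mod_cast h1.trans_lt h

theorem IsSchurStable.isUnit_det_smul_sub {A : Matrix (Fin m) (Fin m) ℝ} (h : IsSchurStable A)
    {z : ℂ} (hz : 1 ≤ ‖z‖) :
    IsUnit (z • (1 : Matrix (Fin m) (Fin m) ℂ) - A.map Complex.ofReal).det := by
  rw [isUnit_iff_ne_zero]
  intro h0
  obtain ⟨v, hv, hv0⟩ := Matrix.exists_mulVec_eq_zero_iff.mpr h0
  refine absurd (h.norm_lt_one (mem_spectrum_iff_exists_mulVec.mpr ⟨v, hv, ?_⟩)) hz.not_gt
  rw [Matrix.sub_mulVec, Matrix.smul_mulVec, Matrix.one_mulVec, sub_eq_zero] at hv0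
  exact hv0.symm

theorem IsSchurStable.isUnit_det_one_sub_smul {A : Matrix (Fin m) (Fin m) ℝ}
    (h : IsSchurStable A) {ζ : ℂ} (hζ : ‖ζ‖ ≤ 1) :
    IsUnit (1 - ζ • A.map Complex.ofReal).det := by
  rw [isUnit_iff_ne_zero]
  intro h0
  obtain ⟨v, hv, hv0⟩ := Matrix.exists_mulVec_eq_zero_iff.mpr h0
  rw [Matrix.sub_mulVec, Matrix.smul_mulVec, Matrix.one_mulVec, sub_eq_zero] at hv0
  have hζ0 : ζ ≠ 0 := by
    rintro rfl
    exact hv (by simpa using hv0)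
  have h1 : ‖ζ⁻¹‖ < 1 := h.norm_lt_one (mem_spectrum_iff_exists_mulVec.mpr ⟨v, hv, by
    conv_rhs => rw [hv0, smul_smul, inv_mul_cancel₀ hζ0, one_smul]⟩)
  rw [norm_inv] at h1
  exact absurd h1 (not_lt.mpr ((one_le_inv₀ (norm_pos_iff.mpr hζ0)).mpr hζ))

end Spectrum

/-! ### The bounded real lemma by continuation. -/

namespace MixedDesign

variable {m d n l : ℕ} {S : MixedDesign m d n l} {F Q P P₁ P₂ : Matrix (Fin m) (Fin m) ℝ}

theorem ric_sub_ric' (hs₁ : P₁ᵀ = P₁) (hM₁ : (S.dist P₁).PosDef) (hs₂ : P₂ᵀ = P₂)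
    (hM₂ : (S.dist P₂).PosDef) :
    S.ric F Q P₂ - S.ric F Q P₁ = (S.amp P₂ * F)ᵀ * (P₂ - P₁) * (S.amp P₂ * F) - (P₂ - P₁) -
      ((S.gain P₂ - S.gain P₁) * F)ᵀ * S.dist P₁ * ((S.gain P₂ - S.gain P₁) * F) := by
  have := ric_sub_ric (F := F) (Q := Q) hs₂ hM₂ hs₁ hM₁
  rw [← neg_sub, this, ← neg_sub P₂ P₁, Matrix.mul_neg, Matrix.neg_mul]
  abel

/-- Raising a solution by a small multiple of a Lyapunov matrix of the closed loop produces slack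
in the Riccati inequality. -/
theorem ric_add_smul (hs : Pᵀ = P) (hM : (S.dist P).PosDef) {X : Matrix (Fin m) (Fin m) ℝ}
    {δ : ℝ} (hδ : 0 ≤ δ) (hX : Xᵀ = X) (hM' : (S.dist (P + δ • X)).PosDef)
    (hc : (X - (S.amp (P + δ • X) * F)ᵀ * X * (S.amp (P + δ • X) * F) -
      (1 / 2 : ℝ) • (1 : Matrix (Fin m) (Fin m) ℝ)).PosSemidef) :
    (S.ric F Q P - S.ric F Q (P + δ • X) -
      (δ / 2) • (1 : Matrix (Fin m) (Fin m) ℝ)).PosSemidef := by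
  have e := ric_sub_ric' (F := F) (Q := Q) hs hM (P₂ := P + δ • X) (by simp [hs, hX]) hM'
  rw [← neg_sub (S.ric F Q (P + δ • X)), e]
  convert (hc.smul hδ).add (hM.posSemidef.transpose_mul_mul
    ((S.gain (P + δ • X) - S.gain P) * F)) using 1
  rw [add_sub_cancel_left, Matrix.mul_smul, Matrix.smul_mul]
  module

/-- Strict Lyapunov inequalities are open: one `X` serves all nearby pairs, at the price of lowering
the slack from `1` to `1/2`. It feeds both the continuation argument and the quadratic growth
estimate. -/
theorem Stabilizing.exists_contraction (h : S.Stabilizing F Q P) :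
    ∃ X : Matrix (Fin m) (Fin m) ℝ, X.PosDef ∧
      ∀ᶠ y : Matrix (Fin m) (Fin m) ℝ × Matrix (Fin m) (Fin m) ℝ in 𝓝 (F, P),
        (y.2)ᵀ = y.2 → (S.dist y.2).PosDef ∧
          (X - (S.amp y.2 * y.1)ᵀ * X * (S.amp y.2 * y.1) -
            (1 / 2 : ℝ) • (1 : Matrix (Fin m) (Fin m) ℝ)).PosSemidef := by
  obtain ⟨X, hX, hXl⟩ := h.stable.exists_lyapunov
  refine ⟨X, hX, ?_⟩
  have ha : ContinuousAt (fun y : Matrix (Fin m) (Fin m) ℝ × Matrix (Fin m) (Fin m) ℝ =>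
      S.amp y.2 * y.1) (F, P) :=
    (ContinuousAt.comp (f := Prod.snd) (g := S.amp) (x := (F, P))
      (continuousAt_amp h.posDef) continuousAt_snd).mul continuousAt_fst
  have hb : Continuous fun Z : Matrix (Fin m) (Fin m) ℝ => X - Zᵀ * X * Z := by fun_prop
  have h1 := Matrix.eventually_posSemidef_sub_smul_one (c := 1) (c' := 1 / 2)
    (ContinuousAt.comp (g := fun Z : Matrix (Fin m) (Fin m) ℝ => X - Zᵀ * X * Z)
      hb.continuousAt ha) (by norm_num) (by simpa using hXl)
  obtain ⟨ε, hε, hεM⟩ := h.posDef.exists_sub_smul_one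
  have h2 := Matrix.eventually_posSemidef_sub_smul_one (c := ε) (c' := ε / 2)
    (f := fun y : Matrix (Fin m) (Fin m) ℝ × Matrix (Fin m) (Fin m) ℝ => S.dist y.2) (a := (F, P))
    (S.continuous_dist.comp continuous_snd).continuousAt (by linarith) hεM
  filter_upwards [h1, h2] with y hy1 hy2 hs
  refine ⟨Matrix.posDef_of_sub_smul_one (half_pos hε) (hy2 (dist_transpose hs)), hy1 ?_⟩
  simp [hX.transpose_eq, Matrix.mul_assoc]

/-- The openness half of the continuation. Raising `P` by `δ X` creates slack `δ / 2`, which pays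
for increasing `t` to `s` as long as `‖(s - t) Q‖ < δ / 2`. -/
theorem Stabilizing.eventually_exists (hQ : Q.PosSemidef) {t : ℝ}
    (h : S.Stabilizing F (t • Q) P) :
    ∀ᶠ s in 𝓝[>] t, 0 ≤ s → ∃ X, S.Stabilizing F (s • Q) X := by
  obtain ⟨X, hX, hev⟩ := h.exists_contraction
  have hpath : Tendsto (fun δ : ℝ => (F, P + δ • X)) (𝓝[>] 0) (𝓝 (F, P)) := by
    have hc : Continuous fun δ : ℝ => (F, P + δ • X) := by fun_prop
    have := hc.tendsto 0
    simp only [zero_smul, add_zero] at this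
    exact this.mono_left nhdsWithin_le_nhds
  obtain ⟨δ, hδ, hδ0⟩ := ((hpath.eventually hev).and self_mem_nhdsWithin).exists
  have hδ0 : 0 < δ := hδ0
  obtain ⟨hM', hc⟩ := hδ (by simp [h.posSemidef.transpose_eq, hX.transpose_eq])
  have hsl := ric_add_smul (Q := t • Q) h.posSemidef.transpose_eq h.posDef hδ0.le hX.transpose_eq
    hM' hc
  rw [h.ric_eq] at hsl
  have hsmall : ∀ᶠ s in 𝓝 t, ‖(s - t) • Q‖ < δ / 2 := by
    have hc : Continuous fun s : ℝ => ‖(s - t) • Q‖ := by fun_prop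
    exact hc.continuousAt.eventually (gt_mem_nhds (by simpa using hδ0))
  filter_upwards [nhdsWithin_le_nhds hsmall] with s hs hs0
  refine exists_stabilizing_of_strict (P := P + δ • X) (hQ.smul hs0)
    (h.posSemidef.add (hX.posSemidef.smul hδ0.le)) hM' ?_
  refine Matrix.posDef_of_sub_smul_one (ε := δ / 2 - ‖(s - t) • Q‖) (by linarith) ?_
  have h3 := Matrix.posSemidef_norm_smul_one_sub (X := (s - t) • Q)
    (by rw [Matrix.transpose_smul, hQ.transpose_eq])
  convert hsl.add h3 using 1
  simp only [ric]
  module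

/-- `P` is bounded in terms of `γ` and `D` only. -/
theorem trace_le_of_dist (hD : (S.D * S.Dᵀ).PosDef) (hM : (S.dist P).PosSemidef) :
    P.trace ≤ S.γ ^ 2 * ((S.D * S.Dᵀ)⁻¹).trace := by
  have hu : IsUnit (S.D * S.Dᵀ).det := hD.det_pos.ne'.isUnit
  set T := S.D * S.Dᵀ with hT
  have h1 := ((hM.mul_mul_transpose S.D).transpose_mul_mul T⁻¹).trace_nonneg
  have hTt : (T⁻¹)ᵀ = T⁻¹ := hD.inv.transpose_eq
  -- Full row rank of `D` turns the bound on `Dᵀ P D` into a bound on `P` itself.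
  have e : (T⁻¹)ᵀ * (S.D * S.dist P * S.Dᵀ) * T⁻¹ = S.γ ^ 2 • T⁻¹ - P := by
    have e1 : S.D * S.dist P * S.Dᵀ = S.γ ^ 2 • T - T * P * T := by
      simp only [dist, hT, Matrix.mul_sub, Matrix.sub_mul, Matrix.mul_smul, Matrix.smul_mul,
        Matrix.mul_one, Matrix.mul_assoc]
    rw [e1, hTt, Matrix.mul_sub, Matrix.sub_mul, Matrix.mul_smul, Matrix.smul_mul,
      Matrix.nonsing_inv_mul _ hu, Matrix.one_mul, Matrix.mul_assoc, Matrix.mul_assoc,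
      Matrix.mul_assoc, Matrix.mul_nonsing_inv _ hu, Matrix.mul_one,
      Matrix.nonsing_inv_mul_cancel_left _ _ hu]
  rw [e, Matrix.trace_sub, Matrix.trace_smul, smul_eq_mul] at h1
  linarith

/-- The frequency response of `x⁺ = F x + D w` weighted by `Q` is at most `γ² - ε`. -/
def FrequencyBound (S : MixedDesign m d n l) (F Q : Matrix (Fin m) (Fin m) ℝ) (ε : ℝ) : Prop :=
  ∀ (α β : ℝ) (x : Matrix (Fin m) (Fin 2) ℝ) (w : Matrix (Fin n) (Fin 2) ℝ),
    α ^ 2 + β ^ 2 = 1 → x * rotMatrix α β = F * x + S.D * w →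
      (xᵀ * Q * x).trace ≤ (S.γ ^ 2 - ε) * (wᵀ * w).trace

/-- The frequency bound forces a definite margin in `γ² I - Dᵀ P D`, by the maximum principle. -/
theorem Stabilizing.dist_margin (h : S.Stabilizing F Q P) {ε : ℝ} (hε : 0 < ε)
    (hf : S.FrequencyBound F Q ε) :
    (S.dist P - ε • (1 : Matrix (Fin n) (Fin n) ℝ)).PosSemidef := by
  have hs := h.posSemidef.transpose_eq
  refine Matrix.IsHermitian.posSemidef_of_forall
    (by simp [dist_transpose hs]) fun v => ?_
  set A := S.amp P * F with hA
  set Ac := A.map Complex.ofReal with hAc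
  set vc : Fin n → ℂ := fun i => (v i : ℂ) with hvc
  set V : Matrix (Fin n) (Fin 2) ℝ := realPair vc with hV
  have hVc : complexVec V = vc := complexVec_realPair vc
  set G : Matrix (Fin n) (Fin m) ℝ := S.gain P * F with hG
  let lin : Matrix (Fin m) (Fin m) ℂ →ₗ[ℂ] EuclideanSpace ℂ (Fin n) :=
    { toFun := fun Y => WithLp.toLp 2
        (G.map Complex.ofReal *ᵥ (Y *ᵥ (S.D.map Complex.ofReal *ᵥ vc)))
      map_add' := fun Y Z => by rw [Matrix.add_mulVec, Matrix.mulVec_add]; rfl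
      map_smul' := fun c Y => by rw [Matrix.smul_mulVec, Matrix.mulVec_smul]; rfl }
  -- With `ζ = 1 / z`, this is the disturbance `w = v + gain * F * x` of the worst-case loop driven
  -- by `v`. For `‖ζ‖ = 1` the energy identity reads `γ² |w|² - xᵀ Q x = vᵀ (dist P) v`, so `ε |w|²
  -- ≤ vᵀ (dist P) v`; the maximum principle carries this to `ζ = 0`, where `w = v`.
  let f : ℂ → EuclideanSpace ℂ (Fin n) := fun ζ =>
    WithLp.toLp 2 vc + ζ • lin ((1 - ζ • Ac)⁻¹)
  have hform : ∀ Y : Matrix (Fin n) (Fin n) ℝ, (Vᵀ * Y * V).trace = v ⬝ᵥ Y *ᵥ v := by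
    intro Y
    rw [Matrix.trace_fin_two, Matrix.mul_assoc]
    have h0 : ∀ i, V i 0 = v i := fun i => by simp [hV, realPair, hvc]
    have h1 : ∀ i, V i 1 = 0 := fun i => by simp [hV, realPair, hvc]
    simp only [Matrix.mul_apply, Matrix.transpose_apply, h0, h1, mul_zero,
      Finset.sum_const_zero, add_zero]
    simp [dotProduct, Matrix.mulVec]
  set c : ℝ := v ⬝ᵥ S.dist P *ᵥ v with hc
  have hc0 : 0 ≤ c := h.posDef.posSemidef.dotProduct_nonneg v
  have hbd : ∀ ζ : ℂ, ‖ζ‖ = 1 → ‖f ζ‖ ≤ Real.sqrt (c / ε) := by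
    intro ζ hζ
    have hζ0 : ζ ≠ 0 := by
      rintro rfl
      simp at hζ
    have hu := h.stable.isUnit_det_one_sub_smul hζ.le
    set u : Fin m → ℂ := ζ • ((1 - ζ • Ac)⁻¹ *ᵥ (S.D.map Complex.ofReal *ᵥ vc)) with hu'
    set z : ℂ := ζ⁻¹ with hz
    have hzn : z.re ^ 2 + z.im ^ 2 = 1 := by
      have : Complex.normSq z = 1 := by rw [Complex.normSq_eq_norm_sq, hz, norm_inv, hζ]; norm_num
      rw [Complex.normSq_apply] at this
      linarith
    set X := realPair u with hX
    have hXc : complexVec X = u := complexVec_realPair u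
    have h1 : u - ζ • (Ac *ᵥ u) = ζ • (S.D.map Complex.ofReal *ᵥ vc) := by
      have : (1 - ζ • Ac) *ᵥ u = ζ • (S.D.map Complex.ofReal *ᵥ vc) := by
        rw [hu', Matrix.mulVec_smul, Matrix.mulVec_mulVec, Matrix.mul_nonsing_inv _ hu,
          Matrix.one_mulVec]
      rwa [Matrix.sub_mulVec, Matrix.one_mulVec, Matrix.smul_mulVec] at this
    have h2 : z • u = Ac *ᵥ u + S.D.map Complex.ofReal *ᵥ vc := by
      have := congrArg (fun y => ζ⁻¹ • y) h1
      simp only [smul_sub, smul_smul, inv_mul_cancel₀ hζ0, one_smul] at this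
      rw [← this, hz]
      abel
    have h3 : X * rotMatrix z.re z.im = A * X + S.D * V := by
      apply complexVec_injective
      rw [complexVec_mul_rotMatrix, complexVec_add, complexVec_mul, complexVec_mul, hXc, hVc,
        Complex.re_add_im, h2]
    set W := V + G * X with hW
    have h4 : X * rotMatrix z.re z.im = F * X + S.D * W := by
      rw [h3, hA, Matrix.mul_assoc, amp_mul, hW, Matrix.mul_add, hG, Matrix.mul_assoc]
      abel
    have e := congrArg Matrix.trace
      (amp_mul_ric_form (F := F) (Q := Q) hs h.posDef X W)
    have hWV : W - S.gain P * (F * X) = V := by rw [hW, hG, Matrix.mul_assoc]; abel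
    rw [← h4, hWV, h.ric_eq, Matrix.trace_sub, trace_rotMatrix, Matrix.trace_sub,
      Matrix.trace_add, Matrix.trace_sub, hzn, Matrix.trace_smul, smul_eq_mul, hform] at e
    simp only [Matrix.mul_zero, Matrix.zero_mul, Matrix.trace_zero] at e
    have h5 := hf _ _ X W hzn h4
    have h6 : f ζ = WithLp.toLp 2 (complexVec W) := by
      have : complexVec W = vc + ζ • (G.map Complex.ofReal *ᵥ
          ((1 - ζ • Ac)⁻¹ *ᵥ (S.D.map Complex.ofReal *ᵥ vc))) := by
        rw [hW, complexVec_add, complexVec_mul, hVc, hXc, hu', Matrix.mulVec_smul]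
      rw [this]
      rfl
    refine Real.le_sqrt_of_sq_le ?_
    rw [h6, norm_complexVec_sq, le_div_iff₀ hε]
    rw [← hc] at e
    nlinarith
  have hdiff : DiffContOnCl ℂ f (Metric.ball 0 1) := by
    refine DifferentiableOn.diffContOnCl fun ζ hζ => ?_
    rw [closure_ball (0 : ℂ) one_ne_zero, mem_closedBall_zero_iff] at hζ
    have hu := h.stable.isUnit_det_one_sub_smul hζ
    have h1 : DifferentiableAt ℂ (fun ζ : ℂ => (1 - ζ • Ac)⁻¹) ζ := by
      have h2 : DifferentiableAt ℂ (fun ζ : ℂ => (1 - ζ • Ac)) ζ := by fun_prop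
      exact DifferentiableAt.comp (g := fun Y : Matrix (Fin m) (Fin m) ℂ => Y⁻¹) ζ
        (Matrix.differentiableAt_nonsing_inv hu) h2
    have h3 : DifferentiableAt ℂ (fun ζ : ℂ => lin ((1 - ζ • Ac)⁻¹)) ζ :=
      DifferentiableAt.comp (g := fun Y => lin.toContinuousLinearMap Y) ζ
        (lin.toContinuousLinearMap.differentiableAt) h1
    exact ((differentiableAt_id.smul h3).const_add _).differentiableWithinAt
  have hmax := Complex.norm_le_of_forall_mem_frontier_norm_le Metric.isBounded_ball hdiff
    (C := Real.sqrt (c / ε)) (fun ζ hζ => hbd ζ (by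
      rw [frontier_ball (0 : ℂ) one_ne_zero] at hζ
      simpa using hζ)) (subset_closure (Metric.mem_ball_self one_pos))
  have hf0 : f 0 = WithLp.toLp 2 vc := by simp [f]
  have hn : ‖f 0‖ ^ 2 = v ⬝ᵥ v := by
    rw [hf0, ← hVc, norm_complexVec_sq]
    have := hform 1
    rwa [Matrix.mul_one, Matrix.one_mulVec] at this
  have hfin : v ⬝ᵥ v ≤ c / ε := by
    rw [← hn, ← Real.sq_sqrt (div_nonneg hc0 hε.le)]
    gcongr
  rw [le_div_iff₀ hε] at hfin
  rw [Matrix.sub_mulVec, dotProduct_sub, Matrix.smul_mulVec, Matrix.one_mulVec, dotProduct_smul,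
    smul_eq_mul, ← hc]
  linarith

/-- The bounded real lemma: a stable system whose frequency response is bounded by less than `γ`
has a stabilizing Riccati solution. -/
theorem exists_stabilizing (hγ : 0 < S.γ) (hD : (S.D * S.Dᵀ).PosDef) (hQ : Q.PosSemidef)
    (hF : IsSchurStable F) {ε : ℝ} (hε : 0 < ε) (hf : S.FrequencyBound F Q ε) :
    ∃ X, S.Stabilizing F Q X := by
  -- Continuation from `t = 0`, where the zero matrix is a solution, to `t = 1`. Closedness rests on
  -- the uniform bound on `X` and the uniform margin in `dist X`.
  set T : Set ℝ := {t | ∃ X, S.Stabilizing F (t • Q) X} with hT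
  have hft : ∀ t ∈ Set.Icc (0 : ℝ) 1, S.FrequencyBound F (t • Q) ε := by
    intro t ht α β x w hαβ hx
    have h1 := hf α β x w hαβ hx
    have h2 := (hQ.transpose_mul_mul x).trace_nonneg
    rw [Matrix.mul_smul, Matrix.smul_mul, Matrix.trace_smul, smul_eq_mul]
    nlinarith [ht.1, ht.2]
  have h0 : (0 : ℝ) ∈ T := by
    refine ⟨0, Matrix.PosSemidef.zero, ?_, ?_, ?_⟩
    · simp [ric, tilde_zero]
    · rw [dist_zero]
      exact Matrix.PosDef.one.smul (by positivity)
    · simpa [amp, gain] using hF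
  have hclosed : IsClosed (T ∩ Set.Icc 0 1) := by
    refine IsSeqClosed.isClosed fun t s ht hts => ?_
    have hs01 : s ∈ Set.Icc (0 : ℝ) 1 := isClosed_Icc.mem_of_tendsto hts
      (Eventually.of_forall fun k => (ht k).2)
    refine ⟨?_, hs01⟩
    choose X hX using fun k => (ht k).1
    have hbd : ∀ k, X k ∈ Metric.closedBall (0 : Matrix (Fin m) (Fin m) ℝ)
        (S.γ ^ 2 * ((S.D * S.Dᵀ)⁻¹).trace) := fun k => by
      rw [mem_closedBall_zero_iff]
      exact (hX k).posSemidef.norm_le_trace.trans (trace_le_of_dist hD (hX k).posDef.posSemidef)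
    obtain ⟨Y, -, φ, hφ, hlim⟩ := (isCompact_closedBall _ _).tendsto_subseq hbd
    have hts' := hts.comp hφ.tendsto_atTop
    have hYp : Y.PosSemidef := Matrix.PosSemidef.of_tendsto hlim fun k => (hX _).posSemidef
    have hYM : (S.dist Y - ε • (1 : Matrix (Fin n) (Fin n) ℝ)).PosSemidef := by
      have hc : Continuous fun Z => S.dist Z - ε • (1 : Matrix (Fin n) (Fin n) ℝ) :=
        S.continuous_dist.sub continuous_const
      exact Matrix.PosSemidef.of_tendsto ((hc.tendsto Y).comp hlim) fun k =>
        (hX (φ k)).dist_margin hε (hft _ (ht (φ k)).2)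
    have hYM := Matrix.posDef_of_sub_smul_one hε hYM
    have hric : S.ric F (s • Q) Y = 0 := by
      have hc : Continuous fun z : Matrix (Fin m) (Fin m) ℝ × ℝ × Matrix (Fin m) (Fin m) ℝ =>
          Fᵀ * z.1 * F + z.2.1 • Q - z.2.2 := by fun_prop
      have h1 := (hc.tendsto (S.tilde Y, s, Y)).comp
        (((continuousAt_tilde hYM).tendsto.comp hlim).prodMk_nhds (hts'.prodMk_nhds hlim))
      refine tendsto_nhds_unique h1 ?_
      refine tendsto_const_nhds.congr fun k => ?_
      exact (hX (φ k)).ric_eq.symm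
    refine ⟨Y, hYp, hric, hYM, ?_⟩
    have hA : Tendsto (fun k => S.amp (X (φ k)) * F) atTop (𝓝 (S.amp Y * F)) :=
      ((continuousAt_amp hYM).tendsto.comp hlim).mul_const F
    rw [isSchurStable_iff]
    intro V α β hαβ hV
    -- Modes outside the closed disc cannot appear in the limit. On the circle, the energy identity
    -- and the margin `ε` force the disturbance to vanish, leaving a marginal mode of the stable
    -- `F`.
    rcases hαβ.eq_or_lt with h1 | h1
    · have hx : V * rotMatrix α β = F * V + S.D * (S.gain Y * (F * V)) := by
        rw [← hV, Matrix.mul_assoc, amp_mul]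
      have e := congrArg Matrix.trace (amp_mul_ric_form (F := F) (Q := s • Q) hYp.transpose_eq hYM
        V (S.gain Y * (F * V)))
      rw [← hx, sub_self, hric, Matrix.trace_sub, trace_rotMatrix, ← h1] at e
      simp only [Matrix.mul_zero, Matrix.zero_mul, sub_zero, zero_sub, Matrix.trace_add,
        Matrix.trace_neg, Matrix.trace_smul, smul_eq_mul, one_mul] at e
      have h2 := hft s hs01 α β V _ h1.symm hx
      have h3 := (Matrix.posSemidef_transpose_mul_self (S.gain Y * (F * V))).trace_nonneg
      have h4 : S.gain Y * (F * V) = 0 :=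
        Matrix.trace_transpose_mul_self_eq_zero (by nlinarith)
      rw [h4, Matrix.mul_zero, add_zero] at hx
      exact isSchurStable_iff.mp hF V α β hαβ hx.symm
    · exact eq_zero_of_tendsto_isSchurStable (fun k => (hX (φ k)).stable) hA h1 hV
  have hsub := hclosed.Icc_subset_of_forall_mem_nhdsWithin h0 (fun t ht => by
    obtain ⟨⟨X, hX⟩, ht0, -⟩ := ht
    filter_upwards [hX.eventually_exists hQ, self_mem_nhdsWithin] with s hs hts
    exact hs (ht0.trans (le_of_lt hts)))
  obtain ⟨X, hX⟩ := hsub (Set.right_mem_Icc.mpr zero_le_one)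
  exact ⟨X, by simpa using hX⟩

end MixedDesign

/-! ### Steady-state responses and the transfer function on the unit circle. -/

section FrequencyResponse

variable {m n p : ℕ}

theorem transferFunction_mulVec {F : Matrix (Fin m) (Fin m) ℝ} {G : Matrix (Fin m) (Fin n) ℝ}
    {H : Matrix (Fin p) (Fin m) ℝ} (hF : IsSchurStable F) {z : ℂ} (hz : 1 ≤ ‖z‖)
    {x : Matrix (Fin m) (Fin 2) ℝ} {w : Matrix (Fin n) (Fin 2) ℝ}
    (hx : x * rotMatrix z.re z.im = F * x + G * w) :
    transferFunction F G H z *ᵥ complexVec w = complexVec (H * x) := by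
  have hu := hF.isUnit_det_smul_sub hz
  have h1 := congrArg complexVec hx
  rw [complexVec_mul_rotMatrix, complexVec_add, complexVec_mul, complexVec_mul,
    Complex.re_add_im] at h1
  have h2 : (z • (1 : Matrix (Fin m) (Fin m) ℂ) - F.map Complex.ofReal) *ᵥ complexVec x =
      G.map Complex.ofReal *ᵥ complexVec w := by
    rw [Matrix.sub_mulVec, Matrix.smul_mulVec, Matrix.one_mulVec, h1]
    abel
  rw [transferFunction, ← Matrix.mulVec_mulVec, ← Matrix.mulVec_mulVec, ← h2,
    Matrix.mulVec_mulVec _ _ (z • (1 : Matrix (Fin m) (Fin m) ℂ) - F.map Complex.ofReal),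
    Matrix.nonsing_inv_mul _ hu, Matrix.one_mulVec, complexVec_mul]

theorem norm_transferFunction_sq {F : Matrix (Fin m) (Fin m) ℝ} {G : Matrix (Fin m) (Fin n) ℝ}
    {H : Matrix (Fin p) (Fin m) ℝ} (hF : IsSchurStable F) {z : ℂ} (hz : 1 ≤ ‖z‖)
    {x : Matrix (Fin m) (Fin 2) ℝ} {w : Matrix (Fin n) (Fin 2) ℝ}
    (hx : x * rotMatrix z.re z.im = F * x + G * w) :
    ‖WithLp.toLp 2 (transferFunction F G H z *ᵥ complexVec w)‖ ^ 2 =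
      (xᵀ * (Hᵀ * H) * x).trace := by
  rw [transferFunction_mulVec hF hz hx, norm_complexVec_sq, Matrix.transpose_mul]
  simp only [Matrix.mul_assoc]

theorem exists_exp_eq {z : ℂ} (hz : ‖z‖ = 1) :
    ∃ θ ∈ Set.Ico (0 : ℝ) (2 * Real.pi), Complex.exp (θ * Complex.I) = z := by
  refine ⟨toIcoMod Real.two_pi_pos 0 z.arg, ?_, ?_⟩
  · simpa using toIcoMod_mem_Ico Real.two_pi_pos 0 z.arg
  · have h := Complex.norm_mul_exp_arg_mul_I z
    rw [hz, Complex.ofReal_one, one_mul] at h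
    refine Eq.trans ?_ h
    rw [Complex.exp_eq_exp_iff_exists_int]
    refine ⟨-toIcoDiv Real.two_pi_pos 0 z.arg, ?_⟩
    rw [toIcoMod, zsmul_eq_mul]
    push_cast
    ring

end FrequencyResponse

/-! ### Translating feasibility into Riccati terms. -/

namespace MixedDesign

variable {m d n l : ℕ} {S : MixedDesign m d n l} {F Q P H : Matrix (Fin m) (Fin m) ℝ}

theorem frequencyBound_of_hInfNorm (hγ : 0 < S.γ) (hF : IsSchurStable F) (hH : Hᵀ * H = Q)
    (h : hInfNorm (transferFunction F S.D H) < ENNReal.ofReal S.γ) :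
    ∃ ε > 0, S.FrequencyBound F Q ε := by
  set c := (hInfNorm (transferFunction F S.D H)).toReal with hc
  have htop : hInfNorm (transferFunction F S.D H) ≠ ⊤ := h.ne_top
  have hcγ : c < S.γ := by
    have := (ENNReal.toReal_lt_toReal htop ENNReal.ofReal_ne_top).mpr h
    rwa [ENNReal.toReal_ofReal hγ.le] at this
  have hc0 : 0 ≤ c := ENNReal.toReal_nonneg
  refine ⟨S.γ ^ 2 - c ^ 2, by nlinarith, fun α β x w hαβ hx => ?_⟩
  set z : ℂ := (α : ℂ) + β * Complex.I with hz
  have hzn : ‖z‖ = 1 := by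
    have : ‖z‖ ^ 2 = 1 := by rw [← Complex.normSq_eq_norm_sq, Complex.normSq_add_mul_I, hαβ]
    nlinarith [norm_nonneg z]
  obtain ⟨θ, hθ, hθz⟩ := exists_exp_eq hzn
  have hT : ‖transferFunction F S.D H z‖ ≤ c := by
    rw [hc, ← ENNReal.ofReal_le_iff_le_toReal htop, ← hθz]
    exact le_iSup₂ (f := fun θ (_ : θ ∈ Set.Ico (0 : ℝ) (2 * Real.pi)) =>
      ENNReal.ofReal ‖transferFunction F S.D H (Complex.exp (θ * Complex.I))‖) θ hθ
  have hre : z.re = α := by simp [hz]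
  have him : z.im = β := by simp [hz]
  have h1 := norm_transferFunction_sq (H := H) hF hzn.ge (by rw [hre, him]; exact hx)
  have h2 := Matrix.l2_opNorm_mulVec (transferFunction F S.D H z) (WithLp.toLp 2 (complexVec w))
  have h3 : ‖WithLp.toLp 2 (transferFunction F S.D H z *ᵥ complexVec w)‖ ≤
      c * ‖WithLp.toLp 2 (complexVec w)‖ := h2.trans (by gcongr)
  rw [← hH, ← h1, ← norm_complexVec_sq, sub_sub_cancel, ← mul_pow]
  gcongr

/-- The pointwise strict bound passes to the supremum because the gain is continuous on the compact
product of the unit circle and the unit sphere of inputs. -/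
theorem hInfNorm_lt_of_frequency (hγ : 0 < S.γ) (hF : IsSchurStable F) (hH : Hᵀ * H = Q)
    (h : ∀ (α β : ℝ) (x : Matrix (Fin m) (Fin 2) ℝ) (w : Matrix (Fin n) (Fin 2) ℝ),
      α ^ 2 + β ^ 2 = 1 → x * rotMatrix α β = F * x + S.D * w →
        S.γ ^ 2 * (wᵀ * w).trace ≤ (xᵀ * Q * x).trace → w = 0) :
    hInfNorm (transferFunction F S.D H) < ENNReal.ofReal S.γ := by
  let φ : ℂ × EuclideanSpace ℂ (Fin n) → ℝ := fun y =>
    ‖WithLp.toLp 2 (transferFunction F S.D H y.1 *ᵥ y.2.ofLp)‖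
  set K : Set (ℂ × EuclideanSpace ℂ (Fin n)) := Metric.sphere 0 1 ×ˢ Metric.sphere 0 1 with hK
  have hKc : IsCompact K := (isCompact_sphere _ _).prod (isCompact_sphere _ _)
  have hφ : ContinuousOn φ K := by
    intro y hy
    have hy1 : ‖y.1‖ = 1 := by simpa using hy.1
    have hu := hF.isUnit_det_smul_sub hy1.ge
    have hc1 : ContinuousAt (fun y : ℂ × EuclideanSpace ℂ (Fin n) =>
        (y.1 • (1 : Matrix (Fin m) (Fin m) ℂ) - F.map Complex.ofReal)⁻¹) y :=
      ContinuousAt.comp (g := fun Y : Matrix (Fin m) (Fin m) ℂ => Y⁻¹)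
        (f := fun y : ℂ × EuclideanSpace ℂ (Fin n) =>
          y.1 • (1 : Matrix (Fin m) (Fin m) ℂ) - F.map Complex.ofReal)
        (Matrix.continuousAt_nonsing_inv hu) (Continuous.continuousAt (by fun_prop))
    have hc2 : Continuous fun q : Matrix (Fin m) (Fin m) ℂ × EuclideanSpace ℂ (Fin n) =>
        ‖WithLp.toLp 2 ((H.map Complex.ofReal * q.1 * S.D.map Complex.ofReal) *ᵥ q.2.ofLp)‖ := by
      fun_prop
    exact (ContinuousAt.comp (g := fun q : Matrix (Fin m) (Fin m) ℂ × EuclideanSpace ℂ (Fin n) =>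
      ‖WithLp.toLp 2 ((H.map Complex.ofReal * q.1 * S.D.map Complex.ofReal) *ᵥ q.2.ofLp)‖)
      hc2.continuousAt (hc1.prodMk continuousAt_snd)).continuousWithinAt
  have hlt : ∀ y ∈ K, φ y < S.γ := by
    intro y hy
    have hy1 : ‖y.1‖ = 1 := by simpa using hy.1
    have hy2 : ‖y.2‖ = 1 := by simpa using hy.2
    have hn : y.1.re ^ 2 + y.1.im ^ 2 = 1 := by
      have : Complex.normSq y.1 = 1 := by rw [Complex.normSq_eq_norm_sq, hy1]; norm_num
      rw [Complex.normSq_apply] at this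
      linarith
    set w := realPair y.2.ofLp with hw
    have hwc : complexVec w = y.2.ofLp := complexVec_realPair _
    obtain ⟨x, hx⟩ := hF.exists_steadyState hn.ge (S.D * w)
    have h1 := norm_transferFunction_sq (H := H) hF hy1.ge hx
    rw [hH, hwc] at h1
    have hwn : (wᵀ * w).trace = 1 := by
      rw [← norm_complexVec_sq, hwc]
      simp [hy2]
    by_contra hge
    have hge := not_lt.mp hge
    have hw0 := h _ _ x w hn hx (by
      rw [← h1, hwn, mul_one]
      exact pow_le_pow_left₀ hγ.le hge 2)
    rw [hw0] at hwn
    simp at hwn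
  obtain ⟨c, hc0, hcγ, hc⟩ : ∃ c : ℝ, 0 ≤ c ∧ c < S.γ ∧ ∀ y ∈ K, φ y ≤ c := by
    rcases K.eq_empty_or_nonempty with he | hne
    · exact ⟨0, le_rfl, hγ, by simp [he]⟩
    · obtain ⟨y, hy, hmax⟩ := hKc.exists_isMaxOn hne hφ
      exact ⟨φ y, norm_nonneg _, hlt y hy, fun y' hy' => hmax hy'⟩
  refine lt_of_le_of_lt (b := ENNReal.ofReal c) (iSup₂_le fun θ _ => ?_)
    ((ENNReal.ofReal_lt_ofReal_iff hγ).mpr hcγ)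
  refine ENNReal.ofReal_le_ofReal ?_
  rw [Matrix.l2_opNorm_def]
  refine ContinuousLinearMap.opNorm_le_of_unit_norm hc0 fun v hv => ?_
  exact hc (Complex.exp (θ * Complex.I), v)
    ⟨by simp [Complex.norm_exp_ofReal_mul_I], by simpa using hv⟩

/-- Identifies the factor in the stability condition of `IsStabilizingSolution` with the worst-case
amplification. -/
theorem amp_eq (hγ : 0 < S.γ) (hs : Pᵀ = P) (hM : (S.dist P).PosDef) :
    ((1 - (S.γ ^ 2)⁻¹ • (P * S.D * S.Dᵀ))⁻¹)ᵀ = S.amp P := by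
  have hg : S.γ ^ 2 ≠ 0 := by positivity
  rw [Matrix.transpose_nonsing_inv]
  refine Matrix.inv_eq_right_inv ?_
  have e : (1 - (S.γ ^ 2)⁻¹ • (P * S.D * S.Dᵀ))ᵀ = 1 - (S.γ ^ 2)⁻¹ • (S.D * (S.Dᵀ * P)) := by
    simp [hs, Matrix.mul_assoc]
  have h1 : S.D * (S.Dᵀ * (P * S.amp P)) = S.γ ^ 2 • (S.D * S.gain P) := by
    rw [D_mul_amp hM, Matrix.mul_smul]
  rw [e, Matrix.sub_mul, Matrix.one_mul, Matrix.smul_mul, Matrix.mul_assoc, Matrix.mul_assoc, h1,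
    smul_smul, inv_mul_cancel₀ hg, one_smul, amp, add_sub_cancel_right]

theorem one_sub_eq_smul_dist (hγ : 0 < S.γ) (P : Matrix (Fin m) (Fin m) ℝ) :
    1 - (S.γ ^ 2)⁻¹ • (S.Dᵀ * P * S.D) = (S.γ ^ 2)⁻¹ • S.dist P := by
  have hg : S.γ ^ 2 ≠ 0 := by positivity
  rw [dist, smul_sub, smul_smul, inv_mul_cancel₀ hg, one_smul]

theorem one_sub_posDef_iff (hγ : 0 < S.γ) :
    (1 - (S.γ ^ 2)⁻¹ • (S.Dᵀ * P * S.D)).PosDef ↔ (S.dist P).PosDef := by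
  have hg : 0 < S.γ ^ 2 := by positivity
  rw [one_sub_eq_smul_dist hγ]
  refine ⟨fun h => ?_, fun h => h.smul (inv_pos.mpr hg)⟩
  have := h.smul hg
  rwa [smul_smul, mul_inv_cancel₀ hg.ne', one_smul] at this

/-- The output weight `Cᵀ C + Kᵀ R K`. -/
def outputWeight (S : MixedDesign m d n l) (K : Matrix (Fin d) (Fin m) ℝ) :
    Matrix (Fin m) (Fin m) ℝ :=
  S.Cᵀ * S.C + Kᵀ * S.R * K

variable {K : Matrix (Fin d) (Fin m) ℝ}

theorem R_posSemidef : S.R.PosSemidef := Matrix.posSemidef_transpose_mul_self S.E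

theorem outputWeight_posSemidef (K : Matrix (Fin d) (Fin m) ℝ) :
    (S.outputWeight K).PosSemidef :=
  (Matrix.posSemidef_transpose_mul_self S.C).add (R_posSemidef.transpose_mul_mul K)

theorem isStabilizingSolution_iff (hγ : 0 < S.γ) :
    S.IsStabilizingSolution K P ↔ S.Stabilizing (S.A - S.B * K) (S.outputWeight K) P := by
  have hric : (S.A - S.B * K)ᵀ * S.tilde P * (S.A - S.B * K) + S.Cᵀ * S.C + Kᵀ * S.R * K - P =
      S.ric (S.A - S.B * K) (S.outputWeight K) P := by
    rw [ric, outputWeight, add_assoc]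
  constructor
  · rintro ⟨h1, h2, h3, h4⟩
    have hM := (one_sub_posDef_iff hγ).mp h3
    exact ⟨h1, hric ▸ h2, hM, by rwa [amp_eq hγ h1.transpose_eq hM] at h4⟩
  · rintro ⟨h1, h2, h3, h4⟩
    exact ⟨h1, hric.trans h2, (one_sub_posDef_iff hγ).mpr h3,
      by rwa [amp_eq hγ h1.transpose_eq h3]⟩

theorem sqrt_transpose_mul_self {Q : Matrix (Fin m) (Fin m) ℝ} (hQ : Q.PosSemidef) :
    (CFC.sqrt Q)ᵀ * CFC.sqrt Q = Q := by
  have h0 : (0 : Matrix (Fin m) (Fin m) ℝ) ≤ Q := Matrix.nonneg_iff_posSemidef.mpr hQ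
  have h1 : (CFC.sqrt Q).PosSemidef := Matrix.nonneg_iff_posSemidef.mp (CFC.sqrt_nonneg Q)
  rw [h1.transpose_eq, CFC.sqrt_mul_sqrt_self Q h0]

/-- The bounded real lemma supplies existence. Later arguments only use that the chosen matrix is
stabilizing, never how it was chosen. -/
theorem stabilizing_riccatiSol (hγ : 0 < S.γ) (hD : (S.D * S.Dᵀ).PosDef) (hK : K ∈ S.feasible) :
    S.Stabilizing (S.A - S.B * K) (S.outputWeight K) (S.riccatiSol K) := by
  obtain ⟨ε, hε, hf⟩ := frequencyBound_of_hInfNorm hγ hK.1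
    (sqrt_transpose_mul_self (S.outputWeight_posSemidef K)) hK.2
  obtain ⟨X, hX⟩ := exists_stabilizing hγ hD (S.outputWeight_posSemidef K) hK.1 hε hf
  have hex : ∃ P, S.IsStabilizingSolution K P := ⟨X, (isStabilizingSolution_iff hγ).mpr hX⟩
  rw [riccatiSol, dif_pos hex]
  exact (isStabilizingSolution_iff hγ).mp hex.choose_spec

/-- A supersolution whose slack detects the marginal modes certifies feasibility. -/
theorem feasible_of_supersolution (hγ : 0 < S.γ) (hP : P.PosSemidef) (hM : (S.dist P).PosDef)
    (hr : (-S.ric (S.A - S.B * K) (S.outputWeight K) P).PosSemidef)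
    (hker : ∀ (V : Matrix (Fin m) (Fin 2) ℝ) (α β : ℝ), 1 ≤ α ^ 2 + β ^ 2 →
      S.amp P * (S.A - S.B * K) * V = V * rotMatrix α β →
        S.ric (S.A - S.B * K) (S.outputWeight K) P * V = 0 → V = 0) :
    K ∈ S.feasible := by
  have hF := isSchurStable_of_supersolution hP hM (S.outputWeight_posSemidef K) hr hker
  exact ⟨hF, hInfNorm_lt_of_frequency hγ hF
    (sqrt_transpose_mul_self (S.outputWeight_posSemidef K)) fun α β x w hαβ hx hw =>
      frequency_of_supersolution hP hM hr hker hαβ hx hw⟩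

end MixedDesign

/-! ### Further inverse bounds, and bounded responses of stable recursions. -/

section Auxiliary

variable {p q : Type*} [Fintype p] [DecidableEq p] [Fintype q] [DecidableEq q]

theorem Matrix.PosDef.inv_sub_smul_one {X : Matrix p p ℝ} (hX : X.PosDef) {c : ℝ} (hc : 0 < c)
    (h : (c • (1 : Matrix p p ℝ) - X).PosSemidef) :
    (X⁻¹ - c⁻¹ • (1 : Matrix p p ℝ)).PosSemidef := by
  have h1 : (1 - c⁻¹ • X).PosSemidef := by
    have := h.smul (inv_nonneg.mpr hc.le)
    rwa [smul_sub, smul_smul, inv_mul_cancel₀ hc.ne', one_smul] at this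
  have h2 := ((hX.smul (inv_pos.mpr hc)).inv_sub_one h1).smul (inv_nonneg.mpr hc.le)
  have hu : IsUnit X.det := hX.det_pos.ne'.isUnit
  have h3 : (c⁻¹ • X)⁻¹ = c • X⁻¹ := Matrix.inv_eq_right_inv (by
    rw [Matrix.smul_mul, Matrix.mul_smul, smul_smul, inv_mul_cancel₀ hc.ne', one_smul,
      Matrix.mul_nonsing_inv _ hu])
  rwa [h3, smul_sub, smul_smul, inv_mul_cancel₀ hc.ne', one_smul] at h2

theorem trace_rotMatrix_mixed (α β : ℝ) (V : Matrix p (Fin 2) ℝ) (W : Matrix q (Fin 2) ℝ)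
    (X : Matrix p q ℝ) :
    ((V * rotMatrix α β)ᵀ * X * (W * rotMatrix α β)).trace
      = (α ^ 2 + β ^ 2) * (Vᵀ * X * W).trace := by
  have h1 : (V * rotMatrix α β)ᵀ * X * (W * rotMatrix α β)
      = (rotMatrix α β)ᵀ * ((Vᵀ * X * W) * rotMatrix α β) := by
    simp only [Matrix.transpose_mul, Matrix.mul_assoc]
  rw [h1, Matrix.trace_mul_comm, Matrix.mul_assoc, rotMatrix_mul_transpose, Matrix.mul_smul,
    Matrix.mul_one, Matrix.trace_smul, smul_eq_mul]

/-- A stable recursion driven by a geometrically decaying input stays bounded. -/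
theorem IsSchurStable.exists_bounded_response {m : ℕ} {F A : Matrix (Fin m) (Fin m) ℝ}
    (hF : IsSchurStable F) (hA : IsSchurStable A) (U : Matrix (Fin m) (Fin m) ℝ) :
    ∃ (X : ℕ → Matrix (Fin m) (Fin m) ℝ) (c : ℝ), X 0 = 1 ∧
      (∀ t, X (t + 1) = F * X t + U * A ^ t) ∧ ∀ t, ‖X t‖ ≤ c := by
  obtain ⟨C, ρ, hC, hρ0, hρ1, hFk⟩ := hF.exists_norm_pow_le
  obtain ⟨C', σ, hC', hσ0, hσ1, hAk⟩ := hA.exists_norm_pow_le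
  refine ⟨fun t => F ^ t + ∑ s ∈ Finset.range t, F ^ (t - 1 - s) * U * A ^ s,
    C + C * ‖U‖ * C' * (1 - σ)⁻¹, by simp, fun t => ?_, fun t => ?_⟩
  · beta_reduce
    rw [Finset.sum_range_succ, mul_add, Finset.mul_sum, pow_succ']
    have : ∀ s ∈ Finset.range t, F ^ (t + 1 - 1 - s) * U * A ^ s =
        F * (F ^ (t - 1 - s) * U * A ^ s) := by
      intro s hs
      have hst := Finset.mem_range.mp hs
      rw [← mul_assoc, ← mul_assoc, ← pow_succ']
      congr 3
      omega
    rw [Finset.sum_congr rfl this]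
    simp [add_assoc]
  · have hFC : ∀ k, ‖F ^ k‖ ≤ C := fun k => (hFk k).trans
      (mul_le_of_le_one_right hC (pow_le_one₀ hρ0.le hρ1.le))
    refine (norm_add_le _ _).trans (add_le_add (hFC t) ?_)
    calc ‖∑ s ∈ Finset.range t, F ^ (t - 1 - s) * U * A ^ s‖
        ≤ ∑ s ∈ Finset.range t, C * ‖U‖ * C' * σ ^ s := by
          refine norm_sum_le_of_le _ fun s _ => ?_
          calc _ ≤ ‖F ^ (t - 1 - s)‖ * ‖U‖ * ‖A ^ s‖ :=
                (norm_mul_le _ _).trans (by gcongr; exact norm_mul_le _ _)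
            _ ≤ C * ‖U‖ * (C' * σ ^ s) := by
                gcongr
                · exact hFC _
                · exact hAk s
            _ = _ := by ring
      _ = C * ‖U‖ * C' * ∑ s ∈ Finset.range t, σ ^ s := by rw [Finset.mul_sum]
      _ ≤ C * ‖U‖ * C' * (1 - σ)⁻¹ := by
          gcongr
          exact (Summable.sum_le_tsum _ (fun i _ => pow_nonneg hσ0.le i)
            (summable_geometric_of_lt_one hσ0.le hσ1)).trans
              (tsum_geometric_of_lt_one hσ0.le hσ1).le

end Auxiliary

/-! ### Dependence on the gain and policy improvement. -/

namespace MixedDesign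

variable {m d n l : ℕ} (S : MixedDesign m d n l)

/-- `R + Bᵀ P̃ B`. -/
noncomputable def weight (P : Matrix (Fin m) (Fin m) ℝ) : Matrix (Fin d) (Fin d) ℝ :=
  S.R + S.Bᵀ * S.tilde P * S.B

/-- `(R + Bᵀ P̃ B) K - Bᵀ P̃ A`. -/
noncomputable def resid (K : Matrix (Fin d) (Fin m) ℝ) (P : Matrix (Fin m) (Fin m) ℝ) :
    Matrix (Fin d) (Fin m) ℝ :=
  S.weight P * K - S.Bᵀ * S.tilde P * S.A

/-- The Riccati operator of the gain `K`. -/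
noncomputable def gainRic (K : Matrix (Fin d) (Fin m) ℝ) (P : Matrix (Fin m) (Fin m) ℝ) :
    Matrix (Fin m) (Fin m) ℝ :=
  S.ric (S.A - S.B * K) (S.outputWeight K) P

/-- Stabilizing solutions for the gain `K`. -/
abbrev GainStabilizing (K : Matrix (Fin d) (Fin m) ℝ) (P : Matrix (Fin m) (Fin m) ℝ) : Prop :=
  S.Stabilizing (S.A - S.B * K) (S.outputWeight K) P

variable {S} {P P' : Matrix (Fin m) (Fin m) ℝ} {K K' : Matrix (Fin d) (Fin m) ℝ}

theorem R_transpose : S.Rᵀ = S.R := R_posSemidef.transpose_eq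

theorem gainWeight_eq (K : Matrix (Fin d) (Fin m) ℝ) :
    S.gainWeight K = S.weight (S.riccatiSol K) := rfl

theorem gradE_eq (K : Matrix (Fin d) (Fin m) ℝ) : S.gradE K = S.resid K (S.riccatiSol K) := rfl

theorem weight_sub_R_posSemidef (hP : P.PosSemidef) (hM : (S.dist P).PosDef) :
    (S.weight P - S.R).PosSemidef := by
  rw [weight, add_sub_cancel_left]
  exact (tilde_posSemidef hP hM).transpose_mul_mul S.B

theorem weight_posDef (hR : S.R.PosDef) (hP : P.PosSemidef) (hM : (S.dist P).PosDef) :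
    (S.weight P).PosDef :=
  hR.add_posSemidef ((tilde_posSemidef hP hM).transpose_mul_mul S.B)

theorem resid_eq (K : Matrix (Fin d) (Fin m) ℝ) (P : Matrix (Fin m) (Fin m) ℝ) :
    S.resid K P = S.R * K - S.Bᵀ * (S.tilde P * (S.A - S.B * K)) := by
  simp only [resid, weight, Matrix.add_mul, Matrix.mul_sub, Matrix.mul_assoc]
  abel

/-- Dependence of the Riccati residual on the gain. -/
theorem gainRic_sub (hs : Pᵀ = P) (hM : (S.dist P).PosDef) (K Z : Matrix (Fin d) (Fin m) ℝ) :
    S.gainRic (K - Z) P = S.gainRic K P - Zᵀ * S.resid K P - (S.resid K P)ᵀ * Z +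
      Zᵀ * S.weight P * Z := by
  have hT := tilde_transpose hs hM
  have hF : S.A - S.B * (K - Z) = (S.A - S.B * K) + S.B * Z := by rw [Matrix.mul_sub]; abel
  rw [gainRic, gainRic, resid_eq, ric, ric, hF]
  generalize S.A - S.B * K = F
  simp only [outputWeight, weight, Matrix.transpose_add, Matrix.transpose_sub,
    Matrix.transpose_mul, Matrix.transpose_transpose, hT, R_transpose, Matrix.mul_add,
    Matrix.add_mul, Matrix.mul_sub, Matrix.sub_mul, Matrix.mul_assoc]
  abel

/-- Around a stationary gain the Riccati residual is a perfect square. -/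
theorem gainRic_of_resid_eq_zero (hs : Pᵀ = P) (hM : (S.dist P).PosDef) (h0 : S.gainRic K P = 0)
    (hE : S.resid K P = 0) (K' : Matrix (Fin d) (Fin m) ℝ) :
    S.gainRic K' P = (K' - K)ᵀ * S.weight P * (K' - K) := by
  have := gainRic_sub hs hM K (K - K')
  rw [sub_sub_cancel, h0, hE] at this
  rw [this]
  simp only [Matrix.transpose_sub, Matrix.mul_sub, Matrix.sub_mul, Matrix.mul_zero,
    Matrix.transpose_zero, Matrix.zero_mul]
  abel

/-- A gain improvement keeps feasibility and lowers the Riccati solution. -/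
theorem GainStabilizing.improve (hγ : 0 < S.γ) (hD : (S.D * S.Dᵀ).PosDef) (hR : S.R.PosDef)
    (h : S.GainStabilizing K P) {a : ℝ} (ha : 0 < a) (N : Matrix (Fin d) (Fin d) ℝ)
    (hK' : K' = K - N * S.resid K P)
    (hr : (-S.gainRic K' P -
      a • ((S.resid K P)ᵀ * (S.weight P)⁻¹ * S.resid K P)).PosSemidef) :
    K' ∈ S.feasible ∧ (P - S.riccatiSol K' -
      a • ((S.resid K P)ᵀ * (S.weight P)⁻¹ * S.resid K P)).PosSemidef := by
  have hs := h.posSemidef.transpose_eq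
  have hG := weight_posDef hR h.posSemidef h.posDef
  have hsq := hG.inv.posSemidef.transpose_mul_mul (S.resid K P)
  have hr0 : (-S.gainRic K' P).PosSemidef := by
    simpa using hr.add (hsq.smul ha.le)
  have hfeas : K' ∈ S.feasible := by
    refine feasible_of_supersolution hγ h.posSemidef h.posDef hr0 fun V α β hαβ hV hV0 => ?_
    -- Zero residual on `V` forces `E V = 0`, so `K'` and `K` agree on `V`; then `V` is a mode of
    -- the stable worst-case loop of `K`, hence zero.
    have h1 := (hr.transpose_mul_mul V).trace_nonneg
    have h2 := (hsq.transpose_mul_mul V).trace_nonneg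
    have hV0 : S.gainRic K' P * V = 0 := hV0
    rw [Matrix.mul_assoc, Matrix.sub_mul, Matrix.neg_mul, hV0, neg_zero, zero_sub, Matrix.mul_neg,
      Matrix.trace_neg, Matrix.smul_mul, Matrix.mul_smul, Matrix.trace_smul, smul_eq_mul,
      ← Matrix.mul_assoc] at h1
    have h3 : ((S.resid K P * V)ᵀ * (S.weight P)⁻¹ * (S.resid K P * V)).trace = 0 := by
      have : (S.resid K P * V)ᵀ * (S.weight P)⁻¹ * (S.resid K P * V) =
          Vᵀ * ((S.resid K P)ᵀ * (S.weight P)⁻¹ * S.resid K P) * V := by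
        simp only [Matrix.transpose_mul, Matrix.mul_assoc]
      rw [this]
      nlinarith
    have h4 := hG.inv.eq_zero_of_trace h3
    have h5 : K' * V = K * V := by
      rw [hK', Matrix.sub_mul, Matrix.mul_assoc, h4, Matrix.mul_zero, sub_zero]
    refine isSchurStable_iff.mp h.stable V α β hαβ ?_
    rw [← hV, Matrix.mul_assoc, Matrix.mul_assoc, Matrix.sub_mul, Matrix.sub_mul,
      Matrix.mul_assoc, Matrix.mul_assoc, h5]
  refine ⟨hfeas, ?_⟩
  have h' := stabilizing_riccatiSol hγ hD hfeas
  have hle := h'.le_of_ric_nonpos hs h.posDef hr0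
  -- Subtracting the Riccati equation of `K'` leaves the slack plus a congruence of `P̃ - P̃_{K'} ≥
  -- 0`.
  have ht := tilde_mono h'.posSemidef.transpose_eq h'.posDef hs h.posDef hle
  convert hr.add (ht.transpose_mul_mul (S.A - S.B * K')) using 1
  have e := h'.ric_eq
  rw [ric, sub_eq_zero] at e
  conv_lhs => rw [← e]
  rw [gainRic, ric, Matrix.mul_sub _ (S.tilde P), Matrix.sub_mul (_ * S.tilde P)]
  abel

/-- Sylvester's determinant identity moves to a symmetric matrix, where concavity of `log det` is
available. -/
theorem cost_eq (K : Matrix (Fin d) (Fin m) ℝ) :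
    S.cost K = -S.γ ^ 2 * Real.log
      (1 - (S.γ ^ 2)⁻¹ • (S.Dᵀ * S.riccatiSol K * S.D)).det := by
  have h : (1 - (S.γ ^ 2)⁻¹ • (S.riccatiSol K * S.D * S.Dᵀ)).det =
      (1 - (S.γ ^ 2)⁻¹ • (S.Dᵀ * S.riccatiSol K * S.D)).det := by
    rw [← Matrix.smul_mul, Matrix.det_one_sub_mul_comm, Matrix.mul_smul, Matrix.mul_assoc]
  rw [cost, h]

end MixedDesign

/-! ### Cost versus trace, one-step slacks, and first-order optimality. -/

namespace MixedDesign

variable {m d n l : ℕ} {S : MixedDesign m d n l} {P P' : Matrix (Fin m) (Fin m) ℝ}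
  {K K' : Matrix (Fin d) (Fin m) ℝ}

/-- Lower bound on the decrease of the cost. -/
theorem trace_le_cost_sub (hγ : 0 < S.γ)
    (hK : S.GainStabilizing K (S.riccatiSol K)) (hK' : S.GainStabilizing K' (S.riccatiSol K'))
    (h : (S.riccatiSol K - S.riccatiSol K').PosSemidef) :
    (S.Dᵀ * (S.riccatiSol K - S.riccatiSol K') * S.D).trace ≤ S.cost K - S.cost K' := by
  have hg : 0 < S.γ ^ 2 := by positivity
  set N := 1 - (S.γ ^ 2)⁻¹ • (S.Dᵀ * S.riccatiSol K * S.D) with hN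
  set N' := 1 - (S.γ ^ 2)⁻¹ • (S.Dᵀ * S.riccatiSol K' * S.D) with hN'
  have hNp : N.PosDef := (one_sub_posDef_iff hγ).mpr hK.posDef
  have hNp' : N'.PosDef := (one_sub_posDef_iff hγ).mpr hK'.posDef
  have h1 := hNp.log_det_sub_le hNp'
  set Z := S.Dᵀ * (S.riccatiSol K - S.riccatiSol K') * S.D with hZ
  have hZp : Z.PosSemidef := h.transpose_mul_mul S.D
  have h2 : N - N' = -((S.γ ^ 2)⁻¹ • Z) := by
    rw [hN, hN', hZ, Matrix.mul_sub, Matrix.sub_mul]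
    module
  have h3 : (N'⁻¹ - (1 : ℝ) • (1 : Matrix (Fin n) (Fin n) ℝ)).PosSemidef := by
    rw [one_smul]
    refine hNp'.inv_sub_one ?_
    rw [hN', sub_sub_cancel]
    exact (hK'.posSemidef.transpose_mul_mul S.D).smul (inv_nonneg.mpr hg.le)
  have h4 := hZp.le_trace_mul h3
  rw [h2, Matrix.neg_mul, Matrix.trace_neg, Matrix.smul_mul, Matrix.trace_smul, smul_eq_mul] at h1
  rw [cost_eq, cost_eq, ← hN, ← hN']
  have h5 : (S.γ ^ 2)⁻¹ * Z.trace ≤ Real.log N'.det - Real.log N.det := by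
    have : (S.γ ^ 2)⁻¹ * (1 * Z.trace) ≤ (S.γ ^ 2)⁻¹ * (Z * N'⁻¹).trace := by gcongr
    linarith
  rw [inv_mul_le_iff₀ hg] at h5
  linarith

/-- `D Dᵀ ≥ c` replaces the trace of `Dᵀ Δ D` by that of `Δ`, so a drop of `P` in any direction is
visible in the cost. -/
theorem exists_trace_le_cost_sub (hγ : 0 < S.γ) (hD : (S.D * S.Dᵀ).PosDef) :
    ∃ c > 0, ∀ K ∈ S.feasible, ∀ K' ∈ S.feasible,
      (S.riccatiSol K - S.riccatiSol K').PosSemidef →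
        c * (S.riccatiSol K - S.riccatiSol K').trace ≤ S.cost K - S.cost K' := by
  obtain ⟨c, hc, hcD⟩ := hD.exists_sub_smul_one
  refine ⟨c, hc, fun K hK K' hK' h => ?_⟩
  have h1 := trace_le_cost_sub hγ (stabilizing_riccatiSol hγ hD hK)
    (stabilizing_riccatiSol hγ hD hK') h
  refine (h.le_trace_mul hcD).trans (le_trans (le_of_eq ?_) h1)
  rw [← Matrix.mul_assoc, Matrix.trace_mul_comm, Matrix.mul_assoc]

/-- Upper bound on the difference of costs. -/
theorem cost_sub_le_trace (hγ : 0 < S.γ) {c : ℝ}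
    (hK : S.GainStabilizing K (S.riccatiSol K)) (hK' : S.GainStabilizing K' (S.riccatiSol K'))
    (hle : (S.riccatiSol K - S.riccatiSol K').PosSemidef) (hc0 : 0 ≤ c)
    (hc : (c • (1 : Matrix (Fin n) (Fin n) ℝ) -
      (1 - (S.γ ^ 2)⁻¹ • (S.Dᵀ * S.riccatiSol K * S.D))⁻¹).PosSemidef) :
    S.cost K - S.cost K' ≤
      c * ‖S.D * S.Dᵀ‖ * (S.riccatiSol K - S.riccatiSol K').trace := by
  have hg : 0 < S.γ ^ 2 := by positivity
  set N := 1 - (S.γ ^ 2)⁻¹ • (S.Dᵀ * S.riccatiSol K * S.D) with hN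
  set N' := 1 - (S.γ ^ 2)⁻¹ • (S.Dᵀ * S.riccatiSol K' * S.D) with hN'
  have hNp : N.PosDef := (one_sub_posDef_iff hγ).mpr hK.posDef
  have hNp' : N'.PosDef := (one_sub_posDef_iff hγ).mpr hK'.posDef
  have h1 := hNp'.log_det_sub_le hNp
  set Z := S.Dᵀ * (S.riccatiSol K - S.riccatiSol K') * S.D with hZ
  have hZp : Z.PosSemidef := hle.transpose_mul_mul S.D
  have h2 : N' - N = (S.γ ^ 2)⁻¹ • Z := by
    rw [hN, hN', hZ, Matrix.mul_sub, Matrix.sub_mul]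
    module
  have h4 := hZp.trace_mul_le hc
  rw [h2, Matrix.smul_mul, Matrix.trace_smul, smul_eq_mul] at h1
  have h5 : Z.trace ≤ ‖S.D * S.Dᵀ‖ * (S.riccatiSol K - S.riccatiSol K').trace := by
    have h6 := hle.trace_mul_le (Matrix.posSemidef_norm_smul_one_sub (X := S.D * S.Dᵀ) (by simp))
    rwa [← Matrix.mul_assoc, Matrix.trace_mul_comm, ← Matrix.mul_assoc] at h6
  rw [cost_eq, cost_eq, ← hN, ← hN']
  have h7 : S.γ ^ 2 * (Real.log N'.det - Real.log N.det) ≤ (Z * N⁻¹).trace := by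
    calc _ ≤ S.γ ^ 2 * ((S.γ ^ 2)⁻¹ * (Z * N⁻¹).trace) := by gcongr
      _ = _ := by rw [← mul_assoc, mul_inv_cancel₀ hg.ne', one_mul]
  calc _ = S.γ ^ 2 * (Real.log N'.det - Real.log N.det) := by ring
    _ ≤ c * Z.trace := h7.trans h4
    _ ≤ c * (‖S.D * S.Dᵀ‖ * (S.riccatiSol K - S.riccatiSol K').trace) := by gcongr
    _ = _ := by ring

/-- The two linear terms contribute `-4η` and the quadratic one `4η²`; the step `η = 1/2` maximizes
the slack. -/
theorem gainRic_gaussNewton (hR : S.R.PosDef) (hP : P.PosSemidef) (hM : (S.dist P).PosDef)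
    (h0 : S.gainRic K P = 0) (η : ℝ) :
    -S.gainRic (K - (2 * η) • ((S.weight P)⁻¹ * S.resid K P)) P =
      (4 * η * (1 - η)) • ((S.resid K P)ᵀ * (S.weight P)⁻¹ * S.resid K P) := by
  have hG := weight_posDef hR hP hM
  have hu : IsUnit (S.weight P).det := hG.det_pos.ne'.isUnit
  rw [gainRic_sub hP.transpose_eq hM, h0]
  simp only [Matrix.transpose_smul, Matrix.transpose_mul, hG.inv.transpose_eq, Matrix.smul_mul,
    Matrix.mul_smul, Matrix.mul_assoc, Matrix.mul_nonsing_inv_cancel_left _ _ hu]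
  module

theorem gainRic_naturalPG (hP : P.PosSemidef) (hM : (S.dist P).PosDef)
    (h0 : S.gainRic K P = 0) (η : ℝ) :
    -S.gainRic (K - (2 * η) • S.resid K P) P =
      (4 * η) • ((S.resid K P)ᵀ * S.resid K P) -
        (4 * η ^ 2) • ((S.resid K P)ᵀ * S.weight P * S.resid K P) := by
  rw [gainRic_sub hP.transpose_eq hM, h0]
  simp only [Matrix.transpose_smul, Matrix.smul_mul, Matrix.mul_smul, Matrix.mul_assoc]
  module

/-- The first-order optimality condition. -/
theorem resid_eq_zero_of_isMin (hγ : 0 < S.γ) (hD : (S.D * S.Dᵀ).PosDef) (hR : S.R.PosDef)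
    (hK : K ∈ S.feasible) (hmin : ∀ K' ∈ S.feasible, S.cost K ≤ S.cost K') :
    S.resid K (S.riccatiSol K) = 0 := by
  have h := stabilizing_riccatiSol hγ hD hK
  obtain ⟨c, hc, hcost⟩ := exists_trace_le_cost_sub hγ hD
  have hG := weight_posDef hR h.posSemidef h.posDef
  set P := S.riccatiSol K with hP
  -- No differentiation: a full Gauss–Newton step would lower the cost unless `Eᵀ G⁻¹ E` has trace
  -- zero, where `G = weight P`.
  set K' := K - (2 * (1 / 2 : ℝ)) • ((S.weight P)⁻¹ * S.resid K P) with hK'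
  obtain ⟨hf, hle⟩ := GainStabilizing.improve hγ hD hR h one_pos (S.weight P)⁻¹ (K' := K')
    (by rw [hK']; norm_num) (by
      rw [hK', gainRic_gaussNewton hR h.posSemidef h.posDef h.ric_eq]
      norm_num
      exact Matrix.PosSemidef.zero)
  have hsq := hG.inv.posSemidef.transpose_mul_mul (S.resid K P)
  have hle0 : (P - S.riccatiSol K').PosSemidef := by
    simpa using hle.add (hsq.smul (zero_le_one (α := ℝ)))
  have h1 := hcost K hK K' hf hle0
  have h2 := hmin K' hf
  have h3 := hle.trace_nonneg
  rw [one_smul, Matrix.trace_sub] at h3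
  have h4 : (P - S.riccatiSol K').trace ≤ 0 := by
    by_contra hpos
    have := mul_pos hc (not_le.mp hpos)
    linarith
  exact hG.inv.eq_zero_of_trace (le_antisymm (by linarith) hsq.trace_nonneg)

/-! ### Comparison with a stationary gain, and global convergence. -/

section Saddle

variable {K₁ K₂ : Matrix (Fin d) (Fin m) ℝ} {P₁ P₂ : Matrix (Fin m) (Fin m) ℝ} {r : Type*}

/-- The quadratic form comparing the gain `K₁` with the worst-case trajectory of a stationary
gain `K₂`. -/
def saddleForm (P₁ P₂ : Matrix (Fin m) (Fin m) ℝ) (x ξ : Matrix (Fin m) r ℝ) : Matrix r r ℝ :=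
  xᵀ * P₁ * x - xᵀ * P₂ * ξ - ξᵀ * P₂ * x + ξᵀ * P₂ * ξ

/-- Stationarity lets `P₂ ξ` act as a costate: it satisfies the open-loop adjoint equation and the
minimum condition. No gain enters the adjoint equation explicitly, so it can be paired with
trajectories of any other gain. -/
theorem stationary_costate (h0 : S.gainRic K₂ P₂ = 0)
    (hE : S.resid K₂ P₂ = 0) (ξ : Matrix (Fin m) r ℝ) :
    P₂ * ξ = S.Aᵀ * (P₂ * (S.amp P₂ * (S.A - S.B * K₂) * ξ)) + S.Cᵀ * (S.C * ξ) ∧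
      S.Bᵀ * (P₂ * (S.amp P₂ * (S.A - S.B * K₂) * ξ)) = S.R * (K₂ * ξ) := by
  have hB : S.Bᵀ * (P₂ * (S.amp P₂ * (S.A - S.B * K₂) * ξ)) = S.R * (K₂ * ξ) := by
    rw [resid_eq, sub_eq_zero, tilde_eq_mul_amp] at hE
    have := congrArg (· * ξ) hE
    simp only [Matrix.mul_assoc] at this ⊢
    exact this.symm
  refine ⟨?_, hB⟩
  rw [gainRic, ric, sub_eq_zero, tilde_eq_mul_amp] at h0
  have h1 := congrArg (· * ξ) h0
  rw [← h1, outputWeight]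
  have e : (S.A - S.B * K₂)ᵀ * (P₂ * S.amp P₂) * (S.A - S.B * K₂) * ξ =
      S.Aᵀ * (P₂ * (S.amp P₂ * (S.A - S.B * K₂) * ξ)) - K₂ᵀ * (S.R * (K₂ * ξ)) := by
    rw [← hB, Matrix.transpose_sub, Matrix.transpose_mul]
    generalize S.A - S.B * K₂ = F
    simp only [Matrix.sub_mul, Matrix.mul_assoc]
  rw [Matrix.add_mul, e]
  simp only [Matrix.add_mul, Matrix.mul_assoc]
  abel

/-- The decrease of `saddleForm` along the dynamics is a sum of squares. -/
theorem saddleForm_sub (hs₁ : P₁ᵀ = P₁) (hM₁ : (S.dist P₁).PosDef) (h₁ : S.gainRic K₁ P₁ = 0)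
    (hs₂ : P₂ᵀ = P₂) (hM₂ : (S.dist P₂).PosDef) (h₂ : S.gainRic K₂ P₂ = 0)
    (hE : S.resid K₂ P₂ = 0) (x ξ : Matrix (Fin m) r ℝ) {w : Matrix (Fin n) r ℝ}
    (hw : w = S.gain P₂ * ((S.A - S.B * K₂) * ξ)) {F₁ : Matrix (Fin m) (Fin m) ℝ}
    (hF₁ : F₁ = S.A - S.B * K₁) :
    saddleForm P₁ P₂ x ξ -
        saddleForm P₁ P₂ (F₁ * x + S.D * w) (S.amp P₂ * (S.A - S.B * K₂) * ξ) =
      (w - S.gain P₁ * (F₁ * x))ᵀ * S.dist P₁ * (w - S.gain P₁ * (F₁ * x)) +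
        (S.C * (x - ξ))ᵀ * (S.C * (x - ξ)) + (K₁ * x - K₂ * ξ)ᵀ * S.R * (K₁ * x - K₂ * ξ) := by
  obtain ⟨hc, hB⟩ := stationary_costate h₂ hE ξ
  have hy : S.amp P₂ * (S.A - S.B * K₂) * ξ = (S.A - S.B * K₂) * ξ + S.D * w := by
    rw [Matrix.mul_assoc, amp_mul, hw]
  have hDw : S.Dᵀ * (P₂ * (S.amp P₂ * (S.A - S.B * K₂) * ξ)) = S.γ ^ 2 • w := by
    have := congrArg (· * ((S.A - S.B * K₂) * ξ)) (D_mul_amp hM₂)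
    simp only [Matrix.mul_assoc, Matrix.smul_mul] at this ⊢
    rw [hw, this]
  -- One identity for an arbitrary gain and state under the disturbance `w`: it is used for `K₁` at
  -- `x` and for `K₂` at `ξ`.
  have cross : ∀ (K : Matrix (Fin d) (Fin m) ℝ) (y : Matrix (Fin m) r ℝ),
      yᵀ * P₂ * ξ - ((S.A - S.B * K) * y + S.D * w)ᵀ * P₂ *
        (S.amp P₂ * (S.A - S.B * K₂) * ξ) =
      yᵀ * (S.Cᵀ * (S.C * ξ)) + yᵀ * (Kᵀ * (S.R * (K₂ * ξ))) - S.γ ^ 2 • (wᵀ * w) := by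
    intro K y
    rw [Matrix.mul_assoc, Matrix.mul_assoc, hc]
    have e : ((S.A - S.B * K) * y + S.D * w)ᵀ = yᵀ * S.Aᵀ - yᵀ * Kᵀ * S.Bᵀ + wᵀ * S.Dᵀ := by
      simp only [Matrix.transpose_add, Matrix.transpose_sub, Matrix.transpose_mul,
        Matrix.sub_mul, Matrix.mul_assoc]
    rw [e]
    generalize S.amp P₂ * (S.A - S.B * K₂) * ξ = η at *
    simp only [Matrix.add_mul, Matrix.sub_mul, Matrix.mul_add, Matrix.mul_assoc, hB, hDw,
      Matrix.mul_smul]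
    abel
  generalize S.amp P₂ * (S.A - S.B * K₂) * ξ = η at *
  have c1 := cross K₁ x
  have c2 := congrArg Matrix.transpose c1
  have c3 := cross K₂ ξ
  rw [← hy] at c3
  rw [← hF₁] at c1 c2
  have f1 := amp_mul_ric_form (F := F₁) (Q := S.outputWeight K₁) hs₁ hM₁ x w
  have h₁' : S.ric F₁ (S.outputWeight K₁) P₁ = 0 := by rw [hF₁]; exact h₁
  rw [h₁', Matrix.mul_zero, Matrix.zero_mul, zero_sub] at f1
  have e4 := sub_eq_iff_eq_add.mp f1
  have e1 := sub_eq_iff_eq_add.mp c1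
  have e3 := sub_eq_iff_eq_add.mp c3
  simp only [Matrix.transpose_sub, Matrix.transpose_add, Matrix.transpose_mul,
    Matrix.transpose_transpose, Matrix.transpose_smul, hs₂, R_transpose] at c2
  rw [saddleForm, saddleForm, e4, e1, e3]
  generalize (w - S.gain P₁ * (F₁ * x))ᵀ * S.dist P₁ * (w - S.gain P₁ * (F₁ * x)) = Nsq at *
  have e2 := sub_eq_iff_eq_add.mp c2
  simp only [Matrix.transpose_sub, Matrix.transpose_add, Matrix.transpose_mul, Matrix.mul_assoc,
    outputWeight, Matrix.mul_add, Matrix.add_mul, Matrix.mul_sub, Matrix.sub_mul] at e2 ⊢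
  rw [e2]
  abel

end Saddle

end MixedDesign

namespace MixedDesign

variable {m d n l : ℕ} {S : MixedDesign m d n l} {K₁ K₂ : Matrix (Fin d) (Fin m) ℝ}
  {P₁ P₂ : Matrix (Fin m) (Fin m) ℝ}

/-- A stationary stabilizing gain has the smallest Riccati solution among all gains. -/
theorem GainStabilizing.sub_posSemidef (hF : IsSchurStable (S.A - S.B * K₁))
    (h₁ : S.GainStabilizing K₁ P₁) (h₂ : S.GainStabilizing K₂ P₂) (hE : S.resid K₂ P₂ = 0) :
    (P₁ - P₂).PosSemidef := by
  set A₂ := S.amp P₂ * (S.A - S.B * K₂) with hA₂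
  obtain ⟨X, c, hX0, hX, hXc⟩ := hF.exists_bounded_response h₂.stable
    (S.D * (S.gain P₂ * (S.A - S.B * K₂)))
  -- Both trajectories start at the identity, so `H 0 = P₁ - P₂`, and both are fed the worst-case
  -- disturbance of `K₂`.
  let H : ℕ → Matrix (Fin m) (Fin m) ℝ := fun t => saddleForm P₁ P₂ (X t) (A₂ ^ t)
  have hdec : ∀ t, (H t - H (t + 1)).PosSemidef := by
    intro t
    have e := saddleForm_sub h₁.posSemidef.transpose_eq h₁.posDef h₁.ric_eq
      h₂.posSemidef.transpose_eq h₂.posDef h₂.ric_eq hE (X t) (A₂ ^ t) rfl rfl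
    have e1 : X (t + 1) = (S.A - S.B * K₁) * X t +
        S.D * (S.gain P₂ * ((S.A - S.B * K₂) * A₂ ^ t)) := by
      rw [hX t, ← hA₂]
      simp only [Matrix.mul_assoc]
    simp only [H]
    rw [e1, pow_succ', e]
    exact ((h₁.posDef.posSemidef.transpose_mul_mul _).add
      (Matrix.posSemidef_transpose_mul_self _)).add (R_posSemidef.transpose_mul_mul _)
  have htel : ∀ t, (H 0 - H t).PosSemidef := by
    intro t
    induction t with
    | zero => simpa using Matrix.PosSemidef.zero
    | succ t ih => simpa using ih.add (hdec t)
  -- Only the cross terms of `H t` have no sign; they vanish in the limit because `X` is bounded and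
  -- `A₂ ^ t → 0`.
  have hlow : ∀ t, (H 0 + ((X t)ᵀ * P₂ * A₂ ^ t + (A₂ ^ t)ᵀ * P₂ * X t)).PosSemidef := by
    intro t
    convert ((htel t).add (h₁.posSemidef.transpose_mul_mul (X t))).add
      (h₂.posSemidef.transpose_mul_mul (A₂ ^ t)) using 1
    simp only [H, saddleForm]
    abel
  have hz : Tendsto (fun t => (X t)ᵀ * P₂ * A₂ ^ t) atTop (𝓝 0) := by
    have h0 : Tendsto (fun t => c * ‖P₂‖ * ‖A₂ ^ t‖) atTop (𝓝 0) := by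
      simpa using (h₂.stable.tendsto_pow.norm).const_mul (c * ‖P₂‖)
    refine squeeze_zero_norm (fun t => ?_) h0
    have ht : ‖(X t)ᵀ‖ ≤ c := by
      rw [← Matrix.conjTranspose_eq_transpose_of_trivial, Matrix.l2_opNorm_conjTranspose]
      exact hXc t
    calc _ ≤ ‖(X t)ᵀ‖ * ‖P₂‖ * ‖A₂ ^ t‖ :=
          (norm_mul_le _ _).trans (by gcongr; exact norm_mul_le _ _)
      _ ≤ _ := by gcongr
  have hz' : Tendsto (fun t => (A₂ ^ t)ᵀ * P₂ * X t) atTop (𝓝 0) := by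
    have hc : Continuous fun Y : Matrix (Fin m) (Fin m) ℝ => Yᵀ := by fun_prop
    have := (hc.tendsto 0).comp hz
    rw [Matrix.transpose_zero] at this
    refine this.congr fun t => ?_
    simp [Matrix.transpose_mul, h₂.posSemidef.transpose_eq, Matrix.mul_assoc]
  have hlim := (tendsto_const_nhds (x := H 0)).add (hz.add hz')
  have hfin := Matrix.PosSemidef.of_tendsto hlim hlow
  convert hfin using 1
  simp [H, saddleForm, hX0]

/-- A limit of stabilizing solutions that is stationary and dominates a stationary stabilizing
solution is itself stabilizing. -/
theorem stable_of_limit (hD : (S.D * S.Dᵀ).PosDef) (hR : S.R.PosDef)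
    (hF : IsSchurStable (S.A - S.B * K₁)) (h₁ : S.GainStabilizing K₁ P₁)
    (hP₂ : P₂.PosSemidef) (hM₂ : (S.dist P₂).PosDef) (h₂ : S.gainRic K₂ P₂ = 0)
    (hE : S.resid K₂ P₂ = 0) (hle : (P₂ - P₁).PosSemidef)
    {A : ℕ → Matrix (Fin m) (Fin m) ℝ} (hA : ∀ k, IsSchurStable (A k))
    (hlim : Tendsto A atTop (𝓝 (S.amp P₂ * (S.A - S.B * K₂)))) :
    IsSchurStable (S.amp P₂ * (S.A - S.B * K₂)) := by
  rw [isSchurStable_iff]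
  intro V α β hαβ hV
  rcases hαβ.eq_or_lt with h | h
  swap
  · exact eq_zero_of_tendsto_isSchurStable hA hlim h hV
  set F₁ := S.A - S.B * K₁ with hF₁
  set F₂ := S.A - S.B * K₂ with hF₂
  have hs₁ := h₁.posSemidef.transpose_eq
  set w := S.gain P₂ * (F₂ * V) with hw
  -- Steady state of the loop of `K₁` under the disturbance generated by the marginal mode. The
  -- trace of the saddle form is unchanged by rotation, so all squares in its decrease vanish.
  obtain ⟨Y, hY⟩ := hF.exists_steadyState hαβ (S.D * w)
  have e := congrArg Matrix.trace (saddleForm_sub hs₁ h₁.posDef h₁.ric_eq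
    hP₂.transpose_eq hM₂ h₂ hE Y V hw hF₁)
  have hconst : (saddleForm P₁ P₂ (Y * rotMatrix α β) (V * rotMatrix α β)).trace =
      (saddleForm P₁ P₂ Y V).trace := by
    simp only [saddleForm, Matrix.trace_add, Matrix.trace_sub, trace_rotMatrix_mixed, ← h, one_mul]
  rw [← hY, hV, Matrix.trace_sub, hconst, sub_self, Matrix.trace_add, Matrix.trace_add] at e
  have t1 := (h₁.posDef.posSemidef.transpose_mul_mul (w - S.gain P₁ * (F₁ * Y))).trace_nonneg
  have t2 := (Matrix.posSemidef_transpose_mul_self (S.C * (Y - V))).trace_nonneg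
  have t3 := (hR.posSemidef.transpose_mul_mul (K₁ * Y - K₂ * V)).trace_nonneg
  have z1 : w - S.gain P₁ * (F₁ * Y) = 0 := h₁.posDef.eq_zero_of_trace (by linarith)
  have z2 : S.C * (Y - V) = 0 := Matrix.trace_transpose_mul_self_eq_zero (by linarith)
  have z3 : K₁ * Y - K₂ * V = 0 := hR.eq_zero_of_trace (by linarith)
  have hY0 : Y = 0 := by
    refine isSchurStable_iff.mp h₁.stable Y α β hαβ ?_
    rw [Matrix.mul_assoc, amp_mul, ← sub_eq_zero.mp z1, hY]
  rw [hY0] at z1 z3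
  have hw0 : w = 0 := by simpa using z1
  have hK2 : K₂ * V = 0 := by simpa using z3
  have hFV : F₂ * V = V * rotMatrix α β := by
    rw [← hV, Matrix.mul_assoc, amp_mul, ← hw, hw0, Matrix.mul_zero, add_zero]
  have hAV : F₂ * V = S.A * V := by
    rw [hF₂, Matrix.sub_mul, Matrix.mul_assoc, hK2, Matrix.mul_zero, sub_zero]
  have hαβ0 : 0 < α ^ 2 + β ^ 2 := by linarith
  -- With no disturbance and no control on `V`, rank of `D` gives `P₂ V = 0`. Then `P₁ ≤ P₂` and the
  -- Riccati equation give `K₁ V = 0`, making `V` a marginal mode of the stable `A - B K₁`.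
  have hPV : P₂ * V = 0 := by
    have h3 : S.Dᵀ * (P₂ * (V * rotMatrix α β)) = 0 := by
      have := congrArg (· * (F₂ * V)) (dist_mul_gain hM₂)
      simp only [Matrix.mul_assoc] at this
      rw [← hFV, ← this, ← hw, hw0, Matrix.mul_zero]
    have h4 : S.D * S.Dᵀ * (P₂ * V * rotMatrix α β) = 0 := by
      rw [Matrix.mul_assoc, Matrix.mul_assoc, h3, Matrix.mul_zero]
    exact eq_zero_of_mul_rotMatrix hαβ0 (hD.eq_zero_of_mul_eq_zero h4)
  have hP₁V : (Vᵀ * P₁ * V).trace = 0 := by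
    have h5 := (hle.transpose_mul_mul V).trace_nonneg
    have h6 := (h₁.posSemidef.transpose_mul_mul V).trace_nonneg
    rw [Matrix.mul_assoc, Matrix.sub_mul, hPV, zero_sub, Matrix.mul_neg, Matrix.trace_neg,
      ← Matrix.mul_assoc] at h5
    linarith
  have hK1 : K₁ * V = 0 := by
    have h7 := congrArg (fun Z => (Vᵀ * Z * V).trace) h₁.ric_eq
    simp only [ric, outputWeight, Matrix.mul_sub, Matrix.mul_add, Matrix.sub_mul, Matrix.add_mul,
      Matrix.trace_sub, Matrix.trace_add, Matrix.mul_zero, Matrix.zero_mul,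
      Matrix.trace_zero] at h7
    rw [hP₁V] at h7
    have t4 := (((tilde_posSemidef h₁.posSemidef h₁.posDef).transpose_mul_mul
      F₁).transpose_mul_mul V).trace_nonneg
    have t5 := ((Matrix.posSemidef_transpose_mul_self S.C).transpose_mul_mul V).trace_nonneg
    have t6 := ((hR.posSemidef.transpose_mul_mul K₁).transpose_mul_mul V).trace_nonneg
    refine hR.eq_zero_of_trace (V := K₁ * V) ?_
    have : (K₁ * V)ᵀ * S.R * (K₁ * V) = Vᵀ * (K₁ᵀ * S.R * K₁) * V := by
      simp only [Matrix.transpose_mul, Matrix.mul_assoc]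
    rw [this]
    have t7 : (Vᵀ * (F₁ᵀ * S.tilde P₁ * F₁) * V).trace + (Vᵀ * (S.Cᵀ * S.C) * V).trace +
        (Vᵀ * (K₁ᵀ * S.R * K₁) * V).trace = 0 := by
      simp only [hF₁, Matrix.mul_sub, Matrix.sub_mul, Matrix.trace_sub] at h7 ⊢
      linarith
    linarith
  refine isSchurStable_iff.mp hF V α β hαβ ?_
  rw [← hFV, hAV, hF₁, Matrix.sub_mul, Matrix.mul_assoc, hK1, Matrix.mul_zero, sub_zero]

variable {Kstar : Matrix (Fin d) (Fin m) ℝ}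

theorem eq_of_resid_eq_zero {P : Matrix (Fin m) (Fin m) ℝ} {K : Matrix (Fin d) (Fin m) ℝ}
    (hG : (S.weight P).PosDef) (h : S.resid K P = 0) :
    K = (S.weight P)⁻¹ * (S.Bᵀ * S.tilde P * S.A) := by
  rw [← sub_eq_zero.mp h, Matrix.nonsing_inv_mul_cancel_left _ _ hG.det_pos.ne'.isUnit]

/-- Sequences of feasible gains with sufficient decrease converge to the stationary gain. -/
theorem tendsto_of_decrease (hγ : 0 < S.γ) (hD : (S.D * S.Dᵀ).PosDef) (hR : S.R.PosDef)
    (hKstar : Kstar ∈ S.feasible) (hE : S.resid Kstar (S.riccatiSol Kstar) = 0)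
    {K : ℕ → Matrix (Fin d) (Fin m) ℝ} (hK : ∀ k, K k ∈ S.feasible) {a : ℝ} (ha : 0 < a)
    (hdec : ∀ k, (S.riccatiSol (K k) - S.riccatiSol (K (k + 1)) -
      a • ((S.gradE (K k))ᵀ * (S.gainWeight (K k))⁻¹ * S.gradE (K k))).PosSemidef) :
    Tendsto K atTop (𝓝 Kstar) ∧
      Tendsto (fun k => S.riccatiSol (K k)) atTop (𝓝 (S.riccatiSol Kstar)) := by
  have hst := stabilizing_riccatiSol hγ hD hKstar
  have hsk := fun k => stabilizing_riccatiSol hγ hD (hK k)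
  set P : ℕ → Matrix (Fin m) (Fin m) ℝ := fun k => S.riccatiSol (K k) with hP
  have hGk : ∀ k, (S.gainWeight (K k)).PosDef := fun k =>
    weight_posDef hR (hsk k).posSemidef (hsk k).posDef
  have hsq := fun k => (hGk k).inv.posSemidef.transpose_mul_mul (S.gradE (K k))
  have hlow : ∀ k, (P k - S.riccatiSol Kstar).PosSemidef := fun k =>
    GainStabilizing.sub_posSemidef (hK k).1 (hsk k) hst hE
  obtain ⟨Y, hY, hPY⟩ := Matrix.exists_tendsto_of_decreasing (P := P)
    (fun k => by simpa using (hdec k).add ((hsq k).smul ha.le)) hlow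
  have hYp : Y.PosSemidef := Matrix.PosSemidef.of_tendsto hY fun k => (hsk k).posSemidef
  have hYM : (S.dist Y).PosDef := dist_posDef_of_le (hPY 0) (hsk 0).posDef
  have hYle : (Y - S.riccatiSol Kstar).PosSemidef :=
    Matrix.PosSemidef.of_tendsto (hY.sub_const _) hlow
  have hG := weight_posDef hR hYp hYM
  have htl : Tendsto (fun k => S.tilde (P k)) atTop (𝓝 (S.tilde Y)) :=
    (continuousAt_tilde hYM).tendsto.comp hY
  have hGl : Tendsto (fun k => S.gainWeight (K k)) atTop (𝓝 (S.weight Y)) := by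
    have hc : Continuous fun T : Matrix (Fin m) (Fin m) ℝ => S.R + S.Bᵀ * T * S.B := by fun_prop
    exact (hc.tendsto _).comp htl
  have htr : Tendsto (fun k => ((S.gradE (K k))ᵀ * (S.gainWeight (K k))⁻¹ *
      S.gradE (K k)).trace) atTop (𝓝 0) := by
    have h1 : Tendsto (fun k => a⁻¹ * ((P k).trace - (P (k + 1)).trace)) atTop (𝓝 0) := by
      have h2 := (Matrix.continuous_trace.tendsto Y).comp hY
      simpa using (h2.sub (h2.comp (tendsto_add_atTop_nat 1))).const_mul a⁻¹
    refine squeeze_zero (fun k => (hsq k).trace_nonneg) (fun k => ?_) h1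
    have := (hdec k).trace_nonneg
    rw [Matrix.trace_sub, Matrix.trace_sub, Matrix.trace_smul, smul_eq_mul] at this
    rw [← div_eq_inv_mul, le_div_iff₀ ha]
    linarith
  -- The weights converge, hence are bounded, so `‖E‖²` is at most a multiple of the vanishing
  -- trace.
  have hEl : Tendsto (fun k => S.gradE (K k)) atTop (𝓝 0) := by
    obtain ⟨c, hc⟩ := hGl.norm.bddAbove_range
    have hc' : ∀ k, ‖S.gainWeight (K k)‖ ≤ |c| + 1 := fun k =>
      (hc (Set.mem_range_self k)).trans (by linarith [le_abs_self c])
    have hcp : 0 < |c| + 1 := by positivity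
    have h1 : Tendsto (fun k => Real.sqrt ((|c| + 1) * ((S.gradE (K k))ᵀ *
        (S.gainWeight (K k))⁻¹ * S.gradE (K k)).trace)) atTop (𝓝 0) := by
      have := (htr.const_mul (|c| + 1)).sqrt
      simpa using this
    refine squeeze_zero_norm (fun k => Real.le_sqrt_of_sq_le ?_) h1
    have h2 : ‖S.gradE (K k)‖ ^ 2 = ‖(S.gradE (K k))ᵀ * S.gradE (K k)‖ := by
      have := Matrix.l2_opNorm_conjTranspose_mul_self (S.gradE (K k))
      rw [Matrix.conjTranspose_eq_transpose_of_trivial] at this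
      rw [this, sq]
    rw [h2]
    refine (Matrix.posSemidef_transpose_mul_self _).norm_le_trace.trans ?_
    have h3 := (((hGk k).inv_sub_smul_one hcp (Matrix.PosSemidef.smul_one_of_norm_le
      (hGk k).transpose_eq (hc' k))).transpose_mul_mul (S.gradE (K k))).trace_nonneg
    rw [Matrix.mul_sub, Matrix.sub_mul, Matrix.trace_sub, Matrix.mul_smul, Matrix.smul_mul,
      Matrix.mul_one, Matrix.trace_smul, smul_eq_mul] at h3
    have h4 : (|c| + 1)⁻¹ * ((S.gradE (K k))ᵀ * S.gradE (K k)).trace ≤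
        ((S.gradE (K k))ᵀ * (S.gainWeight (K k))⁻¹ * S.gradE (K k)).trace := by linarith
    rwa [inv_mul_le_iff₀ hcp] at h4
  -- The gains are recovered from `G K = E + Bᵀ P̃ A`, so no compactness of the feasible set is
  -- needed.
  obtain ⟨Z, hZ⟩ : ∃ Z, Z = (S.weight Y)⁻¹ * (S.Bᵀ * S.tilde Y * S.A) := ⟨_, rfl⟩
  have hKl : Tendsto K atTop (𝓝 Z) := by
    rw [hZ]
    have hc : Continuous fun y : Matrix (Fin d) (Fin d) ℝ × Matrix (Fin d) (Fin m) ℝ ×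
        Matrix (Fin m) (Fin m) ℝ => y.1 * (y.2.1 + S.Bᵀ * y.2.2 * S.A) := by fun_prop
    have h1 := (hc.tendsto ((S.weight Y)⁻¹, 0, S.tilde Y)).comp
      (((Matrix.continuousAt_nonsing_inv hG.det_pos.ne'.isUnit).tendsto.comp hGl).prodMk_nhds
        (hEl.prodMk_nhds htl))
    simp only [zero_add] at h1
    refine h1.congr fun k => ?_
    simp only [Function.comp]
    have h2 : S.gradE (K k) + S.Bᵀ * S.tilde (P k) * S.A = S.gainWeight (K k) * K k := by
      rw [gradE, tildeP, hP]
      abel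
    rw [h2, Matrix.nonsing_inv_mul_cancel_left _ _ (hGk k).det_pos.ne'.isUnit]
  have hEZ : S.resid Z Y = 0 := by
    rw [resid, hZ, Matrix.mul_nonsing_inv_cancel_left _ _ hG.det_pos.ne'.isUnit, sub_self]
  have hric : S.gainRic Z Y = 0 := by
    have hc : Continuous fun y : Matrix (Fin d) (Fin m) ℝ × Matrix (Fin m) (Fin m) ℝ ×
        Matrix (Fin m) (Fin m) ℝ => (S.A - S.B * y.1)ᵀ * y.2.1 * (S.A - S.B * y.1) +
          (S.Cᵀ * S.C + y.1ᵀ * S.R * y.1) - y.2.2 := by fun_prop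
    have h1 := (hc.tendsto (Z, S.tilde Y, Y)).comp (hKl.prodMk_nhds (htl.prodMk_nhds hY))
    exact tendsto_nhds_unique h1 (tendsto_const_nhds.congr fun k => (hsk k).ric_eq.symm)
  have hAl : Tendsto (fun k => S.amp (P k) * (S.A - S.B * K k)) atTop
      (𝓝 (S.amp Y * (S.A - S.B * Z))) := by
    have h1 : Tendsto (fun k => S.amp (P k)) atTop (𝓝 (S.amp Y)) :=
      (continuousAt_amp hYM).tendsto.comp hY
    have hc : Continuous fun y : Matrix (Fin d) (Fin m) ℝ => S.A - S.B * y := by fun_prop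
    exact h1.mul ((hc.tendsto Z).comp hKl)
  have hstab := stable_of_limit hD hR hKstar.1 hst hYp hYM hric hEZ hYle
    (fun k => (hsk k).stable) hAl
  have hZst : S.GainStabilizing Z Y := ⟨hYp, hric, hYM, hstab⟩
  -- Both pairs are stationary and stabilizing, so each Riccati solution is below the other.
  have heq : Y = S.riccatiSol Kstar := Matrix.PosSemidef.eq_of_sub_sub hYle
    (GainStabilizing.sub_posSemidef hKstar.1 hst hZst hEZ)
  have hZK : Z = Kstar := by
    rw [hZ, heq]
    exact (eq_of_resid_eq_zero (weight_posDef hR hst.posSemidef hst.posDef) hE).symm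
  exact ⟨hZK ▸ hKl, heq ▸ hY⟩

end MixedDesign

/-- From the identity `1 - ε X⁻¹ = (1 - ε X⁻¹)² + ε (X⁻¹ - ε X⁻²)`, whose last term is a congruence
of `X - ε`. -/
theorem Matrix.PosDef.smul_one_sub_inv {p : Type*} [Fintype p] [DecidableEq p] {X : Matrix p p ℝ}
    (hX : X.PosDef) {ε : ℝ} (hε : 0 < ε) (h : (X - ε • (1 : Matrix p p ℝ)).PosSemidef) :
    (ε⁻¹ • (1 : Matrix p p ℝ) - X⁻¹).PosSemidef := by
  have hu : IsUnit X.det := hX.det_pos.ne'.isUnit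
  have hs : (X⁻¹)ᵀ = X⁻¹ := hX.inv.transpose_eq
  have h1 := h.transpose_mul_mul X⁻¹
  rw [hs, Matrix.mul_sub, Matrix.sub_mul, Matrix.nonsing_inv_mul _ hu, Matrix.one_mul,
    Matrix.mul_smul, Matrix.smul_mul, Matrix.mul_one] at h1
  have h2 := Matrix.posSemidef_transpose_mul_self (1 - ε • X⁻¹)
  have e : (1 - ε • X⁻¹)ᵀ * (1 - ε • X⁻¹) + ε • (X⁻¹ - ε • (X⁻¹ * X⁻¹)) = 1 - ε • X⁻¹ := by
    rw [Matrix.transpose_sub, Matrix.transpose_one, Matrix.transpose_smul, hs]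
    simp only [Matrix.mul_sub, Matrix.sub_mul, Matrix.mul_one, Matrix.one_mul, Matrix.smul_mul,
      Matrix.mul_smul, smul_sub, smul_smul]
    abel
  have h3 := (h2.add (h1.smul hε.le)).smul (inv_nonneg.mpr hε.le)
  rwa [e, smul_sub, smul_smul, inv_mul_cancel₀ hε.ne', one_smul] at h3

/-! ### Local estimates at a stationary gain. -/

namespace MixedDesign

variable {m d n l : ℕ} {S : MixedDesign m d n l} {Kstar : Matrix (Fin d) (Fin m) ℝ}

/-- Near a stationary gain the Riccati solution grows at most quadratically. -/
theorem eventually_trace_le_norm_sq (hγ : 0 < S.γ) (hD : (S.D * S.Dᵀ).PosDef)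
    (hKstar : Kstar ∈ S.feasible) (hE : S.resid Kstar (S.riccatiSol Kstar) = 0) :
    ∃ c : ℝ, 0 < c ∧ ∀ᶠ K in 𝓝[S.feasible] Kstar,
      (S.riccatiSol K - S.riccatiSol Kstar).trace ≤ c * ‖K - Kstar‖ ^ 2 := by
  have hst := stabilizing_riccatiSol hγ hD hKstar
  set P := S.riccatiSol Kstar with hP
  have hs := hst.posSemidef.transpose_eq
  obtain ⟨X, hX, hev⟩ := hst.exists_contraction
  -- Chosen so that the slack `δ / 2` absorbs the residual `(K - K*)ᵀ G (K - K*)` of `P` at `K`,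
  -- with `G = weight P`; then `P + δ X` is a supersolution for `K`.
  set δ : Matrix (Fin d) (Fin m) ℝ → ℝ := fun K => 2 * ‖S.weight P‖ * ‖K - Kstar‖ ^ 2 with hδ
  have hpath : Tendsto (fun K => (S.A - S.B * K, P + δ K • X)) (𝓝 Kstar)
      (𝓝 (S.A - S.B * Kstar, P)) := by
    have hc : Continuous fun K => (S.A - S.B * K, P + δ K • X) := by
      simp only [hδ]
      fun_prop
    simpa [hδ] using hc.tendsto Kstar
  refine ⟨2 * ‖S.weight P‖ * X.trace + 1, by
    have := hX.posSemidef.trace_nonneg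
    positivity, ?_⟩
  filter_upwards [nhdsWithin_le_nhds (hpath.eventually hev), self_mem_nhdsWithin] with K hK hKf
  have hδ0 : 0 ≤ δ K := by simp only [hδ]; positivity
  have hs' : (P + δ K • X)ᵀ = P + δ K • X := by simp [hs, hX.transpose_eq]
  obtain ⟨hM', hc⟩ := hK hs'
  have h1 := ric_add_smul (Q := S.outputWeight K) hs hst.posDef hδ0 hX.transpose_eq hM' hc
  have h2 : S.ric (S.A - S.B * K) (S.outputWeight K) P =
      (K - Kstar)ᵀ * S.weight P * (K - Kstar) :=
    gainRic_of_resid_eq_zero hs hst.posDef hst.ric_eq hE K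
  have hGs : (S.weight P)ᵀ = S.weight P := by
    rw [weight, Matrix.transpose_add, R_transpose, Matrix.transpose_mul, Matrix.transpose_mul,
      tilde_transpose hs hst.posDef, Matrix.transpose_transpose, Matrix.mul_assoc]
  have h3 : ((δ K / 2) • (1 : Matrix (Fin m) (Fin m) ℝ) -
      (K - Kstar)ᵀ * S.weight P * (K - Kstar)).PosSemidef := by
    refine Matrix.PosSemidef.smul_one_of_norm_le ?_ ?_
    · rw [Matrix.transpose_mul, Matrix.transpose_mul, hGs, Matrix.transpose_transpose,
        Matrix.mul_assoc]
    · have h4 : ‖(K - Kstar)ᵀ‖ = ‖K - Kstar‖ := by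
        rw [← Matrix.conjTranspose_eq_transpose_of_trivial, Matrix.l2_opNorm_conjTranspose]
      calc _ ≤ ‖(K - Kstar)ᵀ‖ * ‖S.weight P‖ * ‖K - Kstar‖ :=
            (Matrix.l2_opNorm_mul _ _).trans (by gcongr; exact Matrix.l2_opNorm_mul _ _)
        _ = δ K / 2 := by rw [h4]; simp only [hδ]; ring
  have h5 : (-S.ric (S.A - S.B * K) (S.outputWeight K) (P + δ K • X)).PosSemidef := by
    convert h1.add h3 using 1
    rw [h2]
    abel
  have h6 := ((stabilizing_riccatiSol hγ hD hKf).le_of_ric_nonpos hs' hM' h5).trace_nonneg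
  rw [Matrix.trace_sub, Matrix.trace_add, Matrix.trace_smul, smul_eq_mul] at h6
  rw [Matrix.trace_sub]
  have h7 : δ K * X.trace = 2 * ‖S.weight P‖ * X.trace * ‖K - Kstar‖ ^ 2 := by
    simp only [hδ]; ring
  nlinarith [sq_nonneg ‖K - Kstar‖]

theorem sub_posSemidef_of_feasible (hγ : 0 < S.γ) (hD : (S.D * S.Dᵀ).PosDef)
    (hKstar : Kstar ∈ S.feasible) (hE : S.resid Kstar (S.riccatiSol Kstar) = 0)
    {K : Matrix (Fin d) (Fin m) ℝ} (hK : K ∈ S.feasible) :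
    (S.riccatiSol K - S.riccatiSol Kstar).PosSemidef :=
  GainStabilizing.sub_posSemidef hK.1 (stabilizing_riccatiSol hγ hD hK)
    (stabilizing_riccatiSol hγ hD hKstar) hE

/-- Continuity at `K*` comes from the squeeze between `0` and quadratic growth, without an implicit
function theorem. -/
theorem tendsto_riccatiSol (hγ : 0 < S.γ) (hD : (S.D * S.Dᵀ).PosDef)
    (hKstar : Kstar ∈ S.feasible) (hE : S.resid Kstar (S.riccatiSol Kstar) = 0) :
    Tendsto S.riccatiSol (𝓝[S.feasible] Kstar) (𝓝 (S.riccatiSol Kstar)) := by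
  obtain ⟨c, -, hc⟩ := eventually_trace_le_norm_sq hγ hD hKstar hE
  rw [tendsto_iff_norm_sub_tendsto_zero]
  have h0 : Tendsto (fun K => c * ‖K - Kstar‖ ^ 2) (𝓝[S.feasible] Kstar) (𝓝 0) := by
    have hcont : Continuous fun K : Matrix (Fin d) (Fin m) ℝ => c * ‖K - Kstar‖ ^ 2 := by fun_prop
    have := hcont.tendsto Kstar
    simp only [sub_self, norm_zero, ne_eq, OfNat.ofNat_ne_zero, not_false_eq_true, zero_pow,
      mul_zero] at this
    exact this.mono_left nhdsWithin_le_nhds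
  refine squeeze_zero' (Eventually.of_forall fun _ => norm_nonneg _) ?_ h0
  filter_upwards [hc, self_mem_nhdsWithin] with K hK hKf
  exact (sub_posSemidef_of_feasible hγ hD hKstar hE hKf).norm_le_trace.trans hK

/-- Gradient dominance near a stationary gain. -/
theorem eventually_trace_le_gradE (hγ : 0 < S.γ) (hD : (S.D * S.Dᵀ).PosDef) (hR : S.R.PosDef)
    (hKstar : Kstar ∈ S.feasible) (hE : S.resid Kstar (S.riccatiSol Kstar) = 0) :
    ∃ c : ℝ, 0 < c ∧ ∀ᶠ K in 𝓝[S.feasible] Kstar,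
      (S.riccatiSol K - S.riccatiSol Kstar).trace ≤
        c * ((S.gradE K)ᵀ * (S.gainWeight K)⁻¹ * S.gradE K).trace := by
  have hst := stabilizing_riccatiSol hγ hD hKstar
  set P := S.riccatiSol Kstar with hP
  have hs := hst.posSemidef.transpose_eq
  set F := S.A - S.B * Kstar with hF
  -- A dual Lyapunov matrix to test against: with `Δ = P_K - P*`, the inequality `Δ - Ψᵀ Δ Ψ ≤ N`
  -- below yields `tr Δ / 2 ≤ tr (N Y) ≤ ‖Y‖ tr N`.
  obtain ⟨Y, hY, hYl⟩ := hst.stable.exists_lyapunov_transpose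
  have hcont : ContinuousAt (fun X : Matrix (Fin m) (Fin m) ℝ =>
      Y - S.amp X * F * Y * (S.amp X * F)ᵀ) P := by
    have hc : Continuous fun Z : Matrix (Fin m) (Fin m) ℝ => Y - Z * F * Y * (Z * F)ᵀ := by fun_prop
    exact ContinuousAt.comp (f := S.amp)
      (g := fun Z : Matrix (Fin m) (Fin m) ℝ => Y - Z * F * Y * (Z * F)ᵀ) hc.continuousAt
      (continuousAt_amp hst.posDef)
  have hev := Matrix.eventually_posSemidef_sub_smul_one (c := 1) (c' := 1 / 2) hcont (by norm_num)
    (by rw [one_smul]; exact hYl)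
  refine ⟨2 * ‖Y‖ + 1, by positivity, ?_⟩
  filter_upwards [(tendsto_riccatiSol hγ hD hKstar hE).eventually hev, self_mem_nhdsWithin]
    with K hK hKf
  have hK1 := hK (by simp [hY.transpose_eq, Matrix.mul_assoc])
  have hsK := stabilizing_riccatiSol hγ hD hKf
  have hΔ : (S.riccatiSol K - P).PosSemidef := sub_posSemidef_of_feasible hγ hD hKstar hE hKf
  have hG : (S.gainWeight K).PosDef := weight_posDef hR hsK.posSemidef hsK.posDef
  have hu : IsUnit (S.gainWeight K).det := hG.det_pos.ne'.isUnit
  set PK := S.riccatiSol K with hPK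
  set Ψ := S.amp PK * F with hΨ
  set N := (S.gradE K)ᵀ * (S.gainWeight K)⁻¹ * S.gradE K with hN
  have hNp : N.PosSemidef := hG.inv.posSemidef.transpose_mul_mul _
  -- Completing the square in the gain: no gain can make the residual of `P_K` smaller than `-N`.
  have h1 : (S.gainRic Kstar PK + N).PosSemidef := by
    have h2 := gainRic_sub hsK.posSemidef.transpose_eq hsK.posDef K (K - Kstar)
    rw [sub_sub_cancel, show S.gainRic K PK = 0 from hsK.ric_eq] at h2
    convert hG.posSemidef.transpose_mul_mul (K - Kstar - (S.gainWeight K)⁻¹ * S.gradE K) using 1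
    rw [h2, hN, ← gradE_eq, ← gainWeight_eq]
    generalize K - Kstar = Z
    simp only [Matrix.transpose_sub, Matrix.transpose_mul, hG.inv.transpose_eq, Matrix.sub_mul,
      Matrix.mul_sub, Matrix.mul_assoc, Matrix.mul_nonsing_inv_cancel_left _ _ hu,
      Matrix.nonsing_inv_mul_cancel_left _ _ hu]
    abel
  have h3 : (Ψᵀ * (PK - P) * Ψ - (PK - P) + N).PosSemidef := by
    have e := ric_sub_ric' (F := F) (Q := S.outputWeight Kstar) hs hst.posDef
      hsK.posSemidef.transpose_eq hsK.posDef
    rw [hst.ric_eq, sub_zero] at e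
    have e' : S.gainRic Kstar PK = _ := e
    convert h1.add (hst.posDef.posSemidef.transpose_mul_mul ((S.gain PK - S.gain P) * F)) using 1
    rw [e']
    abel
  have h4 := h3.trace_mul_nonneg hY.posSemidef
  rw [Matrix.add_mul, Matrix.sub_mul, Matrix.trace_add, Matrix.trace_sub] at h4
  have h5 : (Ψᵀ * (PK - P) * Ψ * Y).trace = ((PK - P) * (Ψ * Y * Ψᵀ)).trace := by
    rw [Matrix.mul_assoc, Matrix.mul_assoc, Matrix.trace_mul_comm]
    simp only [Matrix.mul_assoc]
  have h6 := hΔ.le_trace_mul hK1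
  have h7 := hNp.trace_mul_le (Matrix.posSemidef_norm_smul_one_sub hY.transpose_eq)
  rw [Matrix.mul_sub, Matrix.trace_sub (_ * _)] at h6
  have h8 := hNp.trace_nonneg
  rw [h5] at h4
  nlinarith

/-- Near a stationary gain the cost gap is controlled by the gap of Riccati solutions. -/
theorem eventually_cost_sub_le (hγ : 0 < S.γ) (hD : (S.D * S.Dᵀ).PosDef)
    (hKstar : Kstar ∈ S.feasible) (hE : S.resid Kstar (S.riccatiSol Kstar) = 0) :
    ∃ c : ℝ, 0 < c ∧ ∀ᶠ K in 𝓝[S.feasible] Kstar,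
      S.cost K - S.cost Kstar ≤ c * (S.riccatiSol K - S.riccatiSol Kstar).trace := by
  have hst := stabilizing_riccatiSol hγ hD hKstar
  set P := S.riccatiSol Kstar with hP
  let N : Matrix (Fin m) (Fin m) ℝ → Matrix (Fin n) (Fin n) ℝ :=
    fun X => 1 - (S.γ ^ 2)⁻¹ • (S.Dᵀ * X * S.D)
  have hNp : (N P).PosDef := (one_sub_posDef_iff hγ).mpr hst.posDef
  have hcont : ContinuousAt (fun X => ‖(N X)⁻¹‖) P := by
    have hc : Continuous N := by
      simp only [N]
      fun_prop
    exact (ContinuousAt.comp (f := N) (g := fun Z => Z⁻¹)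
      (Matrix.continuousAt_nonsing_inv hNp.det_pos.ne'.isUnit) hc.continuousAt).norm
  have hev := hcont.eventually (gt_mem_nhds (lt_add_one ‖(N P)⁻¹‖))
  refine ⟨(‖(N P)⁻¹‖ + 1) * ‖S.D * S.Dᵀ‖ + 1, by positivity, ?_⟩
  filter_upwards [(tendsto_riccatiSol hγ hD hKstar hE).eventually hev, self_mem_nhdsWithin]
    with K hK hKf
  have hsK := stabilizing_riccatiSol hγ hD hKf
  have hΔ := sub_posSemidef_of_feasible hγ hD hKstar hE hKf
  have hNK : (N (S.riccatiSol K)).PosDef := (one_sub_posDef_iff hγ).mpr hsK.posDef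
  have h1 := cost_sub_le_trace hγ (c := ‖(N P)⁻¹‖ + 1) hsK hst hΔ (by positivity)
    (Matrix.PosSemidef.smul_one_of_norm_le hNK.inv.transpose_eq hK.le)
  have h2 := hΔ.trace_nonneg
  linarith

/-- The improved gain depends Lipschitz continuously on the Riccati solution. -/
theorem eventually_norm_improved_sub_le (hγ : 0 < S.γ) (hD : (S.D * S.Dᵀ).PosDef)
    (hR : S.R.PosDef) (hKstar : Kstar ∈ S.feasible)
    (hE : S.resid Kstar (S.riccatiSol Kstar) = 0) :
    ∃ c : ℝ, 0 < c ∧ ∀ᶠ K in 𝓝[S.feasible] Kstar,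
      ‖S.gaussNewton (1 / 2) K - Kstar‖ ≤
        c * (S.riccatiSol K - S.riccatiSol Kstar).trace := by
  have hst := stabilizing_riccatiSol hγ hD hKstar
  set P := S.riccatiSol Kstar with hP
  set F := S.A - S.B * Kstar with hF
  have hG := weight_posDef hR hst.posSemidef hst.posDef
  have hcG : ContinuousAt (fun X => ‖(S.weight X)⁻¹‖) P := by
    have hc : Continuous fun T : Matrix (Fin m) (Fin m) ℝ => S.R + S.Bᵀ * T * S.B := by fun_prop
    have h1 : ContinuousAt S.weight P := ContinuousAt.comp (f := S.tilde)
      (g := fun T : Matrix (Fin m) (Fin m) ℝ => S.R + S.Bᵀ * T * S.B) hc.continuousAt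
      (continuousAt_tilde hst.posDef)
    exact (ContinuousAt.comp (f := S.weight) (g := fun Z => Z⁻¹)
      (Matrix.continuousAt_nonsing_inv hG.det_pos.ne'.isUnit) h1).norm
  have hcA : ContinuousAt (fun X => ‖S.amp X * (S.amp X)ᵀ‖) P := by
    have hc : Continuous fun Z : Matrix (Fin m) (Fin m) ℝ => ‖Z * Zᵀ‖ := by fun_prop
    exact ContinuousAt.comp (f := S.amp) (g := fun Z : Matrix (Fin m) (Fin m) ℝ => ‖Z * Zᵀ‖)
      hc.continuousAt (continuousAt_amp hst.posDef)
  set a := ‖(S.weight P)⁻¹‖ + 1 with ha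
  set b := ‖S.amp P * (S.amp P)ᵀ‖ + 1 with hb
  have hev1 := hcG.eventually (gt_mem_nhds (lt_add_one ‖(S.weight P)⁻¹‖))
  have hev2 := hcA.eventually (gt_mem_nhds (lt_add_one ‖S.amp P * (S.amp P)ᵀ‖))
  have ha0 : 0 < a := by positivity
  have hb0 : 0 < b := by positivity
  refine ⟨a * ‖S.Bᵀ‖ * b * ‖F‖ + 1, by positivity, ?_⟩
  have hlim := tendsto_riccatiSol hγ hD hKstar hE
  filter_upwards [hlim.eventually hev1, hlim.eventually hev2, self_mem_nhdsWithin]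
    with K hK1 hK2 hKf
  have hsK := stabilizing_riccatiSol hγ hD hKf
  have hΔ := sub_posSemidef_of_feasible hγ hD hKstar hE hKf
  have hGK : (S.gainWeight K).PosDef := weight_posDef hR hsK.posSemidef hsK.posDef
  have hu : IsUnit (S.gainWeight K).det := hGK.det_pos.ne'.isUnit
  set PK := S.riccatiSol K with hPK
  -- The full step equals `G⁻¹ Bᵀ P̃_K A`, so `K` enters only through `P_K`; stationarity of `K*`
  -- turns the difference into one of `P̃`.
  have e : S.gaussNewton (1 / 2) K - Kstar =
      (S.gainWeight K)⁻¹ * (S.Bᵀ * (S.tilde PK - S.tilde P) * F) := by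
    have h0 : S.Bᵀ * S.tilde P * S.A = S.weight P * Kstar := (sub_eq_zero.mp hE).symm
    have h1 : S.Bᵀ * (S.tilde PK - S.tilde P) * F =
        S.Bᵀ * S.tilde PK * S.A - S.gainWeight K * Kstar := by
      have h2 : S.gainWeight K - S.weight P = S.Bᵀ * (S.tilde PK - S.tilde P) * S.B := by
        rw [gainWeight_eq, weight, weight, Matrix.mul_sub, Matrix.sub_mul]
        abel
      rw [hF, Matrix.mul_sub, ← Matrix.mul_assoc (S.Bᵀ * (S.tilde PK - S.tilde P)), ← h2,
        Matrix.mul_sub S.Bᵀ, Matrix.sub_mul _ _ S.A, Matrix.sub_mul _ _ Kstar, h0]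
      abel
    rw [h1, gaussNewton, gradE, tildeP, Matrix.mul_sub, Matrix.mul_sub,
      Matrix.nonsing_inv_mul_cancel_left _ _ hu, Matrix.nonsing_inv_mul_cancel_left _ _ hu]
    norm_num
    rfl
  have h3 : ‖S.tilde PK - S.tilde P‖ ≤ b * (PK - P).trace := by
    have ht := tilde_mono hst.posSemidef.transpose_eq hst.posDef hsK.posSemidef.transpose_eq
      hsK.posDef hΔ
    refine ht.norm_le_trace.trans ?_
    rw [tilde_sub_tilde' hst.posSemidef.transpose_eq hst.posDef hsK.posSemidef.transpose_eq
      hsK.posDef, Matrix.trace_sub]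
    have h4 := (hst.posDef.posSemidef.transpose_mul_mul (S.gain PK - S.gain P)).trace_nonneg
    have h5 := hΔ.trace_mul_le (Matrix.PosSemidef.smul_one_of_norm_le
      (X := S.amp PK * (S.amp PK)ᵀ) (by simp) hK2.le)
    have h6 : ((S.amp PK)ᵀ * (PK - P) * S.amp PK).trace =
        ((PK - P) * (S.amp PK * (S.amp PK)ᵀ)).trace := by
      rw [Matrix.mul_assoc, Matrix.trace_mul_comm, Matrix.mul_assoc]
    rw [h6]
    linarith
  have h7 := hΔ.trace_nonneg
  calc ‖S.gaussNewton (1 / 2) K - Kstar‖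
      ≤ ‖(S.gainWeight K)⁻¹‖ * (‖S.Bᵀ‖ * ‖S.tilde PK - S.tilde P‖ * ‖F‖) := by
        rw [e]
        refine (Matrix.l2_opNorm_mul _ _).trans ?_
        gcongr
        refine (Matrix.l2_opNorm_mul _ _).trans ?_
        gcongr
        exact Matrix.l2_opNorm_mul _ _
    _ ≤ a * (‖S.Bᵀ‖ * (b * (PK - P).trace) * ‖F‖) := by
        gcongr
        exact hK1.le
    _ = (a * ‖S.Bᵀ‖ * b * ‖F‖) * (PK - P).trace := by ring
    _ ≤ _ := by nlinarith

/-! ### Convergence rates of the two methods. -/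

/-- Any update rule with sufficient decrease converges globally, and locally linearly. -/
theorem convergesLocallyLinearly_of_decrease (hγ : 0 < S.γ) (hD : (S.D * S.Dᵀ).PosDef)
    (hR : S.R.PosDef) (hKstar : Kstar ∈ S.feasible)
    (hopt : ∀ K ∈ S.feasible, S.cost Kstar ≤ S.cost K)
    {step : Matrix (Fin d) (Fin m) ℝ → Matrix (Fin d) (Fin m) ℝ}
    {init inv : Set (Matrix (Fin d) (Fin m) ℝ)} (hinit : init ⊆ inv) (hinv : inv ⊆ S.feasible)
    (hstep : ∀ K ∈ inv, step K ∈ inv) {a : ℝ} (ha : 0 < a)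
    (hdec : ∀ K ∈ inv, (S.riccatiSol K - S.riccatiSol (step K) -
      a • ((S.gradE K)ᵀ * (S.gainWeight K)⁻¹ * S.gradE K)).PosSemidef) :
    S.ConvergesLocallyLinearly step init Kstar := by
  have hE := resid_eq_zero_of_isMin hγ hD hR hKstar hopt
  obtain ⟨c₁, hc₁, hev₁⟩ := eventually_trace_le_gradE hγ hD hR hKstar hE
  obtain ⟨c₂, hc₂, hev₂⟩ := eventually_cost_sub_le hγ hD hKstar hE
  obtain ⟨c₀, hc₀, hcost⟩ := exists_trace_le_cost_sub hγ hD
  have hboth := hev₁.and hev₂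
  rw [eventually_nhdsWithin_iff, Metric.eventually_nhds_iff] at hboth
  obtain ⟨r, hr, hball⟩ := hboth
  have hiter : ∀ K₀ ∈ init, ∀ k, step^[k] K₀ ∈ inv := by
    intro K₀ hK₀ k
    induction k with
    | zero => exact hinit hK₀
    | succ k ih =>
      rw [Function.iterate_succ_apply']
      exact hstep _ ih
  have hsqp : ∀ K ∈ S.feasible,
      ((S.gradE K)ᵀ * (S.gainWeight K)⁻¹ * S.gradE K).PosSemidef := fun K hK => by
    have h := stabilizing_riccatiSol hγ hD hK
    exact (weight_posDef hR h.posSemidef h.posDef).inv.posSemidef.transpose_mul_mul _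
  -- With `T = tr N_K`, the gap is at most `c₂ c₁ T` and one step gains at least `c₀ a T`. The
  -- maximum with `1/2` only keeps the factor positive.
  refine ⟨max (1 / 2) (1 - c₀ * a / (c₂ * c₁)), r, by positivity, ?_, hr, fun K₀ hK₀ => ?_⟩
  · refine max_lt (by norm_num) ?_
    have : 0 < c₀ * a / (c₂ * c₁) := by positivity
    linarith
  have hf : ∀ k, step^[k] K₀ ∈ S.feasible := fun k => hinv (hiter K₀ hK₀ k)
  obtain ⟨hlim, hPlim⟩ := tendsto_of_decrease hγ hD hR hKstar hE hf ha fun k => by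
    rw [Function.iterate_succ_apply']
    exact hdec _ (hiter K₀ hK₀ k)
  refine ⟨hf, hlim, ?_, fun k hk => ?_⟩
  · have hw : Tendsto (fun k => step^[k] K₀) atTop (𝓝[S.feasible] Kstar) :=
      tendsto_nhdsWithin_iff.mpr ⟨hlim, Eventually.of_forall hf⟩
    have h1 : Tendsto (fun k => c₂ * (S.riccatiSol (step^[k] K₀) - S.riccatiSol Kstar).trace)
        atTop (𝓝 0) := by
      have h2 := (Matrix.continuous_trace.tendsto _).comp (hPlim.sub_const (S.riccatiSol Kstar))
      have h3 := h2.const_mul c₂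
      simpa using h3
    have h4 : Tendsto (fun k => S.cost (step^[k] K₀) - S.cost Kstar) atTop (𝓝 0) :=
      squeeze_zero' (Eventually.of_forall fun k => sub_nonneg.mpr (hopt _ (hf k)))
        (hw.eventually hev₂) h1
    simpa using h4.add_const (S.cost Kstar)
  · have hKf := hf k
    have hKf' := hf (k + 1)
    have hd := hdec _ (hiter K₀ hK₀ k)
    rw [Function.iterate_succ_apply'] at hKf' ⊢
    set K := step^[k] K₀ with hK
    obtain ⟨h1, h2⟩ := hball (by rwa [dist_eq_norm]) hKf
    set T := ((S.gradE K)ᵀ * (S.gainWeight K)⁻¹ * S.gradE K).trace with hT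
    have h3 := hcost K hKf _ hKf' (by simpa using hd.add ((hsqp K hKf).smul ha.le))
    have h4 := hd.trace_nonneg
    rw [Matrix.trace_sub, Matrix.trace_smul, smul_eq_mul, ← hT] at h4
    have hgap : 0 ≤ S.cost K - S.cost Kstar := sub_nonneg.mpr (hopt K hKf)
    have h5 : S.cost K - S.cost Kstar ≤ c₂ * c₁ * T := by
      calc _ ≤ c₂ * (c₁ * T) := h2.trans (by gcongr)
        _ = _ := by ring
    have h6 : c₀ * (a * T) ≤ S.cost K - S.cost (step K) :=
      le_trans (by gcongr; linarith) h3
    have h7 : c₀ * a / (c₂ * c₁) * (S.cost K - S.cost Kstar) ≤ c₀ * (a * T) := by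
      calc _ ≤ c₀ * a / (c₂ * c₁) * (c₂ * c₁ * T) := by gcongr
        _ = _ := by field_simp
    calc S.cost (step K) - S.cost Kstar
        ≤ (1 - c₀ * a / (c₂ * c₁)) * (S.cost K - S.cost Kstar) := by linarith
      _ ≤ _ := by
          gcongr
          exact le_max_right _ _

theorem gaussNewton_improve (hγ : 0 < S.γ) (hD : (S.D * S.Dᵀ).PosDef) (hR : S.R.PosDef)
    {η : ℝ} (hη : 0 < η) (hη' : η ≤ 1 / 2) {K : Matrix (Fin d) (Fin m) ℝ}
    (hK : K ∈ S.feasible) :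
    S.gaussNewton η K ∈ S.feasible ∧ (S.riccatiSol K - S.riccatiSol (S.gaussNewton η K) -
      (4 * η * (1 - η)) •
        ((S.gradE K)ᵀ * (S.gainWeight K)⁻¹ * S.gradE K)).PosSemidef := by
  have h := stabilizing_riccatiSol hγ hD hK
  have ha : 0 < 4 * η * (1 - η) := by nlinarith
  refine GainStabilizing.improve hγ hD hR h ha ((2 * η) • (S.gainWeight K)⁻¹) ?_ ?_
  · rw [gaussNewton, Matrix.smul_mul, gradE_eq]
  · have e : -S.gainRic (S.gaussNewton η K) (S.riccatiSol K) = _ :=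
      gainRic_gaussNewton hR h.posSemidef h.posDef h.ric_eq η
    rw [e, sub_self]
    exact Matrix.PosSemidef.zero

/-- With `G = gainWeight K`, the condition `2ηG ≤ 1` reduces the slack to at least `2η EᵀE`, and `G
≥ R ≥ ε` turns this into `2ηε Eᵀ G⁻¹ E`. The condition propagates because `G` decreases together
with `P`. -/
theorem naturalPG_improve (hγ : 0 < S.γ) (hD : (S.D * S.Dᵀ).PosDef) (hR : S.R.PosDef)
    {η ε : ℝ} (hη : 0 < η) (hε : 0 < ε)
    (hRε : (S.R - ε • (1 : Matrix (Fin d) (Fin d) ℝ)).PosSemidef)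
    {K : Matrix (Fin d) (Fin m) ℝ} (hK : K ∈ S.feasible)
    (hKη : (1 - (2 * η) • S.gainWeight K).PosSemidef) :
    (S.naturalPG η K ∈ S.feasible ∧ (1 - (2 * η) • S.gainWeight (S.naturalPG η K)).PosSemidef) ∧
      (S.riccatiSol K - S.riccatiSol (S.naturalPG η K) -
        (2 * η * ε) • ((S.gradE K)ᵀ * (S.gainWeight K)⁻¹ * S.gradE K)).PosSemidef := by
  have h := stabilizing_riccatiSol hγ hD hK
  have hG : (S.gainWeight K).PosDef := weight_posDef hR h.posSemidef h.posDef
  have hGε : (S.gainWeight K - ε • (1 : Matrix (Fin d) (Fin d) ℝ)).PosSemidef := by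
    have h1 : (S.gainWeight K - S.R).PosSemidef := weight_sub_R_posSemidef h.posSemidef h.posDef
    simpa using h1.add hRε
  have ha : 0 < 2 * η * ε := by positivity
  obtain ⟨hf, hle⟩ := GainStabilizing.improve (K' := S.naturalPG η K) hγ hD hR h ha
    ((2 * η) • (1 : Matrix (Fin d) (Fin d) ℝ))
    (by rw [naturalPG, Matrix.smul_mul, Matrix.one_mul, gradE_eq]) (by
      have e : -S.gainRic (S.naturalPG η K) (S.riccatiSol K) = _ :=
        gainRic_naturalPG h.posSemidef h.posDef h.ric_eq η
      have h1 := (hKη.transpose_mul_mul (S.gradE K)).smul (by positivity : 0 ≤ 2 * η)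
      have h2 := (((hG.smul_one_sub_inv hε hGε).transpose_mul_mul (S.gradE K)).smul ha.le)
      rw [e]
      convert h1.add h2 using 1
      rw [← gradE_eq, ← gainWeight_eq]
      simp only [Matrix.mul_sub, Matrix.sub_mul, Matrix.mul_smul, Matrix.smul_mul, Matrix.mul_one,
        smul_sub, smul_smul]
      rw [mul_assoc (2 * η) ε, mul_inv_cancel₀ hε.ne']
      module)
  have hle : (S.riccatiSol K - S.riccatiSol (S.naturalPG η K) -
      (2 * η * ε) • ((S.gradE K)ᵀ * (S.gainWeight K)⁻¹ * S.gradE K)).PosSemidef := hle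
  have hle0 : (S.riccatiSol K - S.riccatiSol (S.naturalPG η K)).PosSemidef := by
    simpa using hle.add ((hG.inv.posSemidef.transpose_mul_mul (S.gradE K)).smul ha.le)
  have h' := stabilizing_riccatiSol hγ hD hf
  refine ⟨⟨hf, ?_⟩, hle⟩
  have ht := ((tilde_mono h'.posSemidef.transpose_eq h'.posDef h.posSemidef.transpose_eq h.posDef
    hle0).transpose_mul_mul S.B).smul (by positivity : 0 ≤ 2 * η)
  convert hKη.add ht using 1
  rw [gainWeight_eq, gainWeight_eq, weight, weight, Matrix.mul_sub, Matrix.sub_mul]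
  module

theorem convergesLocallyQuadratically_gaussNewton (hγ : 0 < S.γ) (hD : (S.D * S.Dᵀ).PosDef)
    (hR : S.R.PosDef) (hKstar : Kstar ∈ S.feasible)
    (hopt : ∀ K ∈ S.feasible, S.cost Kstar ≤ S.cost K) :
    S.ConvergesLocallyQuadratically (S.gaussNewton (1 / 2)) S.feasible Kstar := by
  have hE := resid_eq_zero_of_isMin hγ hD hR hKstar hopt
  have himp := fun K hK => gaussNewton_improve (S := S) (K := K) hγ hD hR
    (by norm_num : (0 : ℝ) < 1 / 2) le_rfl hK
  obtain ⟨c₀, hc₀, hcost⟩ := exists_trace_le_cost_sub hγ hD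
  obtain ⟨c₁, hc₁, hev₁⟩ := eventually_trace_le_norm_sq hγ hD hKstar hE
  obtain ⟨c₂, hc₂, hev₂⟩ := eventually_cost_sub_le hγ hD hKstar hE
  obtain ⟨c₃, hc₃, hev₃⟩ := eventually_norm_improved_sub_le hγ hD hR hKstar hE
  set step := S.gaussNewton (1 / 2) with hstep
  -- The cost estimate needs quadratic growth at the next iterate, so the step must map a feasible
  -- neighbourhood of `K*` into the one where that bound holds.
  have hlim : Tendsto step (𝓝[S.feasible] Kstar) (𝓝[S.feasible] Kstar) := by
    refine tendsto_nhdsWithin_iff.mpr ⟨?_, ?_⟩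
    · rw [tendsto_iff_norm_sub_tendsto_zero]
      have h1 := (Matrix.continuous_trace.tendsto _).comp
        ((tendsto_riccatiSol hγ hD hKstar hE).sub_const (S.riccatiSol Kstar))
      have h2 := h1.const_mul c₃
      rw [sub_self, Matrix.trace_zero, mul_zero] at h2
      exact squeeze_zero' (Eventually.of_forall fun _ => norm_nonneg _) hev₃ h2
    · filter_upwards [self_mem_nhdsWithin] with K hK using (himp K hK).1
  have hall := (hev₁.and hev₃).and ((hlim.eventually hev₁).and (hlim.eventually hev₂))
  rw [eventually_nhdsWithin_iff, Metric.eventually_nhds_iff] at hall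
  obtain ⟨r, hr, hball⟩ := hall
  refine ⟨max (c₃ * c₁) (c₂ * c₁ * c₃ ^ 2 / c₀ ^ 2), r, by positivity, hr, fun K₀ hK₀ => ?_⟩
  have hf : ∀ k, step^[k] K₀ ∈ S.feasible := by
    intro k
    induction k with
    | zero => exact hK₀
    | succ k ih =>
      rw [Function.iterate_succ_apply']
      exact (himp _ ih).1
  have hconv := (tendsto_of_decrease hγ hD hR hKstar hE hf
    (by norm_num : (0 : ℝ) < 4 * (1 / 2) * (1 - 1 / 2)) fun k => by
      rw [Function.iterate_succ_apply']
      exact (himp _ (hf k)).2).1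
  refine ⟨hconv, fun k hk => ?_⟩
  have hKf := hf k
  rw [Function.iterate_succ_apply']
  set K := step^[k] K₀ with hK
  obtain ⟨⟨h1, h3⟩, h1', h2'⟩ := hball (by rwa [dist_eq_norm]) hKf
  set T := (S.riccatiSol K - S.riccatiSol Kstar).trace with hT
  have hΔ := sub_posSemidef_of_feasible hγ hD hKstar hE hKf
  have hT0 : 0 ≤ T := hΔ.trace_nonneg
  have h4 := hcost K hKf Kstar hKstar hΔ
  have hgap : 0 ≤ S.cost K - S.cost Kstar := sub_nonneg.mpr (hopt K hKf)
  constructor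
  · calc ‖step K - Kstar‖ ≤ c₃ * (c₁ * ‖K - Kstar‖ ^ 2) := h3.trans (by gcongr)
      _ = (c₃ * c₁) * ‖K - Kstar‖ ^ 2 := by ring
      _ ≤ _ := by gcongr; exact le_max_left _ _
  · have h5 : T ≤ (S.cost K - S.cost Kstar) / c₀ := by
      rw [le_div_iff₀ hc₀]
      linarith
    calc S.cost (step K) - S.cost Kstar
        ≤ c₂ * (c₁ * ‖step K - Kstar‖ ^ 2) := h2'.trans (by gcongr)
      _ ≤ c₂ * (c₁ * (c₃ * ((S.cost K - S.cost Kstar) / c₀)) ^ 2) := by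
          gcongr
          exact h3.trans (by gcongr)
      _ = c₂ * c₁ * c₃ ^ 2 / c₀ ^ 2 * (S.cost K - S.cost Kstar) ^ 2 := by
          field_simp
      _ ≤ _ := by gcongr; exact le_max_right _ _

end MixedDesign

theorem theorem4p3 {m d n l : ℕ} (S : MixedDesign m d n l)
    (hγ : 0 < S.γ)
    (hEC : S.Eᵀ * S.C = 0) (hR : S.R.PosDef)
    (hD : (S.D * S.Dᵀ).PosDef)
    (Kstar : Matrix (Fin d) (Fin m) ℝ) (hKstar : Kstar ∈ S.feasible)
    (hopt : ∀ K ∈ S.feasible, S.cost Kstar ≤ S.cost K) :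
    Kstar = (S.gainWeight Kstar)⁻¹ * (S.Bᵀ * S.tildeP Kstar * S.A) ∧
    (∀ η : ℝ, 0 < η →
      S.ConvergesLocallyLinearly (S.naturalPG η)
        {K₀ | K₀ ∈ S.feasible ∧ 2 * η * ‖S.gainWeight K₀‖ ≤ 1} Kstar) ∧
    (∀ η : ℝ, 0 < η → η ≤ 1 / 2 →
      S.ConvergesLocallyLinearly (S.gaussNewton η) S.feasible Kstar) ∧
    S.ConvergesLocallyQuadratically (S.gaussNewton (1 / 2)) S.feasible Kstar := by
  have hst := MixedDesign.stabilizing_riccatiSol hγ hD hKstar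
  refine ⟨MixedDesign.eq_of_resid_eq_zero
      (MixedDesign.weight_posDef hR hst.posSemidef hst.posDef)
      (MixedDesign.resid_eq_zero_of_isMin hγ hD hR hKstar hopt),
    fun η hη => ?_, fun η hη hη' => ?_,
    MixedDesign.convergesLocallyQuadratically_gaussNewton hγ hD hR hKstar hopt⟩
  · obtain ⟨ε, hε, hRε⟩ := hR.exists_sub_smul_one
    refine MixedDesign.convergesLocallyLinearly_of_decrease hγ hD hR hKstar hopt
      -- The Loewner form of the step-size condition is the one that passes directly from an iterate
      -- to the next.
      (inv := {K | K ∈ S.feasible ∧ (1 - (2 * η) • S.gainWeight K).PosSemidef})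
      (fun K hK => ⟨hK.1, ?_⟩) (fun K hK => hK.1)
      (fun K hK => (MixedDesign.naturalPG_improve hγ hD hR hη hε hRε hK.1 hK.2).1)
      (by positivity : 0 < 2 * η * ε)
      (fun K hK => (MixedDesign.naturalPG_improve hγ hD hR hη hε hRε hK.1 hK.2).2)
    have h := MixedDesign.stabilizing_riccatiSol hγ hD hK.1
    have hG : (S.gainWeight K).PosDef := MixedDesign.weight_posDef hR h.posSemidef h.posDef
    have h1 := Matrix.PosSemidef.smul_one_of_norm_le (X := (2 * η) • S.gainWeight K) (c := 1)
      (by rw [Matrix.transpose_smul, hG.transpose_eq])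
      (by
        rw [norm_smul, Real.norm_of_nonneg (by positivity)]
        exact hK.2)
    rwa [one_smul] at h1
  · have ha : 0 < 4 * η * (1 - η) := by nlinarith
    exact MixedDesign.convergesLocallyLinearly_of_decrease hγ hD hR hKstar hopt
      (inv := S.feasible) subset_rfl subset_rfl
      (fun K hK => (MixedDesign.gaussNewton_improve hγ hD hR hη hη' hK).1) ha
      (fun K hK => (MixedDesign.gaussNewton_improve hγ hD hR hη hη' hK).2)
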